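/- Let $E_{64}$ be the elliptic curve over $\mathbb{Q}$ of conductor $64$ given by $y^2 = x^3 - 4x$, and let $L(E_{64},s)$ be its Hasse–Weil $L$-function, that is, the Dirichlet series of the Euler product over all primes (absolutely convergent for $\mathrm{Re}(s) > 3/2$). Then $$L(E_{64},2) = \frac{\sqrt{\pi}\,\Gamma\left(\frac14\right)^2}{32}\; {}_3F_2\left[\begin{matrix}\frac14,\frac14,1\\ \frac12,\frac54\end{matrix}\,\middle|\,1\right] - \frac{\sqrt{\pi}\,\Gamma\left(\frac34\right)^2}{48}\; {}_3F_2\left[\begin{matrix}\frac34,\frac34,1\\ \frac32,\frac74\end{matrix}\,\middle|\,1\right],$$ where $${}_3F_2\left[\begin{matrix}a,b,c\\ e,f\end{matrix}\,\middle|\,z\right] := \sum_{n=0}^{\infty}\frac{(a)_n(b)_n(c)_n}{(e)_n(f)_n}\frac{z^n}{n!}, \qquad (t)_n := \frac{\Gamma(t+n)}{\Gamma(t)} = t(t+1)\cdots(t+n-1).$$ The Dirichlet series of $L(E_{64},s)$ at $s=2$ and both hypergeometric series at $z=1$ converge absolutely. -/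

import Mathlib

/-- The `n`-th term `(a)_n (b)_n (c)_n / ((e)_n (f)_n) * z ^ n / n!` of the generalized
hypergeometric series `₃F₂[a, b, c; e, f | z]`. Here `(t)_n = t (t + 1) ⋯ (t + n - 1)` is the
Pochhammer symbol, which equals `Γ(t + n) / Γ(t)` for `t > 0`. -/
noncomputable def hypergeometricTerm₃F₂ (a b c e f z : ℝ) (n : ℕ) : ℝ :=
  (ascPochhammer ℝ n).eval a * (ascPochhammer ℝ n).eval b * (ascPochhammer ℝ n).eval c /
    ((ascPochhammer ℝ n).eval e * (ascPochhammer ℝ n).eval f) * (z ^ n / (n.factorial : ℝ))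

/-- The value of the generalized hypergeometric series `₃F₂[a, b, c; e, f | z]`. -/
noncomputable def hypergeometric₃F₂ (a b c e f z : ℝ) : ℝ :=
  ∑' n : ℕ, hypergeometricTerm₃F₂ a b c e f z n

/-- The elliptic curve `y² = x³ - 4x` over `ℚ`, of conductor 64. -/
def curveE64 : WeierstrassCurve ℚ where
  a₁ := 0
  a₂ := 0
  a₃ := 0
  a₄ := -4
  a₆ := 0

/-! The curve has complex multiplication by ℤ[i], so its n-th Dirichlet coefficient is Σ Re α over
the Gaussian integers α of norm n congruent to 1 or 1 + 2i modulo 4. Jacobsthal sums give the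
coefficients at primes, and the recursion a(pn) = a(p) a(n) - p a(n/p) at odd p gives the rest
(`LFunction_curveE64_apply`). Hence L(E, 2) is the absolutely convergent lattice sum Σ Re α / N(α)².

Put A(t) = θ₂θ₃/2 = Σ (-1)^j exp(-π(2i+1)(2j+1)t/4), an equality that counts primary Gaussian
integers of given norm in two ways. Up to √t, the inversion t ↦ 1/t exchanges θ₂ with θ₄ and fixes
θ₃, so A(1/u)A(u) = u θ₂θ₃²θ₄/4. As θ₂θ₃θ₄/2 = Σ (4k+1) exp(-π(4k+1)²u/4), integrating over u > 0
yields (8/π²) L(E, 2) (`integral_oddLambert_inv_mul_self`).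

The method of Rogers and Zudilin expands A(1/u)A(u) over four odd indices and rescales u, term by
term, by the ratio of two of them. A product of two series of weight one becomes a product of
weights zero and two (`integral_oddLambert_mul_oddLambert`). For v = θ₂/θ₃ the weight-zero series
are artanh(v)/2 and arctan(v)/2, by the Jacobi triple product, and the weight-two series are their
derivatives up to a constant. Since t ↦ 1/t sends v to w = (1 - v⁴)^(1/4), taking v as the variable
and adding the two versions gives (16/π) L(E, 2) = ∫₀¹ (artanh(w)/(1+v²) + arctan(w)/(1-v²)) dv
(`integral_artanh_add_arctan`).

The sum is what makes the integral computable: w^(2n+1)/(2n+1) has coefficient 1/(1+v²) ± 1/(1-v²),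
equal to 2/(1-v⁴) or -2v²/(1-v⁴), so every term is a beta integral. Even and odd n produce the two
hypergeometric series. -/

section

/-! ### Local Euler factors of y² = x³ - 4x -/

open WeierstrassCurve Polynomial IsDedekindDomain

/-- The points of a Weierstrass curve over a field where all affine solutions are nonsingular. -/
theorem card_point_of_isElliptic {F : Type*} [Field F] [Finite F] (W : WeierstrassCurve F)
    [W.IsElliptic] :
    Nat.card W.toAffine.Point = Nat.card {q : F × F // W.toAffine.Equation q.1 q.2} + 1 := by
  rw [← Finite.card_option]
  refine Nat.card_congr
    { toFun := fun P => match P with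
        | .zero => none
        | .some x y h => some ⟨(x, y), h.1⟩
      invFun := fun o => match o with
        | none => .zero
        | some q => .some q.1.1 q.1.2 (Affine.equation_iff_nonsingular.mp q.2)
      left_inv := ?_
      right_inv := ?_ }
  · rintro (_ | _) <;> rfl
  · rintro (_ | _) <;> rfl

/-- Completing the square on the affine equation of a Weierstrass curve. -/
theorem card_equation_eq_card_completeSquare {F : Type*} [Field F] (h2 : (2 : F) ≠ 0)
    (W : WeierstrassCurve F) :
    Nat.card {q : F × F // W.toAffine.Equation q.1 q.2} =
      Nat.card {q : F × F // q.2 ^ 2 = 4 * q.1 ^ 3 + W.b₂ * q.1 ^ 2 + 2 * W.b₄ * q.1 + W.b₆} := by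
  refine Nat.card_congr
    { toFun := fun q => ⟨(q.1.1, 2 * q.1.2 + W.a₁ * q.1.1 + W.a₃), ?_⟩
      invFun := fun q => ⟨(q.1.1, (q.1.2 - W.a₁ * q.1.1 - W.a₃) / 2), ?_⟩
      left_inv := ?_
      right_inv := ?_ }
  · obtain ⟨⟨x, y⟩, h⟩ := q
    rw [Affine.equation_iff] at h
    simp only [b₂, b₄, b₆] at h ⊢
    linear_combination 4 * h
  · obtain ⟨⟨x, y⟩, h⟩ := q
    rw [Affine.equation_iff]
    simp only [b₂, b₄, b₆] at h ⊢
    field_simp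
    linear_combination h
  · rintro ⟨⟨x, y⟩, h⟩
    simp only [Subtype.mk.injEq, Prod.mk.injEq, true_and]
    field_simp
    ring
  · rintro ⟨⟨x, y⟩, h⟩
    simp only [Subtype.mk.injEq, Prod.mk.injEq, true_and]
    field_simp
    ring

/-- The hypotheses are the transformation law of the b-invariants under x ↦ u²x + r, starting from
(0, -8, 0). They are free of denominators so that they can be reduced modulo the maximal ideal. -/
theorem card_completeSquare_eq {F : Type*} [Field F] (h2 : (2 : F) ≠ 0) {u r b₂ b₄ b₆ : F}
    (hu : u ≠ 0) (h₂ : u ^ 2 * b₂ = 12 * r) (h₄ : u ^ 4 * b₄ = 6 * r ^ 2 - 8)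
    (h₆ : u ^ 6 * b₆ = 4 * r ^ 3 - 16 * r) :
    Nat.card {q : F × F // q.2 ^ 2 = 4 * q.1 ^ 3 + b₂ * q.1 ^ 2 + 2 * b₄ * q.1 + b₆} =
      Nat.card {q : F × F // q.2 ^ 2 = q.1 ^ 3 - 4 * q.1} := by
  refine Nat.card_congr
    { toFun := fun q => ⟨(u ^ 2 * q.1.1 + r, u ^ 3 * q.1.2 / 2), ?_⟩
      invFun := fun q => ⟨((q.1.1 - r) / u ^ 2, 2 * q.1.2 / u ^ 3), ?_⟩
      left_inv := ?_
      right_inv := ?_ }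
  · obtain ⟨⟨x, y⟩, h⟩ := q
    simp only at h ⊢
    field_simp
    linear_combination u ^ 6 * h + x ^ 2 * u ^ 4 * h₂ + 2 * x * u ^ 2 * h₄ + h₆
  · obtain ⟨⟨x, y⟩, h⟩ := q
    simp only at h ⊢
    apply mul_left_cancel₀ (pow_ne_zero 6 hu)
    have e1 : u ^ 6 * (2 * y / u ^ 3) ^ 2 = 4 * y ^ 2 := by field_simp; ring
    have e2 : u ^ 6 * (4 * ((x - r) / u ^ 2) ^ 3 + b₂ * ((x - r) / u ^ 2) ^ 2 +
        2 * b₄ * ((x - r) / u ^ 2) + b₆) =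
        4 * (x - r) ^ 3 + (u ^ 2 * b₂) * (x - r) ^ 2 + 2 * (u ^ 4 * b₄) * (x - r) + u ^ 6 * b₆ := by
      field_simp
    rw [e1, e2, h₂, h₄, h₆]
    linear_combination 4 * h
  · rintro ⟨⟨x, y⟩, h⟩
    simp only [Subtype.mk.injEq, Prod.mk.injEq]
    constructor <;> field_simp <;> ring
  · rintro ⟨⟨x, y⟩, h⟩
    simp only [Subtype.mk.injEq, Prod.mk.injEq]
    constructor <;> field_simp <;> ring

theorem card_curve_ringEquiv {F G : Type*} [Field F] [Field G] (e : F ≃+* G) :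
    Nat.card {q : F × F // q.2 ^ 2 = q.1 ^ 3 - 4 * q.1} =
      Nat.card {q : G × G // q.2 ^ 2 = q.1 ^ 3 - 4 * q.1} := by
  refine Nat.card_congr ((e.toEquiv.prodCongr e.toEquiv).subtypeEquiv ?_)
  rintro ⟨x, y⟩
  simp only [RingEquiv.toEquiv_eq_coe, Equiv.prodCongr_apply, EquivLike.coe_coe, Prod.map_apply]
  rw [← e.injective.eq_iff, map_pow, map_sub, map_pow, map_mul, map_ofNat e 4]

/-- The equation `y² = x³ - 4x` over a field. -/
def curveMinusFour (K : Type*) [Field K] : WeierstrassCurve K := ⟨0, 0, 0, -4, 0⟩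

theorem isIntegral_curveMinusFour {R K : Type*} [CommRing R] [Field K] [Algebra R K] :
    IsIntegral R (curveMinusFour K) :=
  ⟨⟨0, 0, 0, -4, 0⟩, by
    ext <;> simp [curveMinusFour, WeierstrassCurve.baseChange, WeierstrassCurve.map,
      map_ofNat (algebraMap R K) 4]⟩

section Local

variable {R : Type*} [CommRing R] [IsDomain R] [IsDiscreteValuationRing R] {K : Type*}
  [Field K] [Algebra R K] [IsFractionRing R K]

open IsDiscreteValuationRing

theorem valuation_eq_one_iff_isUnit (x : R) :
    (maximalIdeal R).valuation K (algebraMap R K x) = 1 ↔ IsUnit x := by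
  have h1 := (maximalIdeal R).valuation_le_one (K := K) x
  have h2 := (maximalIdeal R).valuation_lt_one_iff_mem (K := K) x
  have h3 : x ∈ (maximalIdeal R).asIdeal ↔ ¬ IsUnit x := IsLocalRing.mem_maximalIdeal x
  rw [h3] at h2
  constructor
  · intro h
    by_contra hx
    exact absurd (h2.mpr hx) (by simp [h])
  · intro hx
    exact le_antisymm h1 (not_lt.mp fun h => h2.mp h hx)

theorem curveMinusFour_Δ : (curveMinusFour K).Δ = 4096 := by
  simp [curveMinusFour, WeierstrassCurve.Δ, b₂, b₄, b₆, b₈]; norm_num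

theorem exists_minimal_eq_smul (W : WeierstrassCurve K) :
    ∃ C : VariableChange K, W.minimal R = C • W := ⟨_, rfl⟩

/-- The given equation is integral with unit discriminant 2¹². Maximality of the minimal model,
tested against the change of variables leading back to that equation, leaves its discriminant no
choice but to be a unit. -/
theorem hasGoodReduction_minimal (h2 : IsUnit (2 : R)) :
    ((curveMinusFour K).minimal R).HasGoodReduction R := by
  obtain ⟨C, hC⟩ := exists_minimal_eq_smul (R := R) (curveMinusFour K)
  have hmin : IsMinimal R ((curveMinusFour K).minimal R) := inferInstance
  have hint := isIntegral_curveMinusFour (R := R) (K := K)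
  have hval : (maximalIdeal R).valuation K (curveMinusFour K).Δ = 1 := by
    have h : IsUnit (4096 : R) := by
      rw [show (4096 : R) = 2 ^ 12 by norm_num]
      exact h2.pow 12
    rwa [curveMinusFour_Δ, ← map_ofNat (algebraMap R K) 4096, valuation_eq_one_iff_isUnit]
  have hinv : C⁻¹ • (curveMinusFour K).minimal R = curveMinusFour K := by rw [hC, inv_smul_smul]
  refine ⟨?_⟩
  have key := hmin.val_Δ_maximal.2 (j := C⁻¹) (by simpa only [hinv] using hint)
  simp only [one_smul, hinv] at key
  have h1 : ((valuation_Δ_aux R (curveMinusFour K) : WithZero (Multiplicative ℤ))) = 1 := by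
    rw [valuation_Δ_aux_eq_of_isIntegral, hval]
  have h3 := key (by
    rw [← Subtype.coe_le_coe, h1]; exact (valuation_Δ_aux R _).2)
  rw [← Subtype.coe_le_coe, h1, valuation_Δ_aux_eq_of_isIntegral] at h3
  refine le_antisymm ?_ h3
  rw [← valuation_Δ_aux_eq_of_isIntegral]
  exact (valuation_Δ_aux R _).2

/-- The minimal model is known only up to a change of variables (u, r, s, t) over K. Good reduction
makes u a unit of R and r an element of R, so the relations between the b-invariants descend to the
residue field; s and t disappear when the square is completed. -/
theorem card_reduction_minimal [Finite (IsLocalRing.ResidueField R)] (h2 : IsUnit (2 : R)) :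
    Nat.card (((curveMinusFour K).minimal R).reduction R).toAffine.Point =
      Nat.card {q : IsLocalRing.ResidueField R × IsLocalRing.ResidueField R //
        q.2 ^ 2 = q.1 ^ 3 - 4 * q.1} + 1 := by
  have hgood := hasGoodReduction_minimal (K := K) h2
  have hell := hasGoodReduction_iff_isElliptic_reduction R |>.mp hgood
  have h2' : (2 : IsLocalRing.ResidueField R) ≠ 0 := by
    have := (h2.map (IsLocalRing.residue R)).ne_zero
    rwa [map_ofNat (IsLocalRing.residue R) 2] at this
  rw [card_point_of_isElliptic, card_equation_eq_card_completeSquare h2']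
  obtain ⟨C, hC⟩ := exists_minimal_eq_smul (R := R) (curveMinusFour K)
  set W' := (curveMinusFour K).minimal R with hW'
  have hinj := IsFractionRing.injective R K
  have hΔ : (C.u : K)⁻¹ ^ 12 * 4096 = W'.Δ := by
    rw [hC, variableChange_Δ, curveMinusFour_Δ]; simp
  set I := integralModel R W' with hI
  have hu0 : (C.u : K) ≠ 0 := C.u.ne_zero
  have hIΔ : IsUnit I.Δ := by
    rw [← valuation_eq_one_iff_isUnit (K := K), hI, integralModel_Δ_eq]
    exact hgood.goodReduction
  obtain ⟨d, hd⟩ := hIΔ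
  have hd' : algebraMap R K (↑d⁻¹ : R) * algebraMap R K I.Δ = 1 := by
    rw [← map_mul, ← hd]; simp
  have hu12 : (C.u : K) ^ 12 * algebraMap R K I.Δ = 4096 := by
    rw [hI, integralModel_Δ_eq, ← hΔ]; field_simp
  obtain ⟨U, hU⟩ : ∃ U : R, algebraMap R K U = C.u := by
    -- From u¹²Δ' = 2¹² with Δ' a unit of R, u is a root of a monic polynomial over R.
    refine IsIntegrallyClosed.algebraMap_eq_of_integral
      ⟨X ^ 12 - Polynomial.C (4096 * (↑d⁻¹ : R)), by monicity!, ?_⟩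
    simp only [eval₂_sub, eval₂_pow, eval₂_X, eval₂_C]
    rw [map_mul, map_ofNat (algebraMap R K) 4096]
    linear_combination algebraMap R K (↑d⁻¹ : R) * hu12 - (C.u : K) ^ 12 * hd'
  have hUu : IsUnit U := by
    have h : U ^ 12 * I.Δ = 4096 := by
      apply hinj
      rw [map_mul, map_pow, hU, hu12, map_ofNat (algebraMap R K) 4096]
    have h' : IsUnit (U ^ 12 * I.Δ) := by
      rw [h, show (4096 : R) = 2 ^ 12 by norm_num]
      exact h2.pow 12
    exact (isUnit_pow_iff (by norm_num)).mp (isUnit_of_mul_isUnit_left h')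
  have e2 : (C.u : K) ^ 2 * algebraMap R K I.b₂ = 12 * C.r := by
    rw [hI, integralModel_b₂_eq, hC, variableChange_b₂]
    simp [curveMinusFour, b₂]
  have e4 : (C.u : K) ^ 4 * algebraMap R K I.b₄ = 6 * C.r ^ 2 - 8 := by
    rw [hI, integralModel_b₄_eq, hC, variableChange_b₄]
    simp [curveMinusFour, b₂, b₄]; field_simp; ring
  have e6 : (C.u : K) ^ 6 * algebraMap R K I.b₆ = 4 * C.r ^ 3 - 16 * C.r := by
    rw [hI, integralModel_b₆_eq, hC, variableChange_b₆]
    simp [curveMinusFour, b₂, b₄, b₆]; field_simp; ring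
  obtain ⟨r, hr⟩ : ∃ r : R, algebraMap R K r = C.r := by
    obtain ⟨q, hq⟩ := h2
    have hq' : algebraMap R K (↑q⁻¹ : R) * 2 = 1 := by
      rw [show (2 : K) = algebraMap R K 2 by rw [map_ofNat (algebraMap R K) 2], ← map_mul, ← hq, Units.inv_mul, map_one]
    -- Dividing the b₆ relation by 4 exhibits r as a root of the monic cubic X³ - 4X - u⁶b₆/4.
    refine IsIntegrallyClosed.algebraMap_eq_of_integral
      ⟨X ^ 3 - Polynomial.C 4 * X - Polynomial.C ((↑q⁻¹ : R) ^ 2 * U ^ 6 * I.b₆), ?_, ?_⟩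
    · monicity!
    · simp only [eval₂_sub, eval₂_mul, eval₂_pow, eval₂_X, eval₂_C, map_mul, map_pow, hU]
      rw [map_ofNat (algebraMap R K) 4]
      linear_combination (- (algebraMap R K (↑q⁻¹ : R)) ^ 2) * e6 -
        (C.r ^ 3 - 4 * C.r) * (algebraMap R K (↑q⁻¹ : R) * 2 + 1) * hq'
  have f2 : U ^ 2 * I.b₂ = 12 * r := by
    apply hinj; simp only [map_mul, map_pow, hU, hr, e2]; rw [map_ofNat (algebraMap R K) 12]
  have f4 : U ^ 4 * I.b₄ = 6 * r ^ 2 - 8 := by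
    apply hinj; simp only [map_mul, map_sub, map_pow, hU, hr, e4]
    rw [map_ofNat (algebraMap R K) 6, map_ofNat (algebraMap R K) 8]
  have f6 : U ^ 6 * I.b₆ = 4 * r ^ 3 - 16 * r := by
    apply hinj; simp only [map_mul, map_sub, map_pow, hU, hr, e6]
    rw [map_ofNat (algebraMap R K) 4, map_ofNat (algebraMap R K) 16]
  congr 1
  have hred : W'.reduction R = I.map (IsLocalRing.residue R) := rfl
  rw [hred, map_b₂, map_b₄, map_b₆]
  refine card_completeSquare_eq h2' (u := IsLocalRing.residue R U) (r := IsLocalRing.residue R r)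
    (hUu.map _).ne_zero ?_ ?_ ?_
  · rw [← map_pow, ← map_mul, f2, map_mul, map_ofNat (IsLocalRing.residue R) 12]
  · rw [← map_pow, ← map_mul, f4, map_sub, map_mul, map_pow, map_ofNat (IsLocalRing.residue R) 6,
      map_ofNat (IsLocalRing.residue R) 8]
  · rw [← map_pow, ← map_mul, f6, map_sub, map_mul, map_mul, map_pow, map_ofNat (IsLocalRing.residue R) 4,
      map_ofNat (IsLocalRing.residue R) 16]

theorem localPolynomial_of_isUnit_two {p : ℕ} [Fact p.Prime] (h2 : IsUnit (2 : R))
    (e : IsLocalRing.ResidueField R ≃+* ZMod p) :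
    (curveMinusFour K).localPolynomial R =
      1 - C ((p : ℤ) - Nat.card {q : ZMod p × ZMod p // q.2 ^ 2 = q.1 ^ 3 - 4 * q.1}) * X +
        C (p : ℤ) * X ^ 2 := by
  have : Finite (IsLocalRing.ResidueField R) := .of_equiv _ e.symm.toEquiv
  have hcard : Nat.card (IsLocalRing.ResidueField R) = p := by
    rw [Nat.card_congr e.toEquiv]; simp
  rw [localPolynomial, if_pos (hasGoodReduction_minimal h2), card_reduction_minimal h2,
    card_curve_ringEquiv e, hcard]
  congr 4
  push_cast
  ring

/-- Because c₆ = 0, every integral model has c₄³ = 1728Δ. This forces 2 to divide c₄, then b₂ and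
a₁, hence 16 to divide c₄, and finally 27Δ = 64m³. Both Δ and c₄ are non-units, so the reduction is
neither good nor multiplicative, whichever minimal model was chosen. -/
theorem localPolynomial_of_two_irreducible (hR : ∀ x : R, ¬ IsUnit x ↔ 2 ∣ x) (h2 : (2 : R) ≠ 0) :
    (curveMinusFour K).localPolynomial R = 1 := by
  obtain ⟨C, hC⟩ := exists_minimal_eq_smul (R := R) (curveMinusFour K)
  set W' := (curveMinusFour K).minimal R with hW'
  have hinj := IsFractionRing.injective R K
  set I := integralModel R W' with hI
  have hc6 : I.c₆ = 0 := by
    apply hinj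
    rw [hI, integralModel_c₆_eq, hC, variableChange_c₆]
    simp [curveMinusFour, c₆, b₂, b₄, b₆]
  have hrel := I.c_relation
  rw [hc6] at hrel
  have hn2 : ¬ IsUnit (2 : R) := (hR 2).mpr dvd_rfl
  have hp2 : Prime (2 : R) := by
    refine ⟨h2, hn2, fun a b hab => ?_⟩
    rw [← hR, ← hR]
    by_contra h
    push Not at h
    exact (hR _).mpr hab (h.1.mul h.2)
  have h27 : ¬ (2 : R) ∣ 27 := by
    rintro ⟨k, hk⟩
    exact hn2 (IsUnit.of_mul_eq_one (k - 13) (by linear_combination -hk))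
  have hdiv4 : ¬ IsUnit I.c₄ := by
    rw [hR]
    exact hp2.dvd_of_dvd_pow (n := 3) ⟨864 * I.Δ, by linear_combination -hrel⟩
  have hdivΔ : ¬ IsUnit I.Δ := by
    rw [hR]
    have hb2 : (2 : R) ∣ I.b₂ := by
      have : (2 : R) ∣ I.b₂ ^ 2 := by
        obtain ⟨k, hk⟩ := (hR _).mp hdiv4
        exact ⟨k + 12 * I.b₄, by rw [c₄] at hk; linear_combination hk⟩
      exact hp2.dvd_of_dvd_pow this
    have ha1 : (2 : R) ∣ I.a₁ := by
      obtain ⟨k, hk⟩ := hb2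
      exact hp2.dvd_of_dvd_pow (n := 2) ⟨k - 2 * I.a₂, by rw [b₂] at hk; linear_combination hk⟩
    obtain ⟨k, hk⟩ := ha1
    obtain ⟨m, hm⟩ : (16 : R) ∣ I.c₄ := by
      rw [c₄, b₂, b₄, hk]
      exact ⟨(k ^ 2 + I.a₂) ^ 2 - 3 * (I.a₄ + k * I.a₃), by ring⟩
    rw [hm] at hrel
    have h64 : (64 : R) ≠ 0 := by
      rw [show (64 : R) = 2 ^ 6 by norm_num]; exact pow_ne_zero 6 h2
    have : 27 * I.Δ = 64 * m ^ 3 :=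
      mul_left_cancel₀ h64 (by linear_combination hrel)
    exact (hp2.dvd_or_dvd ⟨32 * m ^ 3, by linear_combination this⟩).resolve_left h27
  have hng : ¬ W'.HasGoodReduction R := by
    intro h
    apply hdivΔ
    rw [← valuation_eq_one_iff_isUnit (K := K), hI, integralModel_Δ_eq]
    exact h.goodReduction
  have hnm : ¬ W'.HasMultiplicativeReduction R := by
    intro h
    apply hdiv4
    rw [← valuation_eq_one_iff_isUnit (K := K), hI, integralModel_c₄_eq]
    exact h.multiplicativeReduction
  rw [localPolynomial, if_neg hng, if_neg (fun h => hnm h.toHasMultiplicativeReduction),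
    if_neg hnm]

end Local

/-! ### Passage to the completions of ℚ -/

section Rational

open NumberField Rat.HeightOneSpectrum

/-- The number of affine points of `y² = x³ - 4x` over `ℤ/pℤ`. -/
noncomputable def affineCount (p : ℕ) : ℕ :=
  Nat.card {q : ZMod p × ZMod p // q.2 ^ 2 = q.1 ^ 3 - 4 * q.1}

open Classical in
/-- The polynomial of the Euler factor at `p` of the curve `y² = x³ - 4x`. -/
noncomputable def eulerPolynomial (p : ℕ) : ℤ[X] :=
  if p = 2 then 1 else 1 - C ((p : ℤ) - affineCount p) * X + C (p : ℤ) * X ^ 2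

theorem fact_primesEquiv (v : HeightOneSpectrum (𝓞 ℚ)) : Fact (primesEquiv v : ℕ).Prime :=
  ⟨(primesEquiv v).2⟩

/-- The completed ring of integers is ℤ_p, with residue field ℤ/p: there 2 generates the maximal
ideal if p = 2 and is a unit otherwise, so one of the two local computations applies. -/
theorem localEulerFactor_curveE64 (v : HeightOneSpectrum (𝓞 ℚ)) :
    (curveE64.baseChange (v.adicCompletion ℚ)).localEulerFactor (v.adicCompletionIntegers ℚ) =
      ArithmeticFunction.ofPowerSeries (primesEquiv v : ℕ)
        (PowerSeries.invOfUnit (eulerPolynomial (primesEquiv v : ℕ)) 1) := by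
  have := fact_primesEquiv v
  let e : v.adicCompletionIntegers ℚ ≃+* ℤ_[primesEquiv v] :=
    (adicCompletionIntegers.padicIntEquiv v).toRingEquiv
  let e' : IsLocalRing.ResidueField (v.adicCompletionIntegers ℚ) ≃+* ZMod (primesEquiv v : ℕ) :=
    (IsLocalRing.ResidueField.mapEquiv e).trans PadicInt.residueField
  have hcard : Nat.card (IsLocalRing.ResidueField (v.adicCompletionIntegers ℚ)) =
      (primesEquiv v : ℕ) := by
    rw [Nat.card_congr e'.toEquiv]; simp
  have hbase : curveE64.baseChange (v.adicCompletion ℚ) = curveMinusFour (v.adicCompletion ℚ) := by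
    ext <;> simp [curveE64, curveMinusFour, WeierstrassCurve.baseChange, WeierstrassCurve.map]
  have hunit : ∀ x : v.adicCompletionIntegers ℚ, ¬ IsUnit x ↔
      ((primesEquiv v : ℕ) : v.adicCompletionIntegers ℚ) ∣ x := by
    intro x
    rw [← MulEquiv.isUnit_map e, ← map_dvd_iff e, map_natCast, ← Ideal.mem_span_singleton,
      ← PadicInt.maximalIdeal_eq_span_p, IsLocalRing.mem_maximalIdeal]
    rfl
  rw [localEulerFactor, localPowerSeries, hcard, hbase]
  congr 3
  by_cases hp : (primesEquiv v : ℕ) = 2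
  · rw [eulerPolynomial, if_pos hp]
    rw [hp] at hunit
    refine localPolynomial_of_two_irreducible (by exact_mod_cast hunit) ?_
    intro h
    have : e 2 = 0 := by rw [h, map_zero]
    rw [map_ofNat e 2] at this
    exact two_ne_zero this
  · rw [eulerPolynomial, if_neg hp]
    refine localPolynomial_of_isUnit_two ?_ e'
    by_contra h
    rw [hunit, ← map_dvd_iff e, map_natCast, map_ofNat e 2] at h
    have h' : ((2 : ℤ) : ℤ_[primesEquiv v]) ∈ Ideal.span {((primesEquiv v : ℕ) : ℤ_[primesEquiv v])} := by
      rw [Ideal.mem_span_singleton]; exact_mod_cast h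
    rw [← pow_one ((primesEquiv v : ℕ) : ℤ_[primesEquiv v]), ← PadicInt.norm_le_pow_iff_mem_span_pow] at h'
    have h3 := (PadicInt.norm_int_le_pow_iff_dvd (p := (primesEquiv v : ℕ)) (k := 2) (n := 1)).mp h'
    have h4 : (primesEquiv v : ℕ) ∣ 2 := by
      rw [pow_one] at h3; exact_mod_cast h3
    exact hp ((Nat.prime_dvd_prime_iff_eq (primesEquiv v).2 Nat.prime_two).mp h4)

end Rational

end

/-! ### Jacobsthal sums and the number of points modulo p -/

section

open Finset

section JacobsthalSum

variable {F : Type*} [Field F] [Fintype F] [DecidableEq F]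

/-- The Jacobsthal sum `∑ χ(x) χ(x² + k)` of the quadratic character. -/
def jacobsthalSum (k : F) : ℤ := ∑ x : F, quadraticChar F x * quadraticChar F (x ^ 2 + k)

theorem quadraticChar_mul_self {a : F} (ha : a ≠ 0) :
    quadraticChar F a * quadraticChar F a = 1 := by
  rw [← map_mul, ← pow_two]; exact quadraticChar_sq_one' ha

theorem jacobsthalSum_mul_sq (k : F) {t : F} (ht : t ≠ 0) :
    jacobsthalSum (k * t ^ 2) = quadraticChar F t * jacobsthalSum k := by
  rw [jacobsthalSum, jacobsthalSum, mul_sum, ← Equiv.sum_comp (Equiv.mulLeft₀ t ht)]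
  refine sum_congr rfl fun x _ => ?_
  rw [show Equiv.mulLeft₀ t ht x = t * x from rfl, show (t * x) ^ 2 + k * t ^ 2 = t ^ 2 * (x ^ 2 + k) by ring, map_mul, map_mul,
    quadraticChar_sq_one' ht]
  ring

theorem sum_quadraticChar (hF : ringChar F ≠ 2) : ∑ x : F, quadraticChar F x = 0 :=
  quadraticChar_sum_zero hF

/-- After a shift the summand is χ(k)χ(k + c), which equals χ(1 + c/k) for k ≠ 0. If c ≠ 0 then 1 +
c/k runs through everything except 1, so the sum is -χ(1). -/
theorem sum_quadraticChar_add_mul_add (hF : ringChar F ≠ 2) (a b : F) :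
    ∑ k : F, quadraticChar F (k + a) * quadraticChar F (k + b) =
      if a = b then (Fintype.card F : ℤ) - 1 else -1 := by
  have hshift : ∑ k : F, quadraticChar F (k + a) * quadraticChar F (k + b) =
      ∑ k : F, quadraticChar F k * quadraticChar F (k + (b - a)) := by
    rw [← Equiv.sum_comp (Equiv.addRight a) (fun k => quadraticChar F k * quadraticChar F (k + (b - a)))]
    refine sum_congr rfl fun k _ => ?_
    simp
  rw [hshift]
  split_ifs with h
  · subst h
    simp only [sub_self, add_zero]
    rw [← sum_erase_add _ _ (mem_univ (0 : F)), sum_congr rfl (g := fun _ => (1 : ℤ))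
      (fun x hx => quadraticChar_mul_self (by simpa using hx))]
    simp [card_erase_of_mem, Nat.cast_sub Fintype.card_pos]
  · have hc : b - a ≠ 0 := sub_ne_zero.mpr (Ne.symm h)
    set c := b - a
    have hbij : ∑ k ∈ univ.erase (0 : F), quadraticChar F k * quadraticChar F (k + c) =
        ∑ u ∈ univ.erase (1 : F), quadraticChar F u := by
      refine sum_bij' (fun k _ => 1 + c / k) (fun u _ => c / (u - 1)) ?_ ?_ ?_ ?_ ?_
      · intro k hk; simp at hk ⊢; exact ⟨hc, hk⟩
      · intro u hu; simp at hu ⊢; exact ⟨hc, sub_ne_zero.mpr hu⟩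
      · intro k hk; simp at hk ⊢; field_simp
      · intro u hu; simp at hu ⊢; have := sub_ne_zero.mpr hu; field_simp; ring
      · intro k hk
        have hk : k ≠ 0 := by simpa using hk
        rw [show k + c = k * (1 + c / k) by field_simp, map_mul, ← mul_assoc,
          quadraticChar_mul_self hk, one_mul]
    rw [← sum_erase_add _ _ (mem_univ (0 : F)), hbij]
    have := sum_quadraticChar hF
    rw [← sum_erase_add _ _ (mem_univ (1 : F))] at this
    simp at this ⊢
    linarith

theorem jacobsthalSum_zero (hF : ringChar F ≠ 2) : jacobsthalSum (0 : F) = 0 := by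
  rw [jacobsthalSum, ← sum_quadraticChar hF]
  refine sum_congr rfl fun x _ => ?_
  by_cases hx : x = 0
  · simp [hx]
  · rw [add_zero, quadraticChar_sq_one' hx, mul_one]

/-- Open the square and sum over k first: apart from a term that cancels, only pairs with x² = y²
remain. For x ≠ 0 these are y = ±x, and both count +1 because χ(-1) = 1. -/
theorem sum_jacobsthalSum_sq (hF : ringChar F ≠ 2) (hneg : quadraticChar F (-1) = 1) :
    ∑ k : F, jacobsthalSum k ^ 2 = 2 * Fintype.card F * (Fintype.card F - 1) := by
  have h1 : ∀ k : F, jacobsthalSum k ^ 2 = ∑ x : F, ∑ y : F,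
      quadraticChar F (x * y) * (quadraticChar F (k + x ^ 2) * quadraticChar F (k + y ^ 2)) := by
    intro k
    rw [pow_two, jacobsthalSum, sum_mul_sum]
    refine sum_congr rfl fun x _ => sum_congr rfl fun y _ => ?_
    rw [map_mul, add_comm k, add_comm k]; ring
  have h2 : ∀ x y : F, ∑ k : F, quadraticChar F (x * y) *
      (quadraticChar F (k + x ^ 2) * quadraticChar F (k + y ^ 2)) =
      (if x ^ 2 = y ^ 2 then quadraticChar F (x * y) * Fintype.card F else 0) -
        quadraticChar F (x * y) := by
    intro x y
    rw [← mul_sum, sum_quadraticChar_add_mul_add hF]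
    split_ifs <;> ring
  rw [sum_congr rfl fun k _ => h1 k, sum_comm, sum_congr rfl fun x _ => sum_comm,
    sum_congr rfl fun x _ => sum_congr rfl fun y _ => h2 x y]
  simp_rw [sum_sub_distrib]
  have h3 : ∑ x : F, ∑ y : F, quadraticChar F (x * y) = 0 := by
    simp_rw [map_mul, ← mul_sum, sum_quadraticChar hF, mul_zero, sum_const_zero]
  rw [h3, sub_zero]
  have h4 : ∀ x : F, ∑ y : F, (if x ^ 2 = y ^ 2 then quadraticChar F (x * y) *
      (Fintype.card F : ℤ) else 0) = if x = 0 then 0 else 2 * (Fintype.card F : ℤ) := by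
    intro x
    split_ifs with hx
    · subst hx; simp
    · rw [← sum_filter]
      have : univ.filter (fun y : F => x ^ 2 = y ^ 2) = {x, -x} := by
        ext y
        simp [sq_eq_sq_iff_eq_or_eq_neg]
        constructor
        · rintro (h | h) <;> simp [h]
        · rintro (h | h) <;> simp [h]
      have hne : x ≠ -x := fun h => hx (by
        have h2 : (2 : F) ≠ 0 := Ring.two_ne_zero hF
        have : 2 * x = 0 := by linear_combination h
        exact (mul_eq_zero.mp this).resolve_left h2)
      rw [this, sum_pair hne, map_mul, quadraticChar_mul_self hx, ← neg_one_mul x,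
        show x * (-1 * x) = (-1) * (x * x) by ring, map_mul, map_mul, quadraticChar_mul_self hx, hneg]
      ring
  simp_rw [h4]
  rw [← sum_erase_add _ _ (mem_univ (0 : F)), sum_congr rfl (g := fun _ => 2 * (Fintype.card F : ℤ))
    (fun x hx => if_neg (by simpa using hx))]
  simp [card_erase_of_mem, Nat.cast_sub Fintype.card_pos]
  ring

/-- The square of the Jacobsthal sum depends only on the square class of k, so the second moment is
(q - 1)/2 times the left side. The weights 1 ± χ(k) below select the class. -/
theorem jacobsthalSum_one_sq_add_sq (hF : ringChar F ≠ 2) (hneg : quadraticChar F (-1) = 1) {g : F}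
    (hg : quadraticChar F g = -1) :
    jacobsthalSum (1 : F) ^ 2 + jacobsthalSum g ^ 2 = 4 * Fintype.card F := by
  have hg0 : g ≠ 0 := by rintro rfl; simp at hg
  have hsq : ∀ t : F, t ≠ 0 → ∀ k : F, jacobsthalSum (k * t ^ 2) ^ 2 = jacobsthalSum k ^ 2 := by
    intro t ht k
    rw [jacobsthalSum_mul_sq k ht, mul_pow, pow_two (quadraticChar F t), quadraticChar_mul_self ht,
      one_mul]
  have h1 : ∀ k ∈ univ.erase (0 : F), 2 * jacobsthalSum k ^ 2 =
      (1 + quadraticChar F k) * jacobsthalSum (1 : F) ^ 2 +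
        (1 - quadraticChar F k) * jacobsthalSum g ^ 2 := by
    intro k hk
    have hk : k ≠ 0 := by simpa using hk
    rcases quadraticChar_dichotomy hk with h | h
    · obtain ⟨t, ht⟩ := (quadraticChar_one_iff_isSquare hk).mp h
      have ht0 : t ≠ 0 := by rintro rfl; simp at ht; exact hk ht
      rw [h, ← hsq t ht0 1, one_mul, pow_two t, ← ht]; ring
    · have h' : quadraticChar F (k * g) = 1 := by rw [map_mul, h, hg]; norm_num
      obtain ⟨t, ht⟩ := (quadraticChar_one_iff_isSquare (mul_ne_zero hk hg0)).mp h'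
      have ht0 : t ≠ 0 := by rintro rfl; simp at ht; tauto
      have hkg : k = g * (t / g) ^ 2 := by field_simp; rw [ht]; ring
      rw [h, ← hsq (t / g) (div_ne_zero ht0 hg0) g, ← hkg]; ring
  have h2 := sum_congr rfl h1
  have hcard : (∑ _k ∈ univ.erase (0 : F), (1 : ℤ)) = Fintype.card F - 1 := by
    simp [card_erase_of_mem, Nat.cast_sub Fintype.card_pos]
  have hchar : ∑ k ∈ univ.erase (0 : F), quadraticChar F k = 0 := by
    have := sum_quadraticChar hF
    rw [← sum_erase_add _ _ (mem_univ (0 : F))] at this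
    simpa using this
  rw [sum_add_distrib, ← sum_mul, ← sum_mul, sum_add_distrib, sum_sub_distrib, hcard, hchar,
    ← mul_sum] at h2
  have h3 := sum_jacobsthalSum_sq hF hneg
  rw [← sum_erase_add _ _ (mem_univ (0 : F)), jacobsthalSum_zero hF] at h3
  have hc : (Fintype.card F : ℤ) - 1 ≠ 0 := by
    have := Fintype.one_lt_card (α := F)
    omega
  apply mul_left_cancel₀ hc
  linear_combination -h2 + 2 * h3

-- The maps x ↦ -x and x ↦ 1/x generate orbits of size four once x⁴ ≠ 1. Concretely, squaring is
-- two-to-one on N, and inversion has no fixed point on the squares.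
omit [Fintype F] in
theorem four_dvd_card_of_neg_inv_invariant (hF : ringChar F ≠ 2) (N : Finset F)
    (h0 : (0 : F) ∉ N) (hfix : ∀ x ∈ N, x ^ 4 ≠ 1)
    (hneg : ∀ x ∈ N, -x ∈ N) (hinv : ∀ x ∈ N, x⁻¹ ∈ N) : 4 ∣ N.card := by
  have h2 : (2 : F) ≠ 0 := Ring.two_ne_zero hF
  set N' := N.image (fun x => x ^ 2)
  have hfib : N.card = N'.card * 2 := by
    rw [card_eq_sum_card_image (fun x => x ^ 2) N, ← smul_eq_mul, ← sum_const]
    refine sum_congr rfl fun y hy => ?_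
    obtain ⟨x, hx, rfl⟩ := mem_image.mp hy
    have hne : x ≠ -x := fun h => h0 (by
      have : 2 * x = 0 := by linear_combination h
      rwa [(mul_eq_zero.mp this).resolve_left h2] at hx)
    refine Eq.trans (congrArg card ?_) (card_pair hne)
    ext z
    simp only [mem_filter, sq_eq_sq_iff_eq_or_eq_neg, mem_insert, mem_singleton]
    refine ⟨fun h => h.2, fun h => ⟨?_, h⟩⟩
    rcases h with rfl | rfl
    · exact hx
    · exact hneg _ hx
  have heven : 2 ∣ N'.card := by
    have : ∑ _y ∈ N', (1 : ZMod 2) = 0 := by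
      refine sum_involution (fun y _ => y⁻¹) (fun _ _ => by decide) ?_ ?_ ?_
      · intro y hy _
        obtain ⟨x, hx, rfl⟩ := mem_image.mp hy
        intro h
        have hx0 : x ≠ 0 := fun h => h0 (h ▸ hx)
        apply hfix x hx
        field_simp at h
        rw [h]
      · intro y hy
        obtain ⟨x, hx, rfl⟩ := mem_image.mp hy
        exact mem_image.mpr ⟨x⁻¹, hinv x hx, by simp⟩
      · intro y _; simp
    rw [← ZMod.natCast_eq_zero_iff]
    simpa using this
  omega


/-- The summand is invariant under x ↦ -x and x ↦ 1/x, so outside 0, ±1, ±i it takes the value -1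
exactly 4m times and +1 otherwise. Among the five exceptional points only ±1 contribute, χ(2) each.
-/
theorem exists_jacobsthalSum_one_eq (hF : ringChar F ≠ 2) (hneg : quadraticChar F (-1) = 1) :
    ∃ m : ℤ, jacobsthalSum (1 : F) = 2 * quadraticChar F 2 + Fintype.card F - 5 - 8 * m := by
  have h2 : (2 : F) ≠ 0 := Ring.two_ne_zero hF
  obtain ⟨i, hi⟩ := (quadraticChar_one_iff_isSquare (by simp)).mp hneg
  set f : F → ℤ := fun x => quadraticChar F x * quadraticChar F (x ^ 2 + 1) with hf
  set N := univ.filter fun x : F => f x = -1 ∧ x ^ 4 ≠ 1 with hN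
  set E := univ.filter fun x : F => x ≠ 0 ∧ x ^ 4 ≠ 1 with hE
  have hfneg : ∀ x, f (-x) = f x := by
    intro x
    simp only [hf]
    rw [← neg_one_mul x, map_mul, hneg, one_mul, mul_pow, neg_one_sq, one_mul]
  have hfinv : ∀ x, f x⁻¹ = f x := by
    intro x
    by_cases hx : x = 0
    · simp [hx]
    simp only [hf]
    rw [← map_mul, ← map_mul,
      show x⁻¹ * (x⁻¹ ^ 2 + 1) = (x⁻¹ ^ 2) ^ 2 * (x * (x ^ 2 + 1)) by field_simp; ring,
      map_mul, quadraticChar_sq_one' (pow_ne_zero 2 (inv_ne_zero hx)), one_mul]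
  have hN4 : 4 ∣ N.card := by
    refine four_dvd_card_of_neg_inv_invariant hF N ?_ ?_ ?_ ?_
    · simp [hN, hf]
    · intro x hx; exact (mem_filter.mp hx).2.2
    · intro x hx
      have := (mem_filter.mp hx).2
      refine mem_filter.mpr ⟨mem_univ _, by rw [hfneg]; exact this.1, ?_⟩
      rw [Even.neg_pow (by decide)]; exact this.2
    · intro x hx
      have := (mem_filter.mp hx).2
      refine mem_filter.mpr ⟨mem_univ _, by rw [hfinv]; exact this.1, ?_⟩
      rw [inv_pow]; simpa using this.2
  obtain ⟨m, hm⟩ := hN4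
  refine ⟨m, ?_⟩
  have hfE : ∀ x ∈ E, f x = 1 - 2 * if f x = -1 then 1 else 0 := by
    intro x hx
    obtain ⟨hx0, hx4⟩ := (mem_filter.mp hx).2
    have h1 : x ^ 2 + 1 ≠ 0 := fun h => hx4 (by linear_combination (x ^ 2 - 1) * h)
    have hfx : f x = 1 ∨ f x = -1 := by
      simp only [hf, ← map_mul]
      exact quadraticChar_dichotomy (mul_ne_zero hx0 h1)
    rcases hfx with h | h <;> rw [h] <;> norm_num
  have hEN : E.filter (fun x => f x = -1) = N := by
    ext x
    simp only [hE, hN, mem_filter, mem_univ, true_and]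
    constructor
    · rintro ⟨⟨_, h⟩, h'⟩; exact ⟨h', h⟩
    · rintro ⟨h', h⟩
      exact ⟨⟨by rintro rfl; simp [hf] at h', h⟩, h'⟩
  have hsumE : ∑ x ∈ E, f x = E.card - 8 * m := by
    rw [sum_congr rfl hfE, sum_sub_distrib, ← mul_sum, ← sum_filter, hEN]
    simp [hm]; ring
  have hi2 : i ^ 2 = -1 := by rw [pow_two, ← hi]
  have hi0 : i ≠ 0 := by rintro rfl; simp at hi2
  have hne : ∀ x : F, x ≠ 0 → x ≠ -x := fun x hx h => hx (by
    have : 2 * x = 0 := by linear_combination h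
    exact (mul_eq_zero.mp this).resolve_left h2)
  have hroots : univ \ E = {0, 1, -1, i, -i} := by
    ext x
    simp only [hE, mem_sdiff, mem_univ, mem_filter, true_and, mem_insert, mem_singleton, not_and,
      not_not]
    constructor
    · intro h
      by_cases hx : x = 0
      · exact Or.inl hx
      · have h' := h hx
        have : (x - 1) * ((x + 1) * ((x - i) * (x + i))) = 0 := by
          linear_combination h' - (x ^ 2 - 1) * hi2
        simp only [mul_eq_zero, sub_eq_zero, add_eq_zero_iff_eq_neg] at this
        exact Or.inr this
    · have hi4 : i ^ 4 = 1 := by linear_combination (i ^ 2 - 1) * hi2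
      rintro (rfl | rfl | rfl | rfl | rfl) h
      · exact absurd rfl h
      · simp
      · norm_num
      · exact hi4
      · rw [neg_pow, hi4]; norm_num
  have hi1 : i ≠ 1 := by
    rintro rfl; exact hne 1 one_ne_zero (by simpa using hi2)
  have hi1' : i ≠ -1 := by
    rintro rfl; exact hne 1 one_ne_zero (by simpa using hi2)
  have hn1 : (0 : F) ∉ ({1, -1, i, -i} : Finset F) := by
    simp [hi0, eq_comm (a := (0 : F))]
  have hn2 : (1 : F) ∉ ({-1, i, -i} : Finset F) := by
    simp only [mem_insert, mem_singleton, not_or]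
    exact ⟨hne 1 one_ne_zero, hi1.symm, fun h => hi1' (by rw [h, neg_neg])⟩
  have hn3 : (-1 : F) ∉ ({i, -i} : Finset F) := by
    simp only [mem_insert, mem_singleton, not_or]
    exact ⟨hi1'.symm, fun h => hi1 (neg_injective h).symm⟩
  have hn4 : i ∉ ({-i} : Finset F) := by simpa using hne i hi0
  have hcardE : (E.card : ℤ) = Fintype.card F - 5 := by
    have h5 : (univ \ E).card = 5 := by
      rw [hroots, card_insert_of_notMem hn1, card_insert_of_notMem hn2, card_insert_of_notMem hn3,
        card_insert_of_notMem hn4, card_singleton]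
    have := card_sdiff_add_card_eq_card (subset_univ E)
    rw [card_univ] at this
    omega
  have hrest : ∑ x ∈ univ \ E, f x = 2 * quadraticChar F 2 := by
    rw [hroots, sum_insert hn1, sum_insert hn2, sum_insert hn3, sum_insert hn4, sum_singleton,
      hfneg, hfneg]
    simp [hf, hi2]
    rw [show (1 : F) + 1 = 2 by norm_num]; ring
  have htot : jacobsthalSum (1 : F) = ∑ x ∈ univ \ E, f x + ∑ x ∈ E, f x :=
    (sum_sdiff (subset_univ E)).symm
  rw [htot, hrest, hsumE, hcardE]; ring

end JacobsthalSum

section PointCount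

variable (p : ℕ) [Fact p.Prime]

theorem affineCount_eq (hp : p ≠ 2) :
    (affineCount p : ℤ) = p + jacobsthalSum (-4 : ZMod p) := by
  have hF : ringChar (ZMod p) ≠ 2 := by rwa [ZMod.ringChar_zmod_n]
  have h1 : affineCount p = ∑ x : ZMod p, Fintype.card {y : ZMod p // y ^ 2 = x ^ 3 - 4 * x} := by
    rw [affineCount, ← Fintype.card_sigma, Nat.card_eq_fintype_card]
    refine Fintype.card_congr
      { toFun := fun q => ⟨q.1.1, q.1.2, q.2⟩
        invFun := fun q => ⟨(q.1, q.2.1), q.2.2⟩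
        left_inv := fun _ => rfl
        right_inv := fun _ => rfl }
  have h2 : ∀ a : ZMod p, (Fintype.card {y : ZMod p // y ^ 2 = a} : ℤ) =
      quadraticChar (ZMod p) a + 1 := by
    intro a
    rw [← quadraticChar_card_sqrts hF a, Set.toFinset_card]
    rfl
  rw [h1]
  push_cast
  simp_rw [h2, sum_add_distrib]
  simp only [sum_const, card_univ, ZMod.card, mul_one, nsmul_eq_mul]
  rw [add_comm, jacobsthalSum]
  congr 1
  refine sum_congr rfl fun x _ => ?_
  rw [← map_mul]
  congr 1
  ring

/-- Here χ(-1) = -1, so x ↦ -x turns the Jacobsthal sum into its negative. -/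
theorem affineCount_of_mod_four_eq_three (hp : p % 4 = 3) : affineCount p = p := by
  have hp2 : p ≠ 2 := by omega
  have hF : ringChar (ZMod p) ≠ 2 := by rwa [ZMod.ringChar_zmod_n]
  have hneg : quadraticChar (ZMod p) (-1) = -1 := by
    rw [quadraticChar_neg_one hF, ZMod.card, ZMod.χ₄_nat_three_mod_four hp]
  have h : jacobsthalSum (-4 : ZMod p) = - jacobsthalSum (-4 : ZMod p) := by
    conv_lhs => rw [show (-4 : ZMod p) = -4 * (-1) ^ 2 by ring,
      jacobsthalSum_mul_sq _ (neg_ne_zero.mpr one_ne_zero), hneg]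
    ring
  have := affineCount_eq p hp2
  omega

/-- The integers are a = -J(1)/2 and b = J(g)/2, with J the Jacobsthal sum and g a non-residue. The
sign of a is fixed by J(1) ≡ -2 mod 8, which holds in both classes of p modulo 8 since χ(2) changes
along with p. -/
theorem affineCount_of_mod_four_eq_one (hp : p % 4 = 1) :
    ∃ a b : ℤ, a % 4 = 1 ∧ b % 2 = 0 ∧ a ^ 2 + b ^ 2 = p ∧ (affineCount p : ℤ) = p - 2 * a := by
  have hp2 : p ≠ 2 := by omega
  have hF : ringChar (ZMod p) ≠ 2 := by rwa [ZMod.ringChar_zmod_n]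
  have h2 : (2 : ZMod p) ≠ 0 := Ring.two_ne_zero hF
  have hneg : quadraticChar (ZMod p) (-1) = 1 := by
    rw [quadraticChar_neg_one hF, ZMod.card, ZMod.χ₄_nat_one_mod_four hp]
  obtain ⟨i, hi⟩ := (quadraticChar_one_iff_isSquare (by simp)).mp hneg
  have hi0 : i ≠ 0 := by rintro rfl; simp at hi
  have hS : jacobsthalSum (-4 : ZMod p) = jacobsthalSum (1 : ZMod p) := by
    -- With i² = -1 one has -4 = (2i)², and 2i = (1 + i)² is itself a square, so no sign appears.
    rw [show (-4 : ZMod p) = 1 * (2 * i) ^ 2 by linear_combination 4 * hi,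
      jacobsthalSum_mul_sq _ (mul_ne_zero h2 hi0),
      show 2 * i = (1 + i) ^ 2 by linear_combination hi, quadraticChar_sq_one', one_mul]
    intro h
    apply mul_ne_zero h2 hi0
    linear_combination (1 + i) * h + hi
  obtain ⟨g, hg⟩ := quadraticChar_exists_neg_one hF
  have hsum := jacobsthalSum_one_sq_add_sq hF hneg hg
  obtain ⟨m, hm⟩ := exists_jacobsthalSum_one_eq hF hneg
  have hq2 := quadraticChar_two hF
  rw [ZMod.card] at hsum hm hq2
  have hcase : ∃ k : ℤ, jacobsthalSum (1 : ZMod p) = -2 + 8 * k := by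
    have h8 : p % 8 = 1 ∨ p % 8 = 5 := by omega
    rcases h8 with h8 | h8
    · have : quadraticChar (ZMod p) 2 = 1 := by
        rw [hq2, ← ZMod.natCast_mod p 8, h8]; decide
      rw [this] at hm
      exact ⟨(p : ℤ) / 8 - m, by omega⟩
    · have : quadraticChar (ZMod p) 2 = -1 := by
        rw [hq2, ← ZMod.natCast_mod p 8, h8]; decide
      rw [this] at hm
      exact ⟨(p : ℤ) / 8 - m, by omega⟩
  obtain ⟨k, hk⟩ := hcase
  have hgeven : Even (jacobsthalSum g) := by
    have : Even (jacobsthalSum g ^ 2) := by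
      rw [hk] at hsum
      exact ⟨2 * p - 2 * (-1 + 4 * k) ^ 2, by linear_combination hsum⟩
    exact (Int.even_pow.mp this).1
  obtain ⟨b, hb⟩ := hgeven
  have hab : (1 - 4 * k) ^ 2 + b ^ 2 = p := by
    rw [hk, hb] at hsum
    have : 4 * ((1 - 4 * k) ^ 2 + b ^ 2) = 4 * (p : ℤ) := by linear_combination hsum
    omega
  refine ⟨1 - 4 * k, b, by omega, ?_, hab, ?_⟩
  · have hb2 : Even (b ^ 2) := by
      have h : b ^ 2 = 2 * (2 * ((p : ℤ) / 4) + 4 * k - 8 * k ^ 2) := by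
        have : (p : ℤ) = 4 * ((p : ℤ) / 4) + 1 := by omega
        linear_combination hab + this
      rw [h]; exact even_two_mul _
    exact Int.even_iff.mp (Int.even_pow.mp hb2).1
  · rw [affineCount_eq p hp2, hS, hk]; ring

end PointCount

end

/-! ### Sums over primary Gaussian integers -/

section

open Finset

section PrimaryGaussian

/-- The Gaussian integers `a + bi` of norm `n` with `a ≡ 1 mod 4` and `b` even. -/
noncomputable def primaryOfNorm (n : ℕ) : Finset GaussianInt :=
  ((Icc (-(n : ℤ)) n ×ˢ Icc (-(n : ℤ)) n).image fun q => (⟨q.1, q.2⟩ : GaussianInt)).filter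
    fun α => α.re % 4 = 1 ∧ α.im % 2 = 0 ∧ α.norm = n

theorem gaussianInt_norm_eq (α : GaussianInt) : α.norm = α.re ^ 2 + α.im ^ 2 := by
  rw [Zsqrtd.norm]; ring

theorem mem_primaryOfNorm {n : ℕ} {α : GaussianInt} :
    α ∈ primaryOfNorm n ↔ α.re % 4 = 1 ∧ α.im % 2 = 0 ∧ α.norm = n := by
  rw [primaryOfNorm, mem_filter, and_iff_right_iff_imp]
  rintro ⟨-, -, h⟩
  rw [gaussianInt_norm_eq] at h
  have hre : |α.re| ≤ n := by
    rw [← h]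
    nlinarith [Int.le_self_sq |α.re|, sq_abs α.re, sq_nonneg α.im]
  have him : |α.im| ≤ n := by
    rw [← h]
    nlinarith [Int.le_self_sq |α.im|, sq_abs α.im, sq_nonneg α.re]
  rw [abs_le] at hre him
  exact mem_image.mpr ⟨(α.re, α.im), by simp [hre, him], rfl⟩

/-- The classes 1 and 1 + 2i form a subgroup of the units of ℤ[i]/4, so it is stable under
quotients. It meets {±1, ±i} only in 1, whence the normalization selects one associate of each
Gaussian integer of odd norm. -/
theorem primary_cancel {α β : GaussianInt} (hα : α.re % 4 = 1) (hα' : α.im % 2 = 0)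
    (h : (α * β).re % 4 = 1) (h' : (α * β).im % 2 = 0) : β.re % 4 = 1 ∧ β.im % 2 = 0 := by
  obtain ⟨a, ha⟩ : ∃ a, α.re = 4 * a + 1 := ⟨α.re / 4, by omega⟩
  obtain ⟨b, hb⟩ : ∃ b, α.im = 2 * b := ⟨α.im / 2, by omega⟩
  simp only [Zsqrtd.re_mul, Zsqrtd.im_mul, ha, hb] at h h'
  have him : β.im % 2 = 0 := by
    have : (4 * a + 1) * β.im + 2 * b * β.re = β.im + 2 * (2 * a * β.im + b * β.re) := by ring
    omega
  obtain ⟨y, hy⟩ : ∃ y, β.im = 2 * y := ⟨β.im / 2, by omega⟩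
  refine ⟨?_, him⟩
  have : (4 * a + 1) * β.re + -1 * (2 * b) * β.im = β.re + 4 * (a * β.re - b * y) := by
    rw [hy]; ring
  omega

theorem primary_mul {α β : GaussianInt} (hα : α.re % 4 = 1) (hα' : α.im % 2 = 0)
    (h : β.re % 4 = 1) (h' : β.im % 2 = 0) : (α * β).re % 4 = 1 ∧ (α * β).im % 2 = 0 := by
  obtain ⟨a, ha⟩ : ∃ a, α.re = 4 * a + 1 := ⟨α.re / 4, by omega⟩
  obtain ⟨b, hb⟩ : ∃ b, α.im = 2 * b := ⟨α.im / 2, by omega⟩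
  obtain ⟨x, hx⟩ : ∃ x, β.re = 4 * x + 1 := ⟨β.re / 4, by omega⟩
  obtain ⟨y, hy⟩ : ∃ y, β.im = 2 * y := ⟨β.im / 2, by omega⟩
  simp only [Zsqrtd.re_mul, Zsqrtd.im_mul, ha, hb, hx, hy]
  constructor
  · have : (4 * a + 1) * (4 * x + 1) + -1 * (2 * b) * (2 * y) =
      1 + 4 * (a * (4 * x + 1) + x - b * y) := by ring
    omega
  · have : (4 * a + 1) * (2 * y) + 2 * b * (4 * x + 1) =
      2 * ((4 * a + 1) * y + b * (4 * x + 1)) := by ring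
    omega

theorem mem_image_mul_primaryOfNorm {π α : GaussianInt} {m n : ℕ} (hm : m ≠ 0)
    (hπ : π ∈ primaryOfNorm m) :
    α ∈ (primaryOfNorm n).image (π * ·) ↔ α ∈ primaryOfNorm (m * n) ∧ π ∣ α := by
  rw [mem_primaryOfNorm] at hπ
  obtain ⟨h1, h2, h3⟩ := hπ
  simp only [mem_image, mem_primaryOfNorm]
  constructor
  · rintro ⟨β, ⟨hβ, hβ', hβn⟩, rfl⟩
    have := primary_mul h1 h2 hβ hβ'
    exact ⟨⟨this.1, this.2, by rw [Zsqrtd.norm_mul, h3, hβn]; simp⟩, dvd_mul_right _ _⟩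
  · rintro ⟨⟨hα, hα', hαn⟩, β, rfl⟩
    have := primary_cancel h1 h2 hα hα'
    refine ⟨β, ⟨this.1, this.2, ?_⟩, rfl⟩
    rw [Zsqrtd.norm_mul, h3] at hαn
    push_cast at hαn
    exact mul_left_cancel₀ (by exact_mod_cast hm) hαn

theorem primaryOfNorm_two_mul (n : ℕ) : primaryOfNorm (2 * n) = ∅ := by
  rw [eq_empty_iff_forall_notMem]
  intro α hα
  rw [mem_primaryOfNorm, gaussianInt_norm_eq] at hα
  obtain ⟨h1, h2, h3⟩ := hα
  obtain ⟨a, ha⟩ : ∃ a, α.re = 4 * a + 1 := ⟨α.re / 4, by omega⟩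
  obtain ⟨b, hb⟩ : ∃ b, α.im = 2 * b := ⟨α.im / 2, by omega⟩
  rw [ha, hb] at h3
  have : (4 * a + 1) ^ 2 + (2 * b) ^ 2 = 1 + 2 * (8 * a ^ 2 + 4 * a + 2 * b ^ 2) := by ring
  push_cast at h3
  omega

variable {R : Type*} [CommRing R] (h : GaussianInt →* R)

theorem sum_image_mul_left {π : GaussianInt} (hπ : π ≠ 0) (n : ℕ) :
    ∑ α ∈ (primaryOfNorm n).image (π * ·), h α = h π * ∑ α ∈ primaryOfNorm n, h α := by
  rw [sum_image fun x _ y _ hxy => mul_left_cancel₀ hπ hxy, mul_sum]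
  exact sum_congr rfl fun x _ => map_mul h _ _

variable {p : ℕ}

/-- If p divides Re(α ρ̄), it divides Im(α ρ̄) too, because the squares of both add up to N(α)p;
then α ρ̄ = p(k + li) and ρ divides α. Modulo p the product of these real parts for ρ = π and ρ = π̄
vanishes, so one of them does. -/
theorem dvd_of_prime_dvd_norm_of_split (hp : p.Prime) {π α : GaussianInt} (hπ : π.norm = p)
    (hα : (p : ℤ) ∣ α.norm) : π ∣ α ∨ star π ∣ α := by
  have hpi : Prime (p : ℤ) := Nat.prime_iff_prime_int.mp hp
  have key : ∀ ρ : GaussianInt, ρ.norm = p → (p : ℤ) ∣ α.re * ρ.re + α.im * ρ.im → ρ ∣ α := by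
    intro ρ hρ hdvd
    rw [gaussianInt_norm_eq] at hρ hα
    have h2 : (p : ℤ) ∣ α.im * ρ.re - α.re * ρ.im := by
      apply hpi.dvd_of_dvd_pow (n := 2)
      obtain ⟨k, hk⟩ := hdvd
      obtain ⟨l, hl⟩ := hα
      refine ⟨p * l - p * k ^ 2, ?_⟩
      linear_combination (ρ.re ^ 2 + ρ.im ^ 2) * hl + p * l * hρ -
        (α.re * ρ.re + α.im * ρ.im + p * k) * hk
    obtain ⟨k, hk⟩ := hdvd
    obtain ⟨l, hl⟩ := h2
    refine ⟨⟨k, l⟩, ?_⟩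
    have hp0 : (p : ℤ) ≠ 0 := hpi.ne_zero
    ext
    · simp only [Zsqrtd.re_mul]
      apply mul_left_cancel₀ hp0
      linear_combination ρ.re * hk - ρ.im * hl - α.re * hρ
    · simp only [Zsqrtd.im_mul]
      apply mul_left_cancel₀ hp0
      linear_combination ρ.im * hk + ρ.re * hl - α.im * hρ
  have hprod : (p : ℤ) ∣ (α.re * π.re + α.im * π.im) * (α.re * π.re - α.im * π.im) := by
    rw [gaussianInt_norm_eq] at hπ hα
    obtain ⟨l, hl⟩ := hα
    refine ⟨α.re ^ 2 - π.im ^ 2 * l, ?_⟩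
    linear_combination α.re ^ 2 * hπ - π.im ^ 2 * hl
  rcases hpi.dvd_or_dvd hprod with h1 | h1
  · exact Or.inl (key π hπ h1)
  · refine Or.inr (key (star π) (by rw [Zsqrtd.norm_conj, hπ]) ?_)
    simpa [sub_eq_add_neg] using h1

theorem natCast_dvd_iff_gaussianInt (n : ℤ) (α : GaussianInt) :
    (n : GaussianInt) ∣ α ↔ n ∣ α.re ∧ n ∣ α.im := Zsqrtd.intCast_dvd n α

/-- Inclusion–exclusion: each primary element of norm pn is a multiple of π or of π̄, and the
multiples of both are the multiples of p, which is itself primary as p ≡ 1 mod 4. -/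
theorem sum_primaryOfNorm_split (hp : p.Prime) (hp4 : p % 4 = 1) {π : GaussianInt}
    (hπ : π ∈ primaryOfNorm p) (n : ℕ) :
    ∑ α ∈ primaryOfNorm (p * n), h α + (if p ∣ n then
      h p * ∑ α ∈ primaryOfNorm (n / p), h α else 0) =
      (h π + h (star π)) * ∑ α ∈ primaryOfNorm n, h α := by
  have hp0 := hp.ne_zero
  have hπ' := mem_primaryOfNorm.mp hπ
  have hπs : star π ∈ primaryOfNorm p := by
    rw [mem_primaryOfNorm, Zsqrtd.norm_conj]
    refine ⟨by simpa using hπ'.1, ?_, hπ'.2.2⟩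
    have := hπ'.2.1
    simp only [Zsqrtd.im_star]; omega
  have hne : ∀ ρ : GaussianInt, ρ ∈ primaryOfNorm p → ρ ≠ 0 := by
    rintro ρ hρ rfl
    have := (mem_primaryOfNorm.mp hρ).1
    simp at this
  have hpp : (p : GaussianInt) ∈ primaryOfNorm (p ^ 2) := by
    rw [mem_primaryOfNorm, gaussianInt_norm_eq]
    refine ⟨by simp; omega, by simp, by simp⟩
  have hnorm : π * star π = (p : GaussianInt) := by
    have := Zsqrtd.norm_eq_mul_conj π
    rw [← this, hπ'.2.2]; simp
  have hunion : (primaryOfNorm n).image (π * ·) ∪ (primaryOfNorm n).image (star π * ·) =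
      primaryOfNorm (p * n) := by
    ext α
    rw [mem_union, mem_image_mul_primaryOfNorm hp0 hπ, mem_image_mul_primaryOfNorm hp0 hπs,
      ← and_or_left, and_iff_left_iff_imp]
    intro hα
    refine dvd_of_prime_dvd_norm_of_split hp hπ'.2.2 ?_
    rw [(mem_primaryOfNorm.mp hα).2.2]; simp
  have hdvd : ∀ α : GaussianInt, (π ∣ α ∧ star π ∣ α) ↔ (p : GaussianInt) ∣ α := by
    intro α
    constructor
    · rintro ⟨⟨β, hβ⟩, ⟨γ, hγ⟩⟩
      have hpi : Prime (p : ℤ) := Nat.prime_iff_prime_int.mp hp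
      have htr : π + star π = ((2 * π.re : ℤ) : GaussianInt) := by
        ext <;> simp; ring
      -- The trace replaces a coprimality argument: (π + π̄)α is divisible by p = ππ̄, while p does
      -- not divide the integer π + π̄.
      have h1 : ((2 * π.re : ℤ) : GaussianInt) * α = ((p : ℤ) : GaussianInt) * (β + γ) := by
        rw [← htr]
        push_cast
        rw [← hnorm]
        linear_combination π * hγ + star π * hβ
      have h2 : ¬ (p : ℤ) ∣ 2 * π.re := by
        intro hd
        have hnp := hπ'.2.2
        rw [gaussianInt_norm_eq] at hnp
        have hpos : 0 < π.re ^ 2 := by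
          have : π.re ≠ 0 := by have := hπ'.1; omega
          positivity
        rcases hpi.dvd_or_dvd hd with hd | hd
        · have := Int.le_of_dvd (by norm_num) hd
          have := hp.two_le
          omega
        · have hle := Int.le_of_dvd hpos (hd.trans (dvd_pow_self _ two_ne_zero))
          have him : π.im = 0 := by nlinarith [sq_nonneg π.im]
          rw [him] at hnp
          obtain ⟨k, hk⟩ := hd
          rw [hk] at hnp
          have : IsUnit (p : ℤ) := by
            refine IsUnit.of_mul_eq_one (k ^ 2) ?_
            apply mul_left_cancel₀ hpi.ne_zero
            linear_combination hnp
          exact hpi.not_isUnit this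
      have h3 : ((p : ℤ) : GaussianInt) ∣ ((2 * π.re : ℤ) : GaussianInt) * α := ⟨_, h1⟩
      rw [natCast_dvd_iff_gaussianInt] at h3
      simp only [Zsqrtd.re_mul, Zsqrtd.im_mul, Zsqrtd.re_intCast, Zsqrtd.im_intCast, zero_mul,
        mul_zero, add_zero] at h3
      have h4 := (natCast_dvd_iff_gaussianInt p α).mpr
        ⟨(hpi.dvd_or_dvd h3.1).resolve_left h2, (hpi.dvd_or_dvd h3.2).resolve_left h2⟩
      exact_mod_cast h4
    · intro hd
      rw [← hnorm] at hd
      exact ⟨(dvd_mul_right _ _).trans hd, (dvd_mul_left _ _).trans hd⟩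
  have hinter : ∑ α ∈ (primaryOfNorm n).image (π * ·) ∩ (primaryOfNorm n).image (star π * ·), h α =
      if p ∣ n then h p * ∑ α ∈ primaryOfNorm (n / p), h α else 0 := by
    have hmem : ∀ α, α ∈ (primaryOfNorm n).image (π * ·) ∩ (primaryOfNorm n).image (star π * ·) ↔
        α ∈ primaryOfNorm (p * n) ∧ (p : GaussianInt) ∣ α := by
      intro α
      rw [mem_inter, mem_image_mul_primaryOfNorm hp0 hπ, mem_image_mul_primaryOfNorm hp0 hπs,
        ← hdvd]
      tauto
    split_ifs with hn
    · obtain ⟨m, rfl⟩ := hn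
      rw [Nat.mul_div_cancel_left _ hp.pos, ← sum_image_mul_left h (by exact_mod_cast hp0)]
      refine sum_congr ?_ fun _ _ => rfl
      ext α
      rw [hmem, mem_image_mul_primaryOfNorm (pow_ne_zero 2 hp0) hpp, pow_two, mul_assoc]
    · refine sum_eq_zero fun α hα => ?_
      exfalso
      obtain ⟨h1, β, rfl⟩ := (hmem α).mp hα
      have h2 := (mem_primaryOfNorm.mp h1).2.2
      rw [Zsqrtd.norm_mul, (mem_primaryOfNorm.mp hpp).2.2] at h2
      apply hn
      have h3 : (p : ℤ) * β.norm = n := by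
        have : (p : ℤ) ≠ 0 := by exact_mod_cast hp0
        apply mul_left_cancel₀ this
        push_cast at h2
        linear_combination h2
      have : (p : ℤ) ∣ n := ⟨_, h3.symm⟩
      exact_mod_cast this
  rw [← hunion, ← hinter, sum_union_inter, sum_image_mul_left h (hne _ hπ),
    sum_image_mul_left h (hne _ hπs), add_mul]

/-- Now p is prime in ℤ[i] and divides every element whose norm it divides. The primary associate of
p is -p, of norm p². -/
theorem sum_primaryOfNorm_inert (hp : p.Prime) (hp4 : p % 4 = 3) (n : ℕ) :
    ∑ α ∈ primaryOfNorm (p * n), h α =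
      if p ∣ n then h (-(p : GaussianInt)) * ∑ α ∈ primaryOfNorm (n / p), h α else 0 := by
  have : Fact p.Prime := ⟨hp⟩
  have hp0 := hp.ne_zero
  have hprime := GaussianInt.prime_of_nat_prime_of_mod_four_eq_three p hp4
  have hpp : -(p : GaussianInt) ∈ primaryOfNorm (p ^ 2) := by
    rw [mem_primaryOfNorm, gaussianInt_norm_eq]
    refine ⟨by simp; omega, by simp, by simp⟩
  have hall : ∀ α ∈ primaryOfNorm (p * n), -(p : GaussianInt) ∣ α := by
    intro α hα
    rw [neg_dvd]
    have h1 := (mem_primaryOfNorm.mp hα).2.2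
    have h2 : (p : GaussianInt) ∣ α * star α := by
      rw [← Zsqrtd.norm_eq_mul_conj, h1]
      push_cast
      exact dvd_mul_right _ _
    rcases hprime.dvd_or_dvd h2 with h3 | ⟨β, hβ⟩
    · exact h3
    · refine ⟨star β, ?_⟩
      rw [← star_star α, hβ, star_mul']
      simp
  split_ifs with hn
  · obtain ⟨m, rfl⟩ := hn
    rw [Nat.mul_div_cancel_left _ hp.pos, ← sum_image_mul_left h (by simpa using hp0)]
    refine sum_congr ?_ fun _ _ => rfl
    ext α
    rw [mem_image_mul_primaryOfNorm (pow_ne_zero 2 hp0) hpp, pow_two, mul_assoc]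
    exact ⟨fun hα => ⟨hα, hall α hα⟩, fun hα => hα.1⟩
  · refine sum_eq_zero fun α hα => ?_
    exfalso
    obtain ⟨β, rfl⟩ := hall α hα
    have h2 := (mem_primaryOfNorm.mp hα).2.2
    rw [Zsqrtd.norm_mul, (mem_primaryOfNorm.mp hpp).2.2] at h2
    apply hn
    have h3 : (p : ℤ) * β.norm = n := by
      have : (p : ℤ) ≠ 0 := by exact_mod_cast hp0
      apply mul_left_cancel₀ this
      push_cast at h2
      linear_combination h2
    have : (p : ℤ) ∣ n := ⟨_, h3.symm⟩
    exact_mod_cast this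

theorem primaryOfNorm_one : primaryOfNorm 1 = {1} := by
  ext α
  rw [mem_primaryOfNorm, gaussianInt_norm_eq, mem_singleton]
  constructor
  · rintro ⟨h1, h2, h3⟩
    push_cast at h3
    have hre : α.re = 1 := by
      have h5 : α.re ≤ 1 := by nlinarith [sq_nonneg α.im]
      have h6 : -1 ≤ α.re := by nlinarith [sq_nonneg α.im]
      omega
    have him : α.im = 0 := by
      rw [hre] at h3
      have : α.im ^ 2 = 0 := by linarith
      simpa using this
    ext <;> simp [hre, him]
  · rintro rfl; simp

end PrimaryGaussian

/-! ### Hecke recursions -/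

section HeckeRelation

variable {R : Type*} [CommRing R]

/-- The relation `F(pn) = a F(n) - b F(n/p)`, where the last term is `0` if `p ∤ n`. -/
def HeckeRelation (F : ℕ → R) (p : ℕ) (a b : R) : Prop :=
  ∀ n, n ≠ 0 → F (p * n) + (if p ∣ n then b * F (n / p) else 0) = a * F n

/-- The recursion computes F(pm) from F(m) and F(m/p), so by strong induction all values at positive
integers follow from F(1). -/
theorem eq_of_heckeRelation {F G : ℕ → R} (h1 : F 1 = G 1)
    (h : ∀ p : ℕ, p.Prime → ∃ a b, HeckeRelation F p a b ∧ HeckeRelation G p a b) :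
    ∀ n, n ≠ 0 → F n = G n := by
  intro n
  induction n using Nat.strong_induction_on with
  | _ n ih =>
    intro hn
    by_cases hn1 : n = 1
    · rw [hn1, h1]
    obtain ⟨p, hp, m, rfl⟩ := Nat.exists_prime_and_dvd hn1
    have hm : m ≠ 0 := right_ne_zero_of_mul hn
    obtain ⟨a, b, hF, hG⟩ := h p hp
    have e1 := hF m hm
    have e2 := hG m hm
    have hlt : m < p * m := lt_mul_left (Nat.pos_of_ne_zero hm) hp.one_lt
    rw [← ih m hlt hm] at e2
    split_ifs at e1 e2 with hpm
    · have h4 := ih (m / p) ((Nat.div_le_self m p).trans_lt hlt)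
        (Nat.div_ne_zero_iff_of_dvd hpm |>.mpr ⟨hm, hp.ne_zero⟩)
      rw [← h4] at e2
      exact add_right_cancel (e1.trans e2.symm)
    · simpa using e1.trans e2.symm

theorem heckeRelation_of_isMultiplicative {F : ArithmeticFunction R} (hF : F.IsMultiplicative)
    {p : ℕ} (hp : p.Prime) {a b : R} (h1 : F p = a)
    (h2 : ∀ k, F (p ^ (k + 2)) + b * F (p ^ k) = a * F (p ^ (k + 1))) :
    HeckeRelation F p a b := by
  intro n hn
  obtain ⟨k, m, hm, rfl⟩ := Nat.exists_eq_pow_mul_and_not_dvd hn p hp.ne_one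
  have hcop : ∀ j, (p ^ j).Coprime m := fun j => Nat.Coprime.pow_left _ ((hp.coprime_iff_not_dvd).mpr hm)
  rw [← mul_assoc, ← pow_succ', hF.map_mul_of_coprime (hcop _), hF.map_mul_of_coprime (hcop _)]
  cases k with
  | zero => simp [hm, h1, hF.1]
  | succ k =>
    rw [if_pos (Dvd.dvd.mul_right (dvd_pow_self p (by omega)) _), pow_succ' p k, mul_assoc p,
      Nat.mul_div_cancel_left _ hp.pos, hF.map_mul_of_coprime (hcop _), ← pow_succ']
    have := h2 k
    rw [add_assoc]
    linear_combination (F m) * this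

end HeckeRelation

section TwoSquares

open ArithmeticFunction

/-- The nontrivial Dirichlet character modulo `4`. -/
def chiFour : ArithmeticFunction ℤ := ⟨fun m => ZMod.χ₄ m, by simp⟩

/-- The indicator function of odd numbers. -/
def oddIndicator : ArithmeticFunction ℤ := ⟨fun m => ZMod.χ₄ m ^ 2, by simp⟩

theorem chiFour_apply (m : ℕ) : chiFour m = ZMod.χ₄ m := rfl

theorem oddIndicator_apply (m : ℕ) : oddIndicator m = chiFour m ^ 2 := rfl

theorem chiFour_mul (m n : ℕ) : chiFour (m * n) = chiFour m * chiFour n := by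
  rw [chiFour_apply, Nat.cast_mul, map_mul]; rfl

theorem chiFour_pow (m n : ℕ) : chiFour (m ^ n) = chiFour m ^ n := by
  rw [chiFour_apply, Nat.cast_pow, map_pow]; rfl

theorem chiFour_of_odd {m : ℕ} (hm : m % 2 = 1) : chiFour m = (-1) ^ (m / 2) :=
  ZMod.χ₄_eq_neg_one_pow hm

theorem chiFour_of_even {m : ℕ} (hm : m % 2 = 0) : chiFour m = 0 := by
  rw [chiFour_apply, ZMod.χ₄_nat_eq_if_mod_four, if_pos hm]

theorem oddIndicator_of_odd {m : ℕ} (hm : m % 2 = 1) : oddIndicator m = 1 := by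
  rw [oddIndicator_apply, chiFour_of_odd hm, ← pow_mul, mul_comm, pow_mul]; simp

theorem isMultiplicative_chiFour : chiFour.IsMultiplicative :=
  ⟨by simp [chiFour_apply], fun _ => chiFour_mul _ _⟩

theorem isMultiplicative_oddIndicator : oddIndicator.IsMultiplicative :=
  ⟨by simp [oddIndicator_apply, chiFour_apply], fun _ => by
    simp only [oddIndicator_apply, chiFour_mul, mul_pow]⟩

theorem oddIndicator_mul_chiFour_prime_pow {p : ℕ} (hp : p.Prime) (k : ℕ) :
    (oddIndicator * chiFour) (p ^ k) =
      ∑ i ∈ range (k + 1), oddIndicator (p ^ (k - i)) * chiFour (p ^ i) := by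
  rw [mul_apply, Nat.sum_divisorsAntidiagonal' (fun a b => oddIndicator a * chiFour b),
    Nat.sum_divisors_prime_pow hp]
  refine sum_congr rfl fun i hi => ?_
  rw [Nat.pow_div (by simp at hi; omega) hp.pos]

/-- At odd p the Euler factor of this convolution is 1/((1 - X)(1 - χ₄(p)X)); at 2 it is 1. -/
theorem heckeRelation_oddIndicator_mul_chiFour {p : ℕ} (hp : p.Prime) :
    HeckeRelation (oddIndicator * chiFour) p (oddIndicator p + chiFour p) (chiFour p) := by
  have hm := isMultiplicative_oddIndicator.mul isMultiplicative_chiFour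
  refine heckeRelation_of_isMultiplicative hm hp ?_ ?_
  · have := oddIndicator_mul_chiFour_prime_pow hp 1
    rw [pow_one] at this
    rw [this]
    simp [sum_range_succ, isMultiplicative_chiFour.1, isMultiplicative_oddIndicator.1]
  · intro k
    rcases hp.eq_two_or_odd with rfl | hodd
    · have h0 : chiFour 2 = 0 := chiFour_of_even rfl
      have h0' : oddIndicator 2 = 0 := by rw [oddIndicator_apply, h0]; rfl
      rw [h0, h0', oddIndicator_mul_chiFour_prime_pow hp]
      rw [zero_mul, add_zero, add_zero, zero_mul]
      refine sum_eq_zero fun i hi => ?_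
      rw [oddIndicator_apply, chiFour_pow, chiFour_pow, h0]
      rcases Nat.eq_zero_or_pos i with rfl | hi'
      · simp
      · rw [zero_pow hi'.ne', mul_zero]
    · have ho : ∀ i, oddIndicator (p ^ i) = 1 := fun i => by
        rw [oddIndicator_apply, chiFour_pow, ← pow_mul, mul_comm, pow_mul, ← oddIndicator_apply,
          oddIndicator_of_odd hodd, one_pow]
      have hg : ∀ j, (oddIndicator * chiFour) (p ^ j) = ∑ i ∈ range (j + 1), chiFour p ^ i := by
        intro j
        rw [oddIndicator_mul_chiFour_prime_pow hp]
        simp only [ho, chiFour_pow, one_mul]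
      rw [hg, hg, hg, oddIndicator_of_odd hodd, sum_range_succ _ (k + 2), sum_range_succ _ (k + 1)]
      ring

/-- For `n ≠ 0` the number of normalized Gaussian integers of norm `n` is
`∑_{d e = n, d odd} χ₄(e)`. -/
theorem card_primaryOfNorm {n : ℕ} (hn : n ≠ 0) :
    ((primaryOfNorm n).card : ℤ) = (oddIndicator * chiFour) n := by
  have hsum : ∀ n, ((primaryOfNorm n).card : ℤ) =
      ∑ α ∈ primaryOfNorm n, (1 : GaussianInt →* ℤ) α := by simp
  refine eq_of_heckeRelation (F := fun n => ((primaryOfNorm n).card : ℤ)) ?_ ?_ n hn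
  · rw [primaryOfNorm_one]
    simp [(isMultiplicative_oddIndicator.mul isMultiplicative_chiFour).1]
  intro p hp
  refine ⟨_, _, ?_, heckeRelation_oddIndicator_mul_chiFour hp⟩
  intro n hn
  rcases hp.eq_two_or_odd with rfl | hodd
  · simp [primaryOfNorm_two_mul, chiFour_of_even, oddIndicator_apply]
  have h4 : p % 4 = 1 ∨ p % 4 = 3 := by omega
  rw [oddIndicator_of_odd hodd]
  simp only [hsum]
  rcases h4 with h4 | h4
  · have : Fact p.Prime := ⟨hp⟩
    obtain ⟨a, b, ha, hb, hab, -⟩ := affineCount_of_mod_four_eq_one p h4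
    have hπ : (⟨a, b⟩ : GaussianInt) ∈ primaryOfNorm p := by
      rw [mem_primaryOfNorm, gaussianInt_norm_eq]; exact ⟨ha, hb, hab⟩
    -- The trivial character turns the character sums into counts.
    have := sum_primaryOfNorm_split (1 : GaussianInt →* ℤ) hp h4 hπ n
    have hχ : chiFour p = 1 := ZMod.χ₄_nat_one_mod_four h4
    simpa [hχ] using this
  · have := sum_primaryOfNorm_inert (1 : GaussianInt →* ℤ) hp h4 n
    have hχ : chiFour p = -1 := ZMod.χ₄_nat_three_mod_four h4
    rw [this, hχ]
    split_ifs <;> simp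

end TwoSquares

/-! ### Dirichlet coefficients of the curve -/

section LFunction

open ArithmeticFunction IsDedekindDomain NumberField Rat.HeightOneSpectrum

theorem coeff_invOfUnit_succ_succ (a b : ℤ) (k : ℕ) :
    let f := PowerSeries.invOfUnit
      ((1 - Polynomial.C a * Polynomial.X + Polynomial.C b * Polynomial.X ^ 2 : Polynomial ℤ) :
        PowerSeries ℤ) 1
    f.coeff 1 = a ∧ f.coeff (k + 2) + b * f.coeff k = a * f.coeff (k + 1) := by
  intro f
  have hf : ((1 - Polynomial.C a * Polynomial.X + Polynomial.C b * Polynomial.X ^ 2 : Polynomial ℤ) :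
      PowerSeries ℤ) * f = 1 := by
    apply PowerSeries.mul_invOfUnit
    simp
  have hf' : f - PowerSeries.C a * (PowerSeries.X * f) +
      PowerSeries.C b * (PowerSeries.X * (PowerSeries.X * f)) = 1 := by
    rw [← hf]; push_cast; ring
  have h0 := congrArg (PowerSeries.coeff 0) hf'
  have h1 := congrArg (PowerSeries.coeff 1) hf'
  have h2 := congrArg (PowerSeries.coeff (k + 2)) hf'
  simp only [map_add, map_sub, PowerSeries.coeff_C_mul, PowerSeries.coeff_zero_X_mul] at h0
  rw [show (1 : ℕ) = 0 + 1 from rfl] at h1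
  simp only [map_add, map_sub, PowerSeries.coeff_C_mul, PowerSeries.coeff_succ_X_mul,
    PowerSeries.coeff_zero_X_mul, PowerSeries.coeff_one] at h0 h1 h2
  simp at h0 h1 h2
  constructor
  · rw [h0] at h1; linarith
  · linarith

/-- Intended for g the product of the Euler factors at primes other than p, which then does not
affect the coefficients at powers of p. -/
theorem coeff_one_of_apply_prime_pow {R : Type*} [CommRing R] {p : ℕ} (hp : p.Prime)
    {f g : ArithmeticFunction R} (hg1 : g 1 = 1) (hg : ∀ k, k ≠ 0 → g (p ^ k) = 0) (k : ℕ) :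
    (f * g) (p ^ k) = f (p ^ k) := by
  rw [mul_apply, Nat.sum_divisorsAntidiagonal (fun a b => f a * g b),
    Nat.sum_divisors_prime_pow hp, sum_range_succ, Nat.div_self (pow_pos hp.pos k), hg1, mul_one,
    add_eq_right]
  refine sum_eq_zero fun i hi => ?_
  rw [mem_range] at hi
  rw [Nat.pow_div hi.le hp.pos, hg _ (by omega), mul_zero]

theorem LFunction_curveE64_eq :
    curveE64.LFunction = eulerProduct fun v : HeightOneSpectrum (𝓞 ℚ) =>
      ofPowerSeries (primesEquiv v : ℕ)
        (PowerSeries.invOfUnit (eulerPolynomial (primesEquiv v : ℕ)) 1) := by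
  rw [WeierstrassCurve.LFunction]
  congr 1
  ext1 v
  exact localEulerFactor_curveE64 v

theorem constantCoeff_invOfUnit_one (f : PowerSeries ℤ) :
    (PowerSeries.invOfUnit f 1).constantCoeff = 1 := by
  rw [PowerSeries.constantCoeff_invOfUnit]; simp

theorem isMultiplicative_LFunction_curveE64 : curveE64.LFunction.IsMultiplicative := by
  rw [LFunction_curveE64_eq]
  exact isMultiplicative_eulerProduct _ fun v =>
    isMultiplicative_ofPowerSeries_of_isPrimePow _ (primesEquiv v).2.isPrimePow _
      (constantCoeff_invOfUnit_one _)

/-- At a fixed integer the finite partial products are eventually constant. Take one that contains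
the place of p and remove that factor: the others are supported on powers of other primes. -/
theorem LFunction_curveE64_prime_pow {p : ℕ} (hp : p.Prime) (k : ℕ) :
    curveE64.LFunction (p ^ k) = (PowerSeries.invOfUnit (eulerPolynomial p) 1).coeff k := by
  classical
  have hN : Northcott fun v : HeightOneSpectrum (𝓞 ℚ) => (primesEquiv v : ℕ) :=
    ⟨fun b => Set.Finite.preimage (f := fun v : HeightOneSpectrum (𝓞 ℚ) => (primesEquiv v : ℕ))
      (fun x _ y _ h => primesEquiv.injective (Subtype.ext h)) (Set.finite_Iic b)⟩
  set f : HeightOneSpectrum (𝓞 ℚ) → ArithmeticFunction ℤ := fun v =>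
    ofPowerSeries (primesEquiv v : ℕ)
      (PowerSeries.invOfUnit (eulerPolynomial (primesEquiv v : ℕ)) 1) with hf
  have hev := tendsTo_eulerProduct_ofPowerSeries
    (fun v : HeightOneSpectrum (𝓞 ℚ) => (primesEquiv v : ℕ))
    (fun v => PowerSeries.invOfUnit (eulerPolynomial (primesEquiv v : ℕ)) 1)
    (fun v => constantCoeff_invOfUnit_one _) (p ^ k)
  rw [LFunction_curveE64_eq]
  set v₀ : HeightOneSpectrum (𝓞 ℚ) := primesEquiv.symm ⟨p, hp⟩
  have hv₀ : (primesEquiv v₀ : ℕ) = p :=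
    congrArg Subtype.val (Equiv.apply_symm_apply primesEquiv (⟨p, hp⟩ : Nat.Primes))
  obtain ⟨s, hs, hsub⟩ := (hev.and (Filter.eventually_ge_atTop {v₀})).exists
  rw [← hs, ← mul_prod_erase s _ (singleton_subset_iff.mp hsub)]
  have hprod : ∀ t : Finset (HeightOneSpectrum (𝓞 ℚ)), v₀ ∉ t →
      (∏ v ∈ t, f v) 1 = 1 ∧ ∀ j, j ≠ 0 → (∏ v ∈ t, f v) (p ^ j) = 0 := by
    intro t
    induction t using Finset.induction_on with
    | empty =>
      intro _
      refine ⟨by simp, fun j hj => ?_⟩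
      rw [prod_empty, one_apply_ne]
      exact (Nat.one_lt_pow hj hp.one_lt).ne'
    | insert v t hv ih =>
      intro hvt
      rw [mem_insert, not_or] at hvt
      obtain ⟨h1, h2⟩ := ih hvt.2
      rw [prod_insert hv]
      refine ⟨?_, fun j hj => ?_⟩
      · rw [mul_apply_one, h1, mul_one, hf]
        simp only [ofPowerSeries_apply_one]
        exact constantCoeff_invOfUnit_one _
      · rw [coeff_one_of_apply_prime_pow hp h1 h2]
        have hq : (primesEquiv v : ℕ) ≠ p := by
          intro h
          apply hvt.1
          apply primesEquiv.injective
          exact Subtype.ext (hv₀.trans h.symm)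
        rw [hf]
        simp only
        rw [ofPowerSeries_apply (primesEquiv v).2.one_lt, Function.extend_apply', Pi.zero_apply]
        rintro ⟨i, hi⟩
        have hi : (primesEquiv v : ℕ) ^ i = p ^ j := hi
        have hi0 : i ≠ 0 := by
          rintro rfl
          exact (Nat.one_lt_pow hj hp.one_lt).ne' (by simpa using hi.symm)
        have : (primesEquiv v : ℕ) ∣ p ^ j := hi ▸ dvd_pow_self _ hi0
        exact hq ((Nat.prime_dvd_prime_iff_eq (primesEquiv v).2 hp).mp
          ((primesEquiv v).2.dvd_of_dvd_pow this))
  obtain ⟨h1, h2⟩ := hprod (s.erase v₀) (notMem_erase _ _)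
  rw [coeff_one_of_apply_prime_pow hp h1 h2, hv₀, ofPowerSeries_apply_pow hp.one_lt]

theorem heckeRelation_LFunction_curveE64 {p : ℕ} (hp : p.Prime) :
    HeckeRelation curveE64.LFunction p (if p = 2 then 0 else (p : ℤ) - affineCount p)
      (if p = 2 then 0 else (p : ℤ)) := by
  refine heckeRelation_of_isMultiplicative isMultiplicative_LFunction_curveE64 hp ?_ fun k => ?_
  · nth_rewrite 1 [← pow_one p]
    rw [LFunction_curveE64_prime_pow hp, eulerPolynomial]
    split_ifs with h2
    · have : PowerSeries.invOfUnit (1 : PowerSeries ℤ) 1 = 1 := by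
        have := PowerSeries.mul_invOfUnit (1 : PowerSeries ℤ) 1 (by simp)
        rwa [one_mul] at this
      rw [Polynomial.coe_one, this]
      simp [PowerSeries.coeff_one]
    · exact (coeff_invOfUnit_succ_succ _ _ 0).1
  · rw [LFunction_curveE64_prime_pow hp, LFunction_curveE64_prime_pow hp,
      LFunction_curveE64_prime_pow hp, eulerPolynomial]
    split_ifs with h2
    · have : PowerSeries.invOfUnit (1 : PowerSeries ℤ) 1 = 1 := by
        have := PowerSeries.mul_invOfUnit (1 : PowerSeries ℤ) 1 (by simp)
        rwa [one_mul] at this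
      rw [Polynomial.coe_one, this]
      simp [PowerSeries.coeff_one]
    · exact (coeff_invOfUnit_succ_succ _ _ k).2

/-- The coefficients of the `L`-function of `y² = x³ - 4x` as sums over Gaussian integers. -/
theorem LFunction_curveE64_apply {n : ℕ} (hn : n ≠ 0) :
    curveE64.LFunction n = ∑ α ∈ primaryOfNorm n, α.re := by
  have hre : ∀ n, ∑ α ∈ primaryOfNorm n, α.re = (∑ α ∈ primaryOfNorm n, α).re := by
    intro n
    let φ : GaussianInt →+ ℤ := ⟨⟨Zsqrtd.re, rfl⟩, fun _ _ => rfl⟩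
    exact (map_sum φ _ _).symm
  refine eq_of_heckeRelation (F := curveE64.LFunction)
    (G := fun n => ∑ α ∈ primaryOfNorm n, α.re) ?_ ?_ n hn
  · rw [isMultiplicative_LFunction_curveE64.1, primaryOfNorm_one]; simp
  intro p hp
  refine ⟨_, _, heckeRelation_LFunction_curveE64 hp, ?_⟩
  intro n hn
  rcases hp.eq_two_or_odd with rfl | hodd
  · simp [primaryOfNorm_two_mul]
  have hp2 : p ≠ 2 := by rintro rfl; simp at hodd
  have : Fact p.Prime := ⟨hp⟩
  have h4 : p % 4 = 1 ∨ p % 4 = 3 := by omega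
  rw [if_neg hp2, if_neg hp2]
  simp only [hre]
  rcases h4 with h4 | h4
  · obtain ⟨a, b, ha, hb, hab, hc⟩ := affineCount_of_mod_four_eq_one p h4
    have hπ : (⟨a, b⟩ : GaussianInt) ∈ primaryOfNorm p := by
      rw [mem_primaryOfNorm, gaussianInt_norm_eq]; exact ⟨ha, hb, hab⟩
    -- The recursion holds for Σ α, with the identity as character. Its coefficients π + π̄ and p
    -- are rational integers, so it passes to real parts.
    have := congrArg Zsqrtd.re (sum_primaryOfNorm_split (MonoidHom.id GaussianInt) hp h4 hπ n)
    have hstar : (⟨a, b⟩ : GaussianInt) + star ⟨a, b⟩ = ((2 * a : ℤ) : GaussianInt) := by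
      ext <;> simp; ring
    simp only [MonoidHom.id_apply, hstar, Zsqrtd.re_add, Zsqrtd.re_mul, Zsqrtd.re_intCast,
      Zsqrtd.im_intCast] at this
    rw [hc, show (p : ℤ) - (p - 2 * a) = 2 * a by ring]
    rw [show ∀ x y : ℤ, 2 * a * x + -1 * 0 * y = 2 * a * x by intros; ring] at this
    rw [← this]
    congr 1
    split_ifs
    · simp
    · simp
  · have := congrArg Zsqrtd.re (sum_primaryOfNorm_inert (MonoidHom.id GaussianInt) hp h4 n)
    rw [affineCount_of_mod_four_eq_three p h4, sub_self, zero_mul]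
    simp only [MonoidHom.id_apply] at this
    rw [this]
    split_ifs
    · simp
    · simp

end LFunction

end

/-! ### Theta constants and Jacobi's quartic identity -/

section

open Real HurwitzZeta

theorem hasSum_of_isCompl_range {α β γ M : Type*} [AddCommMonoid M] [TopologicalSpace M]
    [ContinuousAdd M] {f : γ → M} {i : α → γ} {j : β → γ} (hi : Function.Injective i)
    (hj : Function.Injective j) (hij : IsCompl (Set.range i) (Set.range j)) {a b : M}
    (ha : HasSum (f ∘ i) a) (hb : HasSum (f ∘ j) b) : HasSum f (a + b) :=
  HasSum.add_isCompl hij ((hi.hasSum_range_iff).mpr ha) ((hj.hasSum_range_iff).mpr hb)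

theorem hasSum_int_of_even_of_odd {M : Type*} [AddCommMonoid M] [TopologicalSpace M]
    [ContinuousAdd M] {f : ℤ → M} {a b : M} (ha : HasSum (fun n => f (2 * n)) a)
    (hb : HasSum (fun n => f (2 * n + 1)) b) : HasSum f (a + b) := by
  refine hasSum_of_isCompl_range (i := fun n : ℤ => 2 * n) (j := fun n : ℤ => 2 * n + 1)
    (fun x y h => by simp at h; exact h) (fun x y h => by simp at h; exact h) ?_ ha hb
  constructor
  · rw [Set.disjoint_iff]
    rintro x ⟨⟨m, rfl⟩, ⟨n, hn⟩⟩
    simp only at hn; omega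
  · rw [codisjoint_iff_le_sup]
    intro x _
    rcases Int.even_or_odd' x with ⟨k, rfl | rfl⟩
    · exact Or.inl ⟨k, rfl⟩
    · exact Or.inr ⟨k, rfl⟩

/-- The two maps `(x, y) ↦ (x + y, x - y)` and `(x, y) ↦ (x + y + 1, x - y)` partition `ℤ²`. -/
theorem hasSum_int_prod_of_rotate {M : Type*} [AddCommMonoid M] [TopologicalSpace M]
    [ContinuousAdd M] {f : ℤ × ℤ → M} {a b : M}
    (ha : HasSum (fun q : ℤ × ℤ => f (q.1 + q.2, q.1 - q.2)) a)
    (hb : HasSum (fun q : ℤ × ℤ => f (q.1 + q.2 + 1, q.1 - q.2)) b) : HasSum f (a + b) := by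
  refine hasSum_of_isCompl_range (i := fun q : ℤ × ℤ => (q.1 + q.2, q.1 - q.2))
    (j := fun q : ℤ × ℤ => (q.1 + q.2 + 1, q.1 - q.2)) ?_ ?_ ?_ ha hb
  · rintro ⟨a, b⟩ ⟨c, d⟩ h
    simp only [Prod.mk.injEq] at h ⊢
    omega
  · rintro ⟨a, b⟩ ⟨c, d⟩ h
    simp only [Prod.mk.injEq] at h ⊢
    omega
  constructor
  · rw [Set.disjoint_iff]
    rintro x ⟨⟨m, rfl⟩, ⟨n, hn⟩⟩
    simp only [Prod.mk.injEq] at hn; omega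
  · rw [codisjoint_iff_le_sup]
    rintro ⟨x, y⟩ _
    rcases Int.even_or_odd' (x - y) with ⟨k, h | h⟩
    · exact Or.inl ⟨(y + k, k), by simp only [Prod.mk.injEq]; omega⟩
    · exact Or.inr ⟨(y + k, k), by simp only [Prod.mk.injEq]; omega⟩

/-- The theta constant `∑ exp(-π (n + 1/2)² t)`. -/
noncomputable def thetaTwo (t : ℝ) : ℝ := ∑' n : ℤ, rexp (-π * (n + 1 / 2) ^ 2 * t)

/-- The theta constant `∑ exp(-π n² t)`. -/
noncomputable def thetaThree (t : ℝ) : ℝ := ∑' n : ℤ, rexp (-π * n ^ 2 * t)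

/-- The theta constant `∑ (-1)ⁿ exp(-π n² t)`. -/
noncomputable def thetaFour (t : ℝ) : ℝ := ∑' n : ℤ, (-1) ^ n * rexp (-π * n ^ 2 * t)

section Theta

variable {t : ℝ} (ht : 0 < t)
include ht

theorem hasSum_evenKernel_half :
    HasSum (fun n : ℤ => rexp (-π * (n + 1 / 2) ^ 2 * t)) (evenKernel ((1 / 2 : ℝ) : UnitAddCircle) t) := by
  exact hasSum_int_evenKernel (1 / 2) ht

theorem hasSum_evenKernel_zero :
    HasSum (fun n : ℤ => rexp (-π * n ^ 2 * t)) (evenKernel ((0 : ℝ) : UnitAddCircle) t) := by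
  simpa using hasSum_int_evenKernel 0 ht

theorem hasSum_cosKernel_zero :
    HasSum (fun n : ℤ => rexp (-π * n ^ 2 * t)) (cosKernel ((0 : ℝ) : UnitAddCircle) t) := by
  rw [← Complex.hasSum_ofReal]
  simpa using hasSum_int_cosKernel 0 ht

theorem hasSum_cosKernel_half :
    HasSum (fun n : ℤ => (-1) ^ n * rexp (-π * n ^ 2 * t))
      (cosKernel ((1 / 2 : ℝ) : UnitAddCircle) t) := by
  rw [← Complex.hasSum_ofReal]
  refine (hasSum_int_cosKernel (1 / 2) ht).congr_fun fun n => ?_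
  have : Complex.exp (2 * π * Complex.I * ((1 / 2 : ℝ) : ℂ) * n) = (-1) ^ n := by
    rw [← Complex.exp_pi_mul_I, ← Complex.exp_int_mul]
    congr 1
    push_cast
    ring
  rw [this]
  push_cast
  rfl

theorem hasSum_thetaTwo : HasSum (fun n : ℤ => rexp (-π * (n + 1 / 2) ^ 2 * t)) (thetaTwo t) :=
  (hasSum_evenKernel_half ht).summable.hasSum

theorem hasSum_thetaThree : HasSum (fun n : ℤ => rexp (-π * n ^ 2 * t)) (thetaThree t) :=
  (hasSum_evenKernel_zero ht).summable.hasSum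

theorem hasSum_thetaFour :
    HasSum (fun n : ℤ => (-1) ^ n * rexp (-π * n ^ 2 * t)) (thetaFour t) :=
  (hasSum_cosKernel_half ht).summable.hasSum

theorem thetaThree_pos : 0 < thetaThree t :=
  (hasSum_thetaThree ht).summable.tsum_pos (fun _ => (exp_pos _).le) 0 (exp_pos _)

theorem thetaTwo_pos : 0 < thetaTwo t :=
  (hasSum_thetaTwo ht).summable.tsum_pos (fun _ => (exp_pos _).le) 0 (exp_pos _)

theorem thetaTwo_inv : thetaTwo t⁻¹ = √t * thetaFour t := by
  have h := evenKernel_functional_equation ((1 / 2 : ℝ) : UnitAddCircle) t⁻¹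
  rw [(hasSum_evenKernel_half (inv_pos.mpr ht)).unique (hasSum_thetaTwo (inv_pos.mpr ht)), one_div,
    one_div t⁻¹, inv_inv, (hasSum_cosKernel_half ht).unique (hasSum_thetaFour ht)] at h
  rw [h, ← inv_rpow (inv_pos.mpr ht).le, inv_inv, ← sqrt_eq_rpow]

theorem thetaThree_inv : thetaThree t⁻¹ = √t * thetaThree t := by
  have h := evenKernel_functional_equation ((0 : ℝ) : UnitAddCircle) t⁻¹
  rw [(hasSum_evenKernel_zero (inv_pos.mpr ht)).unique (hasSum_thetaThree (inv_pos.mpr ht)), one_div,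
    one_div t⁻¹, inv_inv, (hasSum_cosKernel_zero ht).unique (hasSum_thetaThree ht)] at h
  rw [h, ← inv_rpow (inv_pos.mpr ht).le, inv_inv, ← sqrt_eq_rpow]

theorem thetaThree_eq_add : thetaThree t = thetaThree (4 * t) + thetaTwo (4 * t) := by
  refine (hasSum_thetaThree ht).unique (hasSum_int_of_even_of_odd ?_ ?_)
  · refine (hasSum_thetaThree (t := 4 * t) (by positivity)).congr_fun fun n => ?_
    push_cast; ring_nf
  · refine (hasSum_thetaTwo (t := 4 * t) (by positivity)).congr_fun fun n => ?_
    push_cast; ring_nf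

theorem thetaFour_eq_sub : thetaFour t = thetaThree (4 * t) - thetaTwo (4 * t) := by
  rw [sub_eq_add_neg]
  refine (hasSum_thetaFour ht).unique (hasSum_int_of_even_of_odd ?_ ?_)
  · refine (hasSum_thetaThree (t := 4 * t) (by positivity)).congr_fun fun n => ?_
    rw [(even_two_mul n).neg_one_zpow]
    push_cast; ring_nf
  · refine (hasSum_thetaTwo (t := 4 * t) (by positivity)).neg.congr_fun fun n => ?_
    rw [Odd.neg_one_zpow ⟨n, rfl⟩]
    push_cast; ring_nf

/-- Rotating ℤ² by 45 degrees diagonalizes the sum of two squares; each of the two cosets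
contributes the same product. -/
theorem thetaTwo_sq : thetaTwo t ^ 2 = 2 * (thetaTwo (2 * t) * thetaThree (2 * t)) := by
  have h2 := hasSum_thetaTwo ht
  have h2' := hasSum_thetaTwo (t := 2 * t) (by positivity)
  have h3' := hasSum_thetaThree (t := 2 * t) (by positivity)
  have hL := h2.mul h2 (h2.summable.mul_of_nonneg h2.summable
    (fun _ => (exp_pos _).le) (fun _ => (exp_pos _).le))
  have hA := h2'.mul h3' (h2'.summable.mul_of_nonneg h3'.summable
    (fun _ => (exp_pos _).le) (fun _ => (exp_pos _).le))
  have h3s : HasSum (fun m : ℤ => rexp (-π * ((m + 1 : ℤ) : ℝ) ^ 2 * (2 * t)))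
      (thetaThree (2 * t)) :=
    ((Equiv.addRight (1 : ℤ)).hasSum_iff (f := fun n : ℤ => rexp (-π * n ^ 2 * (2 * t)))).mpr h3'
  have hB := h3s.mul h2' (h3s.summable.mul_of_nonneg h2'.summable
    (fun _ => (exp_pos _).le) (fun _ => (exp_pos _).le))
  rw [pow_two, hL.unique (hasSum_int_prod_of_rotate (hA.congr_fun fun q => ?_)
    (hB.congr_fun fun q => ?_))]
  · ring
  · rw [← exp_add, ← exp_add]; push_cast; ring_nf
  · rw [← exp_add, ← exp_add]; push_cast; ring_nf

theorem thetaThree_sq : thetaThree t ^ 2 = thetaThree (2 * t) ^ 2 + thetaTwo (2 * t) ^ 2 := by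
  have h3 := hasSum_thetaThree ht
  have h2' := hasSum_thetaTwo (t := 2 * t) (by positivity)
  have h3' := hasSum_thetaThree (t := 2 * t) (by positivity)
  have hL := h3.mul h3 (h3.summable.mul_of_nonneg h3.summable
    (fun _ => (exp_pos _).le) (fun _ => (exp_pos _).le))
  have hA := h3'.mul h3' (h3'.summable.mul_of_nonneg h3'.summable
    (fun _ => (exp_pos _).le) (fun _ => (exp_pos _).le))
  have hB := h2'.mul h2' (h2'.summable.mul_of_nonneg h2'.summable
    (fun _ => (exp_pos _).le) (fun _ => (exp_pos _).le))
  rw [pow_two, hL.unique (hasSum_int_prod_of_rotate (hA.congr_fun fun q => ?_)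
    (hB.congr_fun fun q => ?_))]
  · ring
  · rw [← exp_add, ← exp_add]; push_cast; ring_nf
  · rw [← exp_add, ← exp_add]; push_cast; ring_nf

/-- Jacobi's quartic identity for theta constants. -/
theorem thetaTwo_pow_four_add : thetaTwo t ^ 4 + thetaFour t ^ 4 = thetaThree t ^ 4 := by
  have h2 : 0 < 2 * t := by positivity
  have e1 := thetaTwo_sq ht
  have e2 := thetaThree_sq ht
  have e3 := thetaThree_eq_add ht
  have e4 := thetaFour_eq_sub ht
  have e5 := thetaTwo_sq h2
  have e6 := thetaThree_sq h2
  rw [show 2 * (2 * t) = 4 * t by ring] at e5 e6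
  -- The product of `f1` and `f2` is θ₃⁴ - θ₄⁴ at t, and the duplication formula for θ₂² identifies
  -- it with θ₂⁴.
  have f1 : thetaThree t ^ 2 - thetaFour t ^ 2 = 2 * thetaTwo (2 * t) ^ 2 := by
    rw [e5, e3, e4]; ring
  have f2 : thetaThree t ^ 2 + thetaFour t ^ 2 = 2 * thetaThree (2 * t) ^ 2 := by
    rw [e6, e3, e4]; ring
  have f3 : thetaTwo t ^ 4 = 4 * (thetaTwo (2 * t) ^ 2 * thetaThree (2 * t) ^ 2) := by
    rw [show thetaTwo t ^ 4 = (thetaTwo t ^ 2) ^ 2 by ring, e1]; ring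
  rw [f3]
  linear_combination (-(thetaThree t ^ 2 + thetaFour t ^ 2)) * f1 - 2 * thetaTwo (2 * t) ^ 2 * f2

end Theta

/-- The ratio `θ₂ / θ₃`. -/
noncomputable def thetaRatio (t : ℝ) : ℝ := thetaTwo t / thetaThree t

theorem thetaRatio_pos {t : ℝ} (ht : 0 < t) : 0 < thetaRatio t :=
  div_pos (thetaTwo_pos ht) (thetaThree_pos ht)

theorem thetaRatio_inv {t : ℝ} (ht : 0 < t) : thetaRatio t⁻¹ = thetaFour t / thetaThree t := by
  rw [thetaRatio, thetaTwo_inv ht, thetaThree_inv ht,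
    mul_div_mul_left _ _ (sqrt_pos.mpr ht).ne']

/-- This is the quartic identity divided by θ₃⁴: the inversion t ↦ 1/t acts on v = θ₂/θ₃ by v ↦ (1 -
v⁴)^(1/4). -/
theorem thetaRatio_pow_four_add {t : ℝ} (ht : 0 < t) :
    thetaRatio t ^ 4 + thetaRatio t⁻¹ ^ 4 = 1 := by
  have h := thetaThree_pos ht
  rw [thetaRatio_inv ht, thetaRatio, div_pow, div_pow, ← add_div, thetaTwo_pow_four_add ht,
    div_self (pow_ne_zero 4 h.ne')]

theorem thetaRatio_lt_one {t : ℝ} (ht : 0 < t) : thetaRatio t < 1 := by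
  have h1 := thetaRatio_pow_four_add ht
  have h2 := pow_pos (thetaRatio_pos (inv_pos.mpr ht)) 4
  by_contra h
  have := one_le_pow₀ (n := 4) (not_lt.mp h)
  linarith

end

/-! ### The q-binomial theorem and the finite triple product -/

section

open Finset Filter Topology

section QBinomial

variable {K : Type*} [Field K]

/-- The Gaussian binomial coefficients. -/
def gaussianBinomial (q : K) : ℕ → ℕ → K
  | _, 0 => 1
  | 0, _ + 1 => 0
  | M + 1, k + 1 => gaussianBinomial q M (k + 1) + q ^ (M - k) * gaussianBinomial q M k

/-- The product `∏_{i=1}^n (1 - q^i)`. -/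
def qPochhammer (q : K) (n : ℕ) : K := ∏ i ∈ range n, (1 - q ^ (i + 1))

theorem gaussianBinomial_zero_right (q : K) (M : ℕ) : gaussianBinomial q M 0 = 1 := by
  cases M <;> rfl

theorem gaussianBinomial_of_lt (q : K) {M k : ℕ} (h : M < k) : gaussianBinomial q M k = 0 := by
  induction M generalizing k with
  | zero => cases k with
    | zero => omega
    | succ k => rfl
  | succ M ih => cases k with
    | zero => omega
    | succ k => rw [gaussianBinomial, ih (by omega), ih (by omega)]; simp

theorem qPochhammer_succ (q : K) (n : ℕ) :
    qPochhammer q (n + 1) = qPochhammer q n * (1 - q ^ (n + 1)) := prod_range_succ _ _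

theorem gaussianBinomial_mul (q : K) {M k : ℕ} (h : k ≤ M) :
    gaussianBinomial q M k * (qPochhammer q k * qPochhammer q (M - k)) = qPochhammer q M := by
  induction M generalizing k with
  | zero =>
    obtain rfl : k = 0 := by omega
    simp [gaussianBinomial_zero_right, qPochhammer]
  | succ M ih => cases k with
    | zero => simp [gaussianBinomial_zero_right, qPochhammer]
    | succ k =>
      rw [gaussianBinomial, Nat.add_sub_add_right]
      have h2 := ih (k := k) (by omega)
      rcases eq_or_lt_of_le (show k ≤ M by omega) with rfl | hlt
      · rw [gaussianBinomial_of_lt q (Nat.lt_succ_self _), qPochhammer_succ]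
        simp only [Nat.sub_self] at h2 ⊢
        linear_combination (1 - q ^ (k + 1)) * h2
      · have h1 := ih (k := k + 1) (by omega)
        obtain ⟨d, rfl⟩ : ∃ d, M = k + 1 + d := ⟨M - (k + 1), by omega⟩
        rw [show k + 1 + d - (k + 1) = d by omega] at h1
        rw [show k + 1 + d - k = d + 1 by omega] at h2 ⊢
        rw [qPochhammer_succ q d] at h2 ⊢
        rw [qPochhammer_succ q k] at h1 ⊢
        rw [qPochhammer_succ q (k + 1 + d), show k + 1 + d + 1 = (k + 1) + (d + 1) by omega, pow_add]
        linear_combination (1 - q ^ (d + 1)) * h1 + q ^ (d + 1) * (1 - q ^ (k + 1)) * h2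

/-- The homogeneous form of the finite `q`-binomial theorem. -/
theorem prod_add_pow_mul {R : Type*} [CommRing R] (φ : K →+* R) (q : K) (x y : R) (M : ℕ) :
    ∏ i ∈ range M, (y + φ q ^ i * x) = ∑ k ∈ range (M + 1),
      φ q ^ (k * (k - 1) / 2) * φ (gaussianBinomial q M k) * x ^ k * y ^ (M - k) := by
  induction M with
  | zero => simp [gaussianBinomial_zero_right]
  | succ M ih =>
    rw [prod_range_succ, ih, mul_add, sum_mul, sum_mul]
    conv_rhs => rw [sum_range_succ']
    have e1 : ∑ k ∈ range (M + 1), φ q ^ (k * (k - 1) / 2) * φ (gaussianBinomial q M k) * x ^ k *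
        y ^ (M - k) * y = ∑ k ∈ range (M + 1), φ q ^ ((k + 1) * k / 2) *
          φ (gaussianBinomial q M (k + 1)) * x ^ (k + 1) * y ^ (M - k) + y ^ (M + 1) := by
      rw [sum_range_succ', sum_range_succ]
      rw [gaussianBinomial_of_lt q (Nat.lt_succ_self M), gaussianBinomial_zero_right]
      simp only [map_zero, mul_zero, zero_mul, add_zero, Nat.sub_zero, Nat.zero_div, pow_zero,
        map_one, mul_one, one_mul]
      rw [← pow_succ]
      congr 1
      refine sum_congr rfl fun k hk => ?_
      rw [mem_range] at hk
      rw [show M - k = M - (k + 1) + 1 by omega, pow_succ, Nat.add_sub_cancel]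
      ring
    rw [e1]
    simp only [gaussianBinomial_zero_right, Nat.add_sub_cancel, Nat.add_sub_add_right, zero_mul,
      Nat.zero_div, pow_zero, map_one, mul_one, one_mul, Nat.sub_zero]
    rw [add_right_comm, ← sum_add_distrib]
    congr 1
    refine sum_congr rfl fun k hk => ?_
    rw [mem_range] at hk
    have e2 : φ q ^ (k * (k - 1) / 2) * φ q ^ M = φ q ^ ((k + 1) * k / 2) * φ q ^ (M - k) := by
      rw [← pow_add, ← pow_add]
      congr 1
      have h1 : (k + 1) * k / 2 = k * (k - 1) / 2 + k := by
        rw [← Nat.triangle_succ k]; simp [Nat.mul_comm]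
      omega
    rw [gaussianBinomial, map_add, map_mul, map_pow]
    linear_combination (φ (gaussianBinomial q M k) * x ^ (k + 1) * y ^ (M - k)) * e2

/-- The finite form of the Jacobi triple product. -/
theorem prod_mul_prod_eq_sum_gaussianBinomial {x z : K} (hx : x ≠ 0) (hz : z ≠ 0) (N : ℕ) :
    (∏ i ∈ range N, (1 + x * z ^ (2 * i + 1))) * ∏ i ∈ range N, (1 + x⁻¹ * z ^ (2 * i + 1)) =
      ∑ k ∈ range (2 * N + 1), gaussianBinomial (z ^ 2) (2 * N) k *
        (x ^ ((k : ℤ) - N) * z ^ ((k : ℤ) - N) ^ 2) := by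
  -- With q = z² and y = z^(2N-1), the first N of the 2N factors, in reverse order, give the product
  -- in x⁻¹ and the last N the product in x, up to monomials.
  have h := prod_add_pow_mul (RingHom.id K) (z ^ 2) x (z ^ (2 * (N : ℤ) - 1)) (2 * N)
  simp only [RingHom.id_apply] at h
  have hL : ∏ i ∈ range (2 * N), (z ^ (2 * (N : ℤ) - 1) + (z ^ 2) ^ i * x) =
      (x ^ (N : ℤ) * z ^ (3 * (N : ℤ) ^ 2 - 2 * N)) * ((∏ i ∈ range N, (1 + x * z ^ (2 * i + 1))) *
        ∏ i ∈ range N, (1 + x⁻¹ * z ^ (2 * i + 1))) := by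
    have e1 : ∏ i ∈ range N, (z ^ (2 * (N : ℤ) - 1) + (z ^ 2) ^ i * x) =
        (x ^ N * z ^ (N * (N - 1))) * ∏ i ∈ range N, (1 + x⁻¹ * z ^ (2 * i + 1)) := by
      rw [← prod_range_reflect (fun i => 1 + x⁻¹ * z ^ (2 * i + 1)), ← sum_range_id_mul_two,
        show x ^ N = ∏ i ∈ range N, x by simp, sum_mul, ← prod_pow_eq_pow_sum, ← prod_mul_distrib,
        ← prod_mul_distrib]
      refine prod_congr rfl fun i hi => ?_
      rw [mem_range] at hi
      have : z ^ (2 * (N : ℤ) - 1) = z ^ (i * 2) * z ^ (2 * (N - 1 - i) + 1) := by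
        rw [← pow_add, ← zpow_natCast]
        congr 1
        omega
      rw [this]
      field_simp
      ring
    have e2 : ∏ i ∈ range N, (z ^ (2 * (N : ℤ) - 1) + (z ^ 2) ^ (N + i) * x) =
        (z ^ (2 * (N : ℤ) - 1)) ^ N * ∏ i ∈ range N, (1 + x * z ^ (2 * i + 1)) := by
      rw [show (z ^ (2 * (N : ℤ) - 1)) ^ N = ∏ i ∈ range N, z ^ (2 * (N : ℤ) - 1) by simp,
        ← prod_mul_distrib]
      refine prod_congr rfl fun i hi => ?_
      have : (z ^ 2) ^ (N + i) = z ^ (2 * (N : ℤ) - 1) * z ^ (2 * i + 1) := by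
        rw [← pow_mul, ← zpow_natCast, ← zpow_natCast, ← zpow_add₀ hz]
        congr 1
        push_cast
        ring
      rw [this]
      ring
    rw [two_mul N, prod_range_add, e1, e2]
    have : z ^ (3 * (N : ℤ) ^ 2 - 2 * N) = z ^ (N * (N - 1)) * (z ^ (2 * (N : ℤ) - 1)) ^ N := by
      rw [← zpow_natCast, ← zpow_natCast (z ^ _), ← zpow_mul, ← zpow_add₀ hz]
      congr 1
      cases N with
      | zero => simp
      | succ N => push_cast [Nat.add_sub_cancel]; ring
    rw [this, zpow_natCast]
    ring
  rw [hL] at h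
  rw [← mul_right_inj' (mul_ne_zero (zpow_ne_zero N hx) (zpow_ne_zero (3 * (N : ℤ) ^ 2 - 2 * N) hz)),
    h, mul_sum]
  refine sum_congr rfl fun k hk => ?_
  rw [mem_range] at hk
  have ex : x ^ (N : ℤ) * x ^ ((k : ℤ) - N) = x ^ k := by
    rw [← zpow_add₀ hx, ← zpow_natCast]; congr 1; ring
  have ez : z ^ (3 * (N : ℤ) ^ 2 - 2 * N) * z ^ ((k : ℤ) - N) ^ 2 =
      (z ^ 2) ^ (k * (k - 1) / 2) * (z ^ (2 * (N : ℤ) - 1)) ^ (2 * N - k) := by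
    rw [← zpow_add₀ hz, ← zpow_natCast (z ^ (2 * (N : ℤ) - 1)), ← zpow_mul, ← pow_mul,
      Nat.mul_div_cancel' (Nat.even_mul_pred_self k).two_dvd, ← zpow_natCast z, ← zpow_add₀ hz]
    congr 1
    rw [Nat.cast_sub (by omega)]
    cases k with
    | zero => push_cast; ring
    | succ k => push_cast [Nat.add_sub_cancel]; ring
  rw [← ex]
  linear_combination -(gaussianBinomial (z ^ 2) (2 * N) k * x ^ (N : ℤ) * x ^ ((k : ℤ) - N)) * ez

end QBinomial

end

/-! ### Infinite products for theta series -/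

section

open Finset Filter Topology

section Limits

variable {q : ℂ}

theorem qPochhammer_ne_zero (hq : ‖q‖ < 1) (n : ℕ) : qPochhammer q n ≠ 0 := by
  refine prod_ne_zero_iff.mpr fun i _ h => ?_
  have h1 : ‖q ^ (i + 1)‖ < 1 := by
    rw [norm_pow]; exact pow_lt_one₀ (norm_nonneg _) hq (Nat.succ_ne_zero _)
  rw [← sub_eq_zero.mp h, norm_one] at h1
  exact lt_irrefl _ h1

theorem exists_tendsto_qPochhammer (hq : ‖q‖ < 1) :
    ∃ L : ℂ, L ≠ 0 ∧ Tendsto (qPochhammer q) atTop (𝓝 L) := by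
  refine ⟨∏' i : ℕ, (1 - q ^ (i + 1)), ?_,
    (ModularForm.multipliable_one_sub_pow hq).hasProd.tendsto_prod_nat⟩
  have := tprod_one_add_ne_zero_of_summable (f := fun i : ℕ => -q ^ (i + 1)) (fun i h => ?_) ?_
  · simpa [sub_eq_add_neg] using this
  · have := qPochhammer_ne_zero hq (i + 1)
    rw [qPochhammer_succ] at this
    refine this ?_
    rw [sub_eq_add_neg, h, mul_zero]
  · simpa using (summable_nat_add_iff 1).mpr (summable_geometric_of_lt_one (norm_nonneg _) hq)

theorem gaussianBinomial_eq (hq : ‖q‖ < 1) {M k : ℕ} (h : k ≤ M) : gaussianBinomial q M k =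
    qPochhammer q M * (qPochhammer q k)⁻¹ * (qPochhammer q (M - k))⁻¹ := by
  rw [← gaussianBinomial_mul q h]
  field_simp [qPochhammer_ne_zero hq]

theorem exists_norm_gaussianBinomial_le (hq : ‖q‖ < 1) :
    ∃ C : ℝ, ∀ M k : ℕ, ‖gaussianBinomial q M k‖ ≤ C := by
  obtain ⟨L, hL0, hL⟩ := exists_tendsto_qPochhammer hq
  obtain ⟨A, hA⟩ := (Metric.isBounded_range_of_tendsto _ hL).exists_norm_le
  obtain ⟨B, hB⟩ := (Metric.isBounded_range_of_tendsto _ (hL.inv₀ hL0)).exists_norm_le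
  have hA' : ∀ n, ‖qPochhammer q n‖ ≤ A := fun n => hA _ ⟨n, rfl⟩
  have hB' : ∀ n, ‖(qPochhammer q n)⁻¹‖ ≤ B := fun n => hB _ ⟨n, rfl⟩
  have hA0 : 0 ≤ A := (norm_nonneg _).trans (hA' 0)
  have hB0 : 0 ≤ B := (norm_nonneg _).trans (hB' 0)
  refine ⟨A * B * B, fun M k => ?_⟩
  rcases le_or_gt k M with h | h
  · rw [gaussianBinomial_eq hq h, norm_mul, norm_mul]
    exact mul_le_mul (mul_le_mul (hA' _) (hB' _) (norm_nonneg _) hA0) (hB' _) (norm_nonneg _)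
      (by positivity)
  · rw [gaussianBinomial_of_lt q h, norm_zero]
    positivity

/-- The centred coefficients tend to 1/L for each fixed n and are uniformly bounded, so dominated
convergence carries the finite triple product to the infinite one. -/
theorem tendsto_sum_gaussianBinomial_mul (hq : ‖q‖ < 1) {L : ℂ} (hL0 : L ≠ 0)
    (hL : Tendsto (qPochhammer q) atTop (𝓝 L)) {g : ℤ → ℂ} {a : ℂ} (hg : HasSum g a) :
    Tendsto (fun N : ℕ => ∑ k ∈ range (2 * N + 1), gaussianBinomial q (2 * N) k * g ((k : ℤ) - N))
      atTop (𝓝 (L⁻¹ * a)) := by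
  obtain ⟨C, hC⟩ := exists_norm_gaussianBinomial_le hq
  have hC0 : 0 ≤ C := (norm_nonneg _).trans (hC 0 0)
  have key : ∀ N : ℕ, ∑ k ∈ range (2 * N + 1), gaussianBinomial q (2 * N) k * g ((k : ℤ) - N) =
      ∑' n : ℤ, (if 0 ≤ n + N then gaussianBinomial q (2 * N) (n + N).toNat else 0) * g n := by
    intro N
    rw [tsum_eq_sum (s := (range (2 * N + 1)).map
      ⟨fun k : ℕ => (k : ℤ) - N, fun a b h => by simpa using h⟩), sum_map]
    · refine sum_congr rfl fun k _ => ?_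
      change _ = (if 0 ≤ (k : ℤ) - N + N then
        gaussianBinomial q (2 * N) ((k : ℤ) - N + N).toNat else 0) * g (k - N)
      simp
    · intro n hn
      split_ifs with h
      · rw [gaussianBinomial_of_lt, zero_mul]
        by_contra! h'
        refine hn (mem_map.mpr ⟨(n + N).toNat, mem_range.mpr (by omega), ?_⟩)
        change ((n + N).toNat : ℤ) - N = n
        omega
      · rw [zero_mul]
  simp_rw [key]
  rw [← hg.tsum_eq, ← tsum_mul_left]
  refine tendsto_tsum_of_dominated_convergence (bound := fun n => C * ‖g n‖)
    (hg.summable.norm.mul_left C) (fun n => Tendsto.mul_const _ ?_)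
    (Eventually.of_forall fun N n => ?_)
  · have h1 : Tendsto (fun N : ℕ => (n + N).toNat) atTop atTop :=
      tendsto_atTop.mpr fun b => eventually_atTop.mpr ⟨b + n.natAbs, fun N hN => by omega⟩
    have h2 : Tendsto (fun N : ℕ => 2 * N - (n + N).toNat) atTop atTop :=
      tendsto_atTop.mpr fun b => eventually_atTop.mpr ⟨b + n.natAbs, fun N hN => by omega⟩
    have h3 : Tendsto (fun N : ℕ => 2 * N) atTop atTop :=
      tendsto_atTop.mpr fun b => eventually_atTop.mpr ⟨b, fun N hN => by omega⟩
    have := ((hL.comp h3).mul ((hL.inv₀ hL0).comp h1)).mul ((hL.inv₀ hL0).comp h2)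
    rw [mul_inv_cancel₀ hL0, one_mul] at this
    refine this.congr' (eventually_atTop.mpr ⟨n.natAbs, fun N hN => ?_⟩)
    dsimp only [Function.comp]
    rw [if_pos (by omega), gaussianBinomial_eq hq (by omega)]
  · rw [norm_mul]
    refine mul_le_mul_of_nonneg_right ?_ (norm_nonneg _)
    split_ifs
    · exact hC _ _
    · simpa using hC0

/-- The arctangent series at -iw. The exponential form of the conclusion allows products of such
factors without any choice of branch. -/
theorem Complex.exists_hasSum_artanh {w : ℂ} (hw : ‖w‖ < 1) :
    ∃ s, HasSum (fun n : ℕ => w ^ (2 * n + 1) / (2 * n + 1)) s ∧ 1 + w = exp (2 * s) * (1 - w) := by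
  have h := (Complex.hasSum_arctan (z := -I * w) (by simpa)).mul_left I
  refine ⟨_, h.congr_fun fun n => ?_, ?_⟩
  · rw [mul_pow, pow_succ (-I), pow_mul, neg_sq, I_sq]
    push_cast
    have : ((-1 : ℂ) ^ n) * (-1) ^ n = 1 := by rw [← mul_pow]; simp
    linear_combination (w ^ (2 * n + 1) / (2 * n + 1)) * (I * I * this + I_mul_I)
  · have h1 : 1 + w ≠ 0 := fun h => by
      rw [← neg_eq_of_add_eq_zero_right h, norm_neg, norm_one] at hw; exact lt_irrefl _ hw
    have h2 : 1 - w ≠ 0 := fun h => by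
      rw [← sub_eq_zero.mp h, norm_one] at hw; exact lt_irrefl _ hw
    rw [arctan, show -I * w * I = w by linear_combination -w * I_mul_I,
      show 2 * (I * (-I / 2 * log ((1 + w) / (1 - w)))) = log ((1 + w) / (1 - w)) by
        linear_combination -log ((1 + w) / (1 - w)) * I_mul_I,
      exp_log (div_ne_zero h1 h2), div_mul_cancel₀ _ h2]

variable {z : ℂ} (hz0 : z ≠ 0) (hz : ‖z‖ < 1)
include hz

theorem norm_sq_lt_one : ‖z ^ 2‖ < 1 := by
  rw [norm_pow]; exact pow_lt_one₀ (norm_nonneg _) hz two_ne_zero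

include hz0

theorem tendsto_prod_sq {L a : ℂ} (hL0 : L ≠ 0) (hL : Tendsto (qPochhammer (z ^ 2)) atTop (𝓝 L))
    (ha : HasSum (fun n : ℤ => z ^ n ^ 2) a) :
    Tendsto (fun N : ℕ => (∏ i ∈ range N, (1 + z ^ (2 * i + 1))) ^ 2) atTop (𝓝 (L⁻¹ * a)) := by
  refine (tendsto_sum_gaussianBinomial_mul (norm_sq_lt_one hz) hL0 hL ha).congr fun N => ?_
  simpa [pow_two] using (prod_mul_prod_eq_sum_gaussianBinomial one_ne_zero hz0 N).symm

/-- By the triple product at x = 1, the quotient of the two theta series is ∏ ((1 + z^m)/(1 - z^m))²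
over odd m, that is exp(4 Σ artanh(z^m)). The factor L is common, since it depends on z² only. -/
theorem theta_eq_exp_mul_theta_neg {a b e : ℂ} (ha : HasSum (fun n : ℤ => z ^ n ^ 2) a)
    (hb : HasSum (fun n : ℤ => (-z) ^ n ^ 2) b)
    (he : HasSum (fun p : ℕ × ℕ => z ^ ((2 * p.1 + 1) * (2 * p.2 + 1)) / (2 * p.2 + 1)) e) :
    a = Complex.exp (4 * e) * b := by
  obtain ⟨L, hL0, hL⟩ := exists_tendsto_qPochhammer (norm_sq_lt_one hz)
  have h1 := tendsto_prod_sq hz0 hz hL0 hL ha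
  have h2 := tendsto_prod_sq (neg_ne_zero.mpr hz0) (by rwa [norm_neg]) hL0
    (by rwa [neg_sq]) hb
  have hw : ∀ i : ℕ, ‖z ^ (2 * i + 1)‖ < 1 := fun i => by
    rw [norm_pow]; exact pow_lt_one₀ (norm_nonneg _) hz (Nat.succ_ne_zero _)
  choose s hs hs' using fun i => Complex.exists_hasSum_artanh (hw i)
  have h3 : HasSum s e := he.prod_fiberwise fun i => (hs i).congr_fun fun n => by rw [pow_mul]
  have h4 : Tendsto (fun N : ℕ => Complex.exp (4 * ∑ i ∈ range N, s i)) atTop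
      (𝓝 (Complex.exp (4 * e))) :=
    (Complex.continuous_exp.tendsto _).comp (h3.tendsto_sum_nat.const_mul 4)
  have h5 := tendsto_nhds_unique h1 ((h4.mul h2).congr fun N => ?_)
  · refine mul_left_cancel₀ (inv_ne_zero hL0) ?_
    rw [h5]; ring
  · rw [prod_congr rfl fun i _ => hs' i, prod_mul_distrib, mul_pow, ← Complex.exp_sum, ← mul_sum,
      ← Complex.exp_nat_mul]
    congr 2
    · push_cast; ring_nf
    · refine prod_congr rfl fun i _ => ?_
      rw [Odd.neg_pow ⟨i, rfl⟩, sub_eq_add_neg]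

/-- The triple product at x = z. The factors in x⁻¹ then begin with 1 + 1 = 2 and stop one step
early, which the extra factor 1 + z^(2N) → 1 repairs. -/
theorem tendsto_prod_one_add {L a : ℂ} (hL0 : L ≠ 0)
    (hL : Tendsto (qPochhammer (z ^ 2)) atTop (𝓝 L))
    (ha : HasSum (fun n : ℤ => z ^ (n ^ 2 + n)) a) :
    Tendsto (fun N : ℕ => 2 * (∏ i ∈ range N, (1 + (z ^ 2) ^ (i + 1))) ^ 2) atTop
      (𝓝 (L⁻¹ * a)) := by
  have hq := norm_sq_lt_one hz
  have h1 : Tendsto (fun N : ℕ => 1 + (z ^ 2) ^ N) atTop (𝓝 (1 + 0)) :=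
    (tendsto_pow_atTop_nhds_zero_of_norm_lt_one hq).const_add 1
  have h2 := (tendsto_sum_gaussianBinomial_mul (norm_sq_lt_one hz) hL0 hL
    (g := fun n : ℤ => z ^ n * z ^ n ^ 2)
    (ha.congr_fun fun n => by rw [← zpow_add₀ hz0, add_comm])).mul h1
  rw [add_zero, mul_one] at h2
  refine h2.congr fun N => ?_
  rw [← prod_mul_prod_eq_sum_gaussianBinomial hz0 hz0 N, mul_assoc]
  have e1 : (∏ i ∈ range N, (1 + z⁻¹ * z ^ (2 * i + 1))) * (1 + (z ^ 2) ^ N) =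
      2 * ∏ i ∈ range N, (1 + (z ^ 2) ^ (i + 1)) := by
    have := prod_range_succ (fun i => 1 + (z ^ 2) ^ i) N
    rw [prod_range_succ', pow_zero, one_add_one_eq_two] at this
    rw [mul_comm 2, this]
    congr 1
    refine prod_congr rfl fun i _ => ?_
    rw [pow_succ z, pow_mul]
    field_simp
  rw [e1, prod_congr rfl fun i _ => show 1 + z * z ^ (2 * i + 1) = 1 + (z ^ 2) ^ (i + 1) by ring]
  ring

/-- Jacobi's identity for the cube of the Euler product. -/
theorem qPochhammer_limit_cube {L a : ℂ} (hL0 : L ≠ 0)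
    (hL : Tendsto (qPochhammer (z ^ 2)) atTop (𝓝 L))
    (ha : HasSum (fun n : ℤ => (-1) ^ n * n * z ^ (n ^ 2 + n)) a) : L ^ 3 = a := by
  have key : ∀ N : ℕ, qPochhammer (z ^ 2) N * qPochhammer (z ^ 2) (N + 1) =
      ∑ k ∈ range (2 * (N + 1) + 1), gaussianBinomial (z ^ 2) (2 * (N + 1)) k *
        ((-1) ^ ((k : ℤ) - (N + 1 : ℕ)) * ((k : ℤ) - (N + 1 : ℕ) : ℤ) *
          z ^ (((k : ℤ) - (N + 1 : ℕ)) ^ 2 + ((k : ℤ) - (N + 1 : ℕ)))) := by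
    intro N
    -- The finite triple product is differentiated at x = -z, a zero of its factor 1 + x⁻¹z. `G`
    -- collects the other factors, so only G(-z) times the derivative of that factor survives.
    set G : ℂ → ℂ := fun x => (∏ i ∈ range (N + 1), (1 + x * z ^ (2 * i + 1))) *
      ∏ i ∈ range N, (1 + x⁻¹ * z ^ (2 * (i + 1) + 1)) with hG
    have hmz : -z ≠ 0 := neg_ne_zero.mpr hz0
    have hGd : DifferentiableAt ℂ G (-z) := by
      refine DifferentiableAt.fun_mul ?_ ?_
      · exact DifferentiableAt.fun_finsetProd fun i _ => by fun_prop
      · exact DifferentiableAt.fun_finsetProd fun i _ =>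
          ((differentiableAt_inv hmz).mul_const _).const_add 1
    have hinv : HasDerivAt (fun x : ℂ => 1 + x⁻¹ * z) (-z⁻¹) (-z) := by
      have h := ((hasDerivAt_inv hmz).mul_const z).const_add 1
      rwa [show -((-z) ^ 2)⁻¹ * z = -z⁻¹ by rw [neg_sq]; field_simp] at h
    have h1 := hGd.hasDerivAt.mul hinv
    have h2 : HasDerivAt (fun x : ℂ => ∑ k ∈ range (2 * (N + 1) + 1),
        gaussianBinomial (z ^ 2) (2 * (N + 1)) k *
        (x ^ ((k : ℤ) - (N + 1 : ℕ)) * z ^ ((k : ℤ) - (N + 1 : ℕ)) ^ 2))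
        (∑ k ∈ range (2 * (N + 1) + 1), gaussianBinomial (z ^ 2) (2 * (N + 1)) k *
        (((k : ℤ) - (N + 1 : ℕ) : ℤ) * (-z) ^ ((k : ℤ) - (N + 1 : ℕ) - 1) *
          z ^ ((k : ℤ) - (N + 1 : ℕ)) ^ 2)) (-z) :=
      HasDerivAt.fun_sum fun k _ => ((hasDerivAt_zpow _ _ (Or.inl hmz)).mul_const _).const_mul _
    have h3 := h1.unique (h2.congr_of_eventuallyEq ?_)
    · have hGz : G (-z) = qPochhammer (z ^ 2) N * qPochhammer (z ^ 2) (N + 1) := by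
        rw [hG, mul_comm, qPochhammer, qPochhammer]
        dsimp only
        congr 1 <;> refine prod_congr rfl fun i _ => ?_
        · ring
        · rw [pow_succ z, inv_neg, pow_mul]
          field_simp
          ring
      rw [inv_neg, neg_mul, inv_mul_cancel₀ hz0, add_neg_cancel, mul_zero, zero_add, hGz] at h3
      rw [show qPochhammer (z ^ 2) N * qPochhammer (z ^ 2) (N + 1) =
        -z * (qPochhammer (z ^ 2) N * qPochhammer (z ^ 2) (N + 1) * -z⁻¹) by field_simp, h3,
        mul_sum]
      refine sum_congr rfl fun k _ => ?_
      set n : ℤ := (k : ℤ) - (N + 1 : ℕ) with hn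
      have e : (-z) ^ n = (-z) ^ (n - 1) * -z := by rw [← zpow_add_one₀ hmz, sub_add_cancel]
      have e' : (-z) ^ n = (-1) ^ n * z ^ n := by rw [← mul_zpow, neg_one_mul]
      rw [zpow_add₀ hz0]
      linear_combination (gaussianBinomial (z ^ 2) (2 * (N + 1)) k * n * z ^ n ^ 2) * (e' - e)
    · filter_upwards [isOpen_ne.mem_nhds hmz] with x hx
      rw [← prod_mul_prod_eq_sum_gaussianBinomial hx hz0 (N + 1)]
      simp only [Pi.mul_apply, hG]
      rw [prod_range_succ' (fun i => 1 + x⁻¹ * z ^ (2 * i + 1))]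
      ring
  have h1 := (tendsto_sum_gaussianBinomial_mul (norm_sq_lt_one hz) hL0 hL ha).comp
    (tendsto_add_atTop_nat 1)
  have h2 := hL.mul (hL.comp (tendsto_add_atTop_nat 1))
  have h3 := tendsto_nhds_unique h2 (h1.congr fun N => (key N).symm)
  field_simp at h3
  linear_combination h3

/-- With q = z², the factors 1 ± z^(2i+1) combine to 1 - q^(2i+1), and 1 ± q^(i+1) combine to 1 -
q^(2i+2). The limit reads abc L⁻³ L² = 2L², and L³ = d by the cube identity. -/
theorem theta_mul_theta_neg_mul {a b c d : ℂ} (ha : HasSum (fun n : ℤ => z ^ n ^ 2) a)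
    (hb : HasSum (fun n : ℤ => (-z) ^ n ^ 2) b) (hc : HasSum (fun n : ℤ => z ^ (n ^ 2 + n)) c)
    (hd : HasSum (fun n : ℤ => (-1) ^ n * n * z ^ (n ^ 2 + n)) d) : a * b * c = 2 * d := by
  obtain ⟨L, hL0, hL⟩ := exists_tendsto_qPochhammer (norm_sq_lt_one hz)
  have h1 := tendsto_prod_sq hz0 hz hL0 hL ha
  have h2 := tendsto_prod_sq (neg_ne_zero.mpr hz0) (by rwa [norm_neg]) hL0
    (by rwa [neg_sq]) hb
  have h3 := tendsto_prod_one_add hz0 hz hL0 hL hc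
  have h4 : Tendsto (fun N : ℕ => 2 * N) atTop atTop :=
    tendsto_atTop.mpr fun b => eventually_atTop.mpr ⟨b, fun N hN => by omega⟩
  have h5 := ((hL.comp h4).pow 2).const_mul 2
  have key : ∀ N : ℕ, 2 * qPochhammer (z ^ 2) (2 * N) ^ 2 =
      (∏ i ∈ range N, (1 + z ^ (2 * i + 1))) ^ 2 * (∏ i ∈ range N, (1 + (-z) ^ (2 * i + 1))) ^ 2 *
        (2 * (∏ i ∈ range N, (1 + (z ^ 2) ^ (i + 1))) ^ 2) * qPochhammer (z ^ 2) N ^ 2 := by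
    intro N
    rw [show ∀ a b c d : ℂ, a ^ 2 * b ^ 2 * (2 * c ^ 2) * d ^ 2 = 2 * (a * b * (c * d)) ^ 2 by
      intros; ring, qPochhammer, qPochhammer, ← prod_mul_distrib, ← prod_mul_distrib,
      ← prod_mul_distrib]
    congr 2
    induction N with
    | zero => simp
    | succ N ih =>
      rw [show 2 * (N + 1) = 2 * N + 1 + 1 by ring, prod_range_succ, prod_range_succ, ih,
        prod_range_succ, Odd.neg_pow ⟨N, rfl⟩]
      ring
  have h6 := tendsto_nhds_unique h5 (((((h1.mul h2).mul h3).mul (hL.pow 2))).congr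
    fun N => (key N).symm)
  rw [← qPochhammer_limit_cube hz0 hz hL0 hL hd]
  field_simp at h6
  linear_combination -h6

end Limits

end

/-! ### Odd Lambert series and the theta quotient -/

section

open Real Set

section OddLambert

/-- The summand `exp(-π m n t / 4)` with `m = 2i + 1`, `n = 2j + 1`. -/
noncomputable def oddExp (t : ℝ) (p : ℕ × ℕ) : ℝ :=
  rexp (-(π / 4 * ((2 * p.1 + 1) * (2 * p.2 + 1)) * t))

/-- The Lambert series `∑ f(i) g(j) exp(-π (2i + 1) (2j + 1) t / 4)`. -/
noncomputable def oddLambert (f g : ℕ → ℝ) (t : ℝ) : ℝ := ∑' p : ℕ × ℕ, f p.1 * g p.2 * oddExp t p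

theorem oddExp_pos (t : ℝ) (p : ℕ × ℕ) : 0 < oddExp t p := exp_pos _

theorem oddExp_anti {s t : ℝ} (h : s ≤ t) (p : ℕ × ℕ) : oddExp t p ≤ oddExp s p := by
  rw [oddExp, oddExp, exp_le_exp, neg_le_neg_iff]
  gcongr

theorem summable_inv_odd_sq : Summable fun i : ℕ => ((2 * i + 1 : ℝ) ^ 2)⁻¹ := by
  have := (Real.summable_nat_pow_inv (p := 2)).mpr one_lt_two
  have h := this.comp_injective (i := fun i : ℕ => 2 * i + 1) (fun a b h => by simpa using h)
  simpa [Function.comp_def] using h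

theorem exp_neg_le_factorial_div_pow {x : ℝ} (hx : 0 < x) (k : ℕ) :
    rexp (-x) ≤ k.factorial / x ^ k := by
  have h := Real.pow_div_factorial_le_exp x hx.le k
  rw [exp_neg, inv_le_comm₀ (exp_pos x) (by positivity), inv_div]
  exact h

variable {f g : ℕ → ℝ}

theorem summable_weight_mul_oddExp {t : ℝ} (ht : 0 < t) :
    Summable fun p : ℕ × ℕ => (2 * p.1 + 1) * oddExp t p := by
  have h := (summable_inv_odd_sq.mul_of_nonneg summable_inv_odd_sq (fun _ => by positivity)
    (fun _ => by positivity)).mul_left (6 / (π / 4 * t) ^ 3)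
  refine h.of_nonneg_of_le (fun p => mul_nonneg (by positivity) (oddExp_pos t p).le) fun p => ?_
  have h1 := exp_neg_le_factorial_div_pow
    (x := π / 4 * ((2 * p.1 + 1) * (2 * p.2 + 1)) * t) (by positivity) 3
  have h2 : (1 : ℝ) ≤ 2 * p.2 + 1 := by
    have : (0 : ℝ) ≤ p.2 := Nat.cast_nonneg _
    linarith
  calc (2 * p.1 + 1) * oddExp t p
      ≤ (2 * p.1 + 1) * (Nat.factorial 3 / (π / 4 * ((2 * p.1 + 1) * (2 * p.2 + 1)) * t) ^ 3) := by
        gcongr; exact h1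
    _ = 6 / (π / 4 * t) ^ 3 * (((2 * p.1 + 1 : ℝ) ^ 2)⁻¹ * ((2 * p.2 + 1 : ℝ) ^ 3)⁻¹) := by
        simp only [Nat.factorial]
        field_simp
        norm_num
    _ ≤ _ := by
        gcongr
        norm_num

theorem abs_mul_oddExp_le {t : ℝ} (hf : ∀ i, |f i| ≤ 2 * i + 1) (hg : ∀ j, |g j| ≤ 1)
    (p : ℕ × ℕ) : ‖f p.1 * g p.2 * oddExp t p‖ ≤ (2 * p.1 + 1) * oddExp t p := by
  rw [norm_mul, norm_mul, norm_of_nonneg (oddExp_pos t p).le]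
  refine mul_le_mul_of_nonneg_right ?_ (oddExp_pos t p).le
  calc ‖f p.1‖ * ‖g p.2‖ ≤ (2 * p.1 + 1) * 1 :=
        mul_le_mul (hf _) (hg _) (norm_nonneg _) (by positivity)
    _ = _ := mul_one _

theorem summable_norm_mul_oddExp {t : ℝ} (ht : 0 < t) (hf : ∀ i, |f i| ≤ 2 * i + 1)
    (hg : ∀ j, |g j| ≤ 1) : Summable fun p : ℕ × ℕ => ‖f p.1 * g p.2 * oddExp t p‖ :=
  (summable_weight_mul_oddExp ht).of_nonneg_of_le (fun _ => norm_nonneg _)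
    (abs_mul_oddExp_le hf hg)

theorem hasSum_oddLambert {t : ℝ} (ht : 0 < t) (hf : ∀ i, |f i| ≤ 2 * i + 1)
    (hg : ∀ j, |g j| ≤ 1) :
    HasSum (fun p : ℕ × ℕ => f p.1 * g p.2 * oddExp t p) (oddLambert f g t) :=
  (summable_norm_mul_oddExp ht hf hg).of_norm.hasSum

theorem one_le_odd (i : ℕ) : (1 : ℝ) ≤ 2 * i + 1 := by
  have : (0 : ℝ) ≤ i := Nat.cast_nonneg _
  linarith

theorem abs_div_odd_le (hg : ∀ j, |g j| ≤ 1) (j : ℕ) : |g j / (2 * j + 1)| ≤ 1 := by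
  rw [abs_div, abs_of_pos (by positivity : (0 : ℝ) < 2 * j + 1)]
  exact div_le_one_of_le₀ ((hg j).trans (one_le_odd j)) (by positivity)

/-- Differentiation cancels the denominator 2j + 1 and leaves the weight 2i + 1. The termwise
derivatives are dominated on (t/2, ∞) by their values at t/2. -/
theorem hasDerivAt_oddLambert (hf : ∀ i, |f i| ≤ 1) (hg : ∀ j, |g j| ≤ 1) {t : ℝ} (ht : 0 < t) :
    HasDerivAt (oddLambert f fun j => g j / (2 * j + 1))
      (-(π / 4) * oddLambert (fun i => f i * (2 * i + 1)) g t) t := by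
  have hf' : ∀ i, |f i * (2 * i + 1)| ≤ 2 * i + 1 := fun i => by
    rw [abs_mul, abs_of_pos (by positivity : (0 : ℝ) < 2 * i + 1)]
    exact mul_le_of_le_one_left (by positivity) (hf i)
  rw [oddLambert, ← tsum_mul_left]
  refine hasDerivAt_tsum_of_isPreconnected (t := Ioi (t / 2)) (y₀ := t)
    (u := fun p => π / 4 * ((2 * p.1 + 1) * oddExp (t / 2) p))
    (g' := fun p y => -(π / 4) * (f p.1 * (2 * p.1 + 1) * g p.2 * oddExp y p))
    ((summable_weight_mul_oddExp (half_pos ht)).mul_left _) isOpen_Ioi isPreconnected_Ioi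
    (fun p y _ => ?_) (fun p y hy => ?_) (half_lt_self ht)
    (hasSum_oddLambert ht (fun i => (hf i).trans (one_le_odd i)) (abs_div_odd_le hg)).summable
    (half_lt_self ht)
  · have h := (((hasDerivAt_id y).const_mul
      (π / 4 * ((2 * p.1 + 1) * (2 * p.2 + 1)))).neg.exp).const_mul
      (f p.1 * (g p.2 / (2 * p.2 + 1)))
    convert! h using 1
    simp only [oddExp, id, Pi.neg_apply]
    field_simp
  · rw [norm_mul, norm_neg, norm_of_nonneg (by positivity : (0 : ℝ) ≤ π / 4)]
    refine mul_le_mul_of_nonneg_left ((abs_mul_oddExp_le hf' hg p).trans ?_) (by positivity)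
    exact mul_le_mul_of_nonneg_left (oddExp_anti (le_of_lt hy) p) (by positivity)

end OddLambert

section ThetaArtanh

/-- Squares are 0 or 1 modulo 4 according to parity, so u survives only in the odd terms, which form
θ₂. -/
theorem hasSum_zpow_sq {u : ℂ} (hu : u ^ 4 = 1) {t : ℝ} (ht : 0 < t) :
    HasSum (fun n : ℤ => (u * rexp (-(π / 4 * t))) ^ n ^ 2)
      ((thetaThree t : ℂ) + u * thetaTwo t) := by
  have hu0 : u ≠ 0 := by rintro rfl; norm_num at hu
  have hx : ∀ m : ℤ, ((rexp (-(π / 4 * t)) : ℝ) : ℂ) ^ m = (rexp (m * -(π / 4 * t)) : ℝ) := by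
    intro m
    rw [Complex.ofReal_exp, Complex.ofReal_exp, ← Complex.exp_int_mul]
    push_cast
    rfl
  refine hasSum_int_of_even_of_odd ?_ ?_
  · refine (Complex.hasSum_ofReal.mpr (hasSum_thetaThree ht)).congr_fun fun n => ?_
    rw [mul_zpow, hx, show (2 * n) ^ 2 = ((4 : ℕ) : ℤ) * n ^ 2 by push_cast; ring, zpow_mul,
      zpow_natCast, hu, one_zpow, one_mul]
    push_cast
    ring_nf
  · refine ((Complex.hasSum_ofReal.mpr (hasSum_thetaTwo ht)).mul_left u).congr_fun fun n => ?_
    rw [mul_zpow, hx, show (2 * n + 1) ^ 2 = ((4 : ℕ) : ℤ) * (n ^ 2 + n) + 1 by push_cast; ring,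
      zpow_add_one₀ hu0, zpow_mul, zpow_natCast, hu, one_zpow, one_mul]
    push_cast
    ring_nf

/-- One identity serves twice: u = 1 gives artanh(θ₂/θ₃) and u = i gives arctan(θ₂/θ₃). -/
theorem theta_add_eq_exp_mul {u : ℂ} (hu : u ^ 4 = 1) {t : ℝ} (ht : 0 < t) {e : ℂ}
    (he : HasSum (fun p : ℕ × ℕ => u ^ ((2 * p.1 + 1) * (2 * p.2 + 1)) * (oddExp t p : ℂ) /
      (2 * p.2 + 1)) e) :
    (thetaThree t : ℂ) + u * thetaTwo t = Complex.exp (4 * e) * (thetaThree t - u * thetaTwo t) := by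
  have hu1 : ‖u‖ = 1 := Complex.norm_eq_one_of_pow_eq_one hu (by norm_num)
  have hu0 : u ≠ 0 := by rintro rfl; norm_num at hu
  have hx : ‖u * rexp (-(π / 4 * t))‖ < 1 := by
    rw [norm_mul, hu1, one_mul, Complex.norm_real, norm_of_nonneg (exp_pos _).le, exp_lt_one_iff]
    have := pi_pos
    simp only [neg_lt_zero]
    positivity
  have h := theta_eq_exp_mul_theta_neg (mul_ne_zero hu0 (Complex.ofReal_ne_zero.mpr (exp_pos _).ne')) hx
    (hasSum_zpow_sq hu ht) (b := thetaThree t - u * thetaTwo t) (e := e) ?_ ?_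
  · exact h
  · have := hasSum_zpow_sq (u := -u) (by rw [← hu]; ring) ht
    simpa [sub_eq_add_neg] using this
  · refine he.congr_fun fun p => ?_
    rw [mul_pow, oddExp, ← Complex.ofReal_pow, ← exp_nat_mul]
    push_cast
    ring_nf

theorem thetaRatio_eq_tanh {t : ℝ} (ht : 0 < t) :
    thetaRatio t = tanh (2 * oddLambert (fun _ => 1) (fun j => 1 / (2 * j + 1)) t) := by
  set a := oddLambert (fun _ => 1) (fun j => 1 / (2 * j + 1)) t with ha
  have h := hasSum_oddLambert (f := fun _ => 1) (g := fun j : ℕ => 1 / (2 * j + 1)) ht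
    (fun i => by simp)
    (abs_div_odd_le (g := fun _ => 1) fun _ => by simp)
  rw [← ha] at h
  have h1 := theta_add_eq_exp_mul (u := 1) (by norm_num) ht (e := (a : ℂ))
    ((Complex.hasSum_ofReal.mpr h).congr_fun fun p => by push_cast; ring)
  have h2 : thetaThree t + thetaTwo t = rexp (4 * a) * (thetaThree t - thetaTwo t) := by
    rw [one_mul] at h1
    exact_mod_cast h1
  have h3 := thetaThree_pos ht
  rw [thetaRatio, tanh_eq_sinh_div_cosh, div_eq_div_iff h3.ne' (cosh_pos _).ne', sinh_eq, cosh_eq,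
    show 4 * a = 2 * a + 2 * a by ring, exp_add] at *
  have h4 : rexp (2 * a) * rexp (-(2 * a)) = 1 := by rw [← exp_add]; simp
  linear_combination rexp (-(2 * a)) / 2 * h2 +
    rexp (2 * a) * (thetaThree t - thetaTwo t) / 2 * h4

/-- For u = i the identity says (θ₃ + iθ₂)/(θ₃ - iθ₂) = exp(4ic). It is balanced by exp(-2ic), and
imaginary parts are compared. -/
theorem thetaTwo_mul_cos_eq {t : ℝ} (ht : 0 < t) {c : ℝ}
    (hc : c = oddLambert (fun i => (-1) ^ i) (fun j => (-1) ^ j / (2 * j + 1)) t) :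
    thetaTwo t * cos (2 * c) = thetaThree t * sin (2 * c) := by
  have h := hasSum_oddLambert (f := fun i => (-1) ^ i) (g := fun j : ℕ => (-1) ^ j / (2 * j + 1)) ht
    (fun i => by simp)
    (abs_div_odd_le (g := fun j => (-1) ^ j) fun _ => by simp)
  rw [← hc] at h
  have h1 := theta_add_eq_exp_mul (u := Complex.I) Complex.I_pow_four ht (e := Complex.I * c)
    (((Complex.hasSum_ofReal.mpr h).mul_left Complex.I).congr_fun fun p => ?_)
  · have h2 : Complex.exp (4 * (Complex.I * c)) = Complex.exp ((2 * c : ℝ) * Complex.I) *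
        Complex.exp ((2 * c : ℝ) * Complex.I) := by
      rw [← Complex.exp_add]; congr 1; push_cast; ring
    have h3 : Complex.exp (-(2 * c : ℝ) * Complex.I) * Complex.exp ((2 * c : ℝ) * Complex.I) = 1 := by
      rw [← Complex.exp_add]; simp
    have h4 : Complex.exp (-(2 * c : ℝ) * Complex.I) * (thetaThree t + Complex.I * thetaTwo t) =
        Complex.exp ((2 * c : ℝ) * Complex.I) * (thetaThree t - Complex.I * thetaTwo t) := by
      rw [h1, h2]
      linear_combination (Complex.exp ((2 * c : ℝ) * Complex.I) *
        (thetaThree t - Complex.I * thetaTwo t)) * h3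
    rw [← Complex.ofReal_neg, Complex.exp_mul_I, Complex.exp_mul_I] at h4
    simp only [← Complex.ofReal_cos, ← Complex.ofReal_sin, cos_neg, sin_neg] at h4
    generalize cos (2 * c) = x at h4 ⊢
    generalize sin (2 * c) = y at h4 ⊢
    have h5 := congrArg Complex.im h4
    simp at h5
    linarith
  · have e1 : Complex.I ^ ((2 * p.1 + 1) * (2 * p.2 + 1)) =
        Complex.I * (-1) ^ p.1 * (-1) ^ p.2 := by
      rw [pow_mul, pow_succ Complex.I (2 * p.1), pow_mul, Complex.I_sq, mul_pow, ← pow_mul,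
        mul_comm p.1, pow_mul, Odd.neg_one_pow ⟨p.2, rfl⟩, pow_succ, pow_mul, Complex.I_sq]
      ring
    rw [e1]
    push_cast
    ring

/-- The tangent is already known, and only the branch is at issue. Summing over j first makes c an
alternating series with decreasing terms arctan(x^(2i+1)), so 0 ≤ c ≤ arctan x < π/4. -/
theorem arctan_thetaRatio {t : ℝ} (ht : 0 < t) :
    arctan (thetaRatio t) =
      2 * oddLambert (fun i => (-1) ^ i) (fun j => (-1) ^ j / (2 * j + 1)) t := by
  set c := oddLambert (fun i => (-1) ^ i) (fun j => (-1) ^ j / (2 * j + 1)) t with hc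
  have h := hasSum_oddLambert (f := fun i => (-1) ^ i) (g := fun j : ℕ => (-1) ^ j / (2 * j + 1)) ht
    (fun i => by simp) (abs_div_odd_le (g := fun j => (-1) ^ j) fun _ => by simp)
  rw [← hc] at h
  set x := rexp (-(π / 4 * t)) with hx
  have hx0 : 0 < x := exp_pos _
  have hx1 : x < 1 := by
    have := pi_pos
    rw [hx, exp_lt_one_iff, neg_lt_zero]
    positivity
  have h1 : HasSum (fun i : ℕ => (-1) ^ i * arctan (x ^ (2 * i + 1))) c := by
    refine h.prod_fiberwise fun i => ?_
    refine ((hasSum_arctan (x := x ^ (2 * i + 1)) ?_).mul_left ((-1) ^ i)).congr_fun fun j => ?_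
    · rw [norm_pow, norm_of_nonneg hx0.le]
      exact pow_lt_one₀ hx0.le hx1 (Nat.succ_ne_zero _)
    · rw [oddExp, hx, ← pow_mul, ← exp_nat_mul]
      push_cast
      ring_nf
  have hanti : Antitone fun i : ℕ => arctan (x ^ (2 * i + 1)) := fun i j hij =>
    arctan_strictMono.monotone (pow_le_pow_of_le_one hx0.le hx1.le (by omega))
  have hl := hanti.alternating_series_le_tendsto h1.tendsto_sum_nat 0
  have hu := hanti.tendsto_le_alternating_series h1.tendsto_sum_nat 0
  simp only [mul_zero, Finset.range_zero, Finset.sum_empty, zero_add, Finset.sum_range_one, pow_zero,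
    one_mul, pow_one] at hl hu
  have hu' : c < π / 4 := hu.trans_lt (by rw [← arctan_one]; exact arctan_strictMono hx1)
  have hcos : 0 < cos (2 * c) := cos_pos_of_mem_Ioo ⟨by linarith [pi_pos], by linarith⟩
  rw [show thetaRatio t = tan (2 * c) by
    rw [thetaRatio, tan_eq_sin_div_cos, div_eq_div_iff (thetaThree_pos ht).ne' hcos.ne',
      thetaTwo_mul_cos_eq ht hc, mul_comm]]
  exact arctan_tan (by linarith [pi_pos]) (by linarith)

end ThetaArtanh

section ThetaQuarter

open HurwitzZeta

theorem hasSum_int_reflect {M : Type*} [AddCommMonoid M] [TopologicalSpace M] {f : ℤ → M} {a : M}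
    (hf : HasSum f a) : HasSum (fun n => f (-n - 1)) a :=
  ((Equiv.subRight (1 : ℤ)).hasSum_iff (f := fun n => f n) |>.mpr hf |> fun h =>
    ((Equiv.neg ℤ).hasSum_iff (f := fun n => f (n - 1))).mpr h)

variable {t : ℝ} (ht : 0 < t)
include ht

/-- Every odd integer is ±(4k + 1) for exactly one k, so this sum takes half of θ₂. -/
theorem hasSum_thetaTwo_half :
    HasSum (fun k : ℤ => rexp (-(π / 4 * (4 * k + 1) ^ 2 * t))) (thetaTwo t / 2) := by
  have h := hasSum_int_evenKernel (1 / 4) (t := 4 * t) (by positivity)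
  have h' : HasSum (fun k : ℤ => rexp (-(π / 4 * (4 * k + 1) ^ 2 * t)))
      (evenKernel ((1 / 4 : ℝ) : UnitAddCircle) (4 * t)) :=
    h.congr_fun fun k => by ring_nf
  have h2 := (hasSum_int_of_even_of_odd (f := fun n : ℤ => rexp (-π * (n + 1 / 2) ^ 2 * t))
    (h'.congr_fun fun n => by push_cast; ring_nf)
    ((hasSum_int_reflect h').congr_fun fun n => by push_cast; ring_nf)).unique
      (hasSum_thetaTwo ht)
  rwa [← h2, add_self_div_two]

/-- Splitting Σ (-1)ⁿ n exp(-π(n + 1/2)²t) by parity, with n ↦ -n - 1 on the odd part, yields ((4k +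
1) ∓ 1)/2 as weights. The two corrections by `G` cancel, and the triple-product identity at z =
exp(-πt) evaluates the sum. -/
theorem hasSum_thetaTwo_mul_thetaThree_mul_thetaFour :
    HasSum (fun k : ℤ => (4 * k + 1) * rexp (-(π / 4 * (4 * k + 1) ^ 2 * t)))
      (thetaTwo t * thetaThree t * thetaFour t / 2) := by
  set G := thetaTwo t / 2 with hG
  set D := 4 * oddKernel ((1 / 4 : ℝ) : UnitAddCircle) (4 * t) with hD
  have h1 : HasSum (fun k : ℤ => (4 * k + 1) * rexp (-(π / 4 * (4 * k + 1) ^ 2 * t))) D :=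
    ((hasSum_int_oddKernel (1 / 4) (x := 4 * t) (by positivity)).mul_left 4).congr_fun
      fun k => by ring_nf
  have h0 := hasSum_thetaTwo_half ht
  have h2 : HasSum (fun n : ℤ => (-1) ^ n * n * rexp (-π * (n + 1 / 2) ^ 2 * t))
      ((D - G) / 2 + (D + G) / 2) := by
    refine hasSum_int_of_even_of_odd ?_ ?_
    · refine ((h1.sub h0).div_const 2).congr_fun fun n => ?_
      rw [(even_two_mul n).neg_one_zpow]
      push_cast
      ring_nf
    · refine (hasSum_int_reflect ((h1.add h0).div_const 2)).congr_fun fun n => ?_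
      rw [Odd.neg_one_zpow ⟨n, rfl⟩]
      push_cast
      ring_nf
  set z : ℂ := ((rexp (-(π * t)) : ℝ) : ℂ) with hzdef
  have hz0 : z ≠ 0 := Complex.ofReal_ne_zero.mpr (exp_pos _).ne'
  have hz : ‖z‖ < 1 := by
    rw [hzdef, Complex.norm_real, norm_of_nonneg (exp_pos _).le, exp_lt_one_iff, neg_lt_zero]
    have := pi_pos
    positivity
  have hx : ∀ m : ℤ, z ^ m = (rexp (m * -(π * t)) : ℝ) := by
    intro m
    rw [hzdef, Complex.ofReal_exp, Complex.ofReal_exp, ← Complex.exp_int_mul]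
    push_cast
    rfl
  have key := theta_mul_theta_neg_mul hz0 hz (a := thetaThree t) (b := thetaFour t)
    (c := (rexp (π * t / 4) * thetaTwo t : ℝ)) (d := (rexp (π * t / 4) * D : ℝ)) ?_ ?_ ?_ ?_
  · have k2 : thetaThree t * thetaFour t * (rexp (π * t / 4) * thetaTwo t) =
      2 * (rexp (π * t / 4) * D) := by exact_mod_cast key
    have k3 : thetaTwo t * thetaThree t * thetaFour t / 2 = D := by
      have := (exp_pos (π * t / 4)).ne'
      field_simp at k2 ⊢
      linear_combination k2
    rwa [k3]
  · refine (Complex.hasSum_ofReal.mpr (hasSum_thetaThree ht)).congr_fun fun n => ?_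
    rw [hx]
    push_cast
    ring_nf
  · refine (Complex.hasSum_ofReal.mpr (hasSum_thetaFour ht)).congr_fun fun n => ?_
    rw [← neg_one_mul, mul_zpow, hx]
    have : (-1 : ℂ) ^ n ^ 2 = (-1) ^ n := by
      rcases Int.even_or_odd n with h | h
      · rw [h.neg_one_zpow, (h.pow_of_ne_zero two_ne_zero).neg_one_zpow]
      · rw [h.neg_one_zpow, h.pow.neg_one_zpow]
    rw [this]
    push_cast
    ring_nf
  · refine (Complex.hasSum_ofReal.mpr ((hasSum_thetaTwo ht).mul_left (rexp (π * t / 4)))).congr_fun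
      fun n => ?_
    rw [hx, ← exp_add]
    push_cast
    ring_nf
  · rw [← add_div, show D - G + (D + G) = D * 2 by ring, mul_div_cancel_right₀ _ two_ne_zero] at h2
    refine (Complex.hasSum_ofReal.mpr (h2.mul_left (rexp (π * t / 4)))).congr_fun fun n => ?_
    rw [hx, mul_left_comm, ← exp_add]
    push_cast
    ring_nf

end ThetaQuarter

end

/-! ### The Rogers–Zudilin transformation -/

section

open Real Set MeasureTheory Filter Topology

section Integrability

theorem integrable_tsum_of_summable_integral_norm {α ι : Type*} [Countable ι] [MeasurableSpace α]
    {μ : Measure α} {F : ι → α → ℝ} (hF : ∀ i, Integrable (F i) μ)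
    (hs : Summable fun i => ∫ a, ‖F i a‖ ∂μ) : Integrable (fun a => ∑' i, F i a) μ := by
  have h1 : ∑' i, ∫⁻ a, ‖F i a‖ₑ ∂μ ≠ ⊤ := by
    have (i : ι) : ∫⁻ a, ‖F i a‖ₑ ∂μ = ENNReal.ofReal (∫ a, ‖F i a‖ ∂μ) :=
      (ofReal_integral_norm_eq_lintegral_enorm (hF i)).symm
    rw [funext this]
    exact hs.tsum_ofReal_ne_top
  rw [← lintegral_tsum fun i => (hF i).1.enorm] at h1
  have h2 : ∀ᵐ a ∂μ, ∑' i, ‖F i a‖ₑ < ⊤ :=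
    ae_lt_top' (AEMeasurable.tsum fun i => (hF i).1.enorm) h1
  refine ⟨aestronglyMeasurable_of_tendsto_ae atTop (f := fun (s : Finset ι) a => ∑ i ∈ s, F i a)
    (fun s => Finset.aestronglyMeasurable_fun_sum s fun i _ => (hF i).1) ?_,
    (lintegral_mono fun a => enorm_tsum_le_tsum_enorm).trans_lt h1.lt_top⟩
  filter_upwards [h2] with a ha
  exact (Summable.of_nnnorm (tsum_enorm_ne_top_iff_summable_nnnorm.mp ha.ne)).hasSum

end Integrability

section RogersZudilin

/-- The quantity `π (2i + 1) (2k + 1) / 4`. -/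
noncomputable def oddWeight (p : ℕ × ℕ) : ℝ := π / 4 * ((2 * p.1 + 1) * (2 * p.2 + 1))

theorem oddWeight_pos (p : ℕ × ℕ) : 0 < oddWeight p := by
  rw [oddWeight]; positivity

theorem integrableOn_sq_mul_exp {b : ℝ} (hb : 0 < b) :
    IntegrableOn (fun u : ℝ => u ^ 2 * rexp (-(b * u))) (Ioi 0) := by
  have := integrableOn_rpow_mul_exp_neg_mul_rpow (p := 1) (s := 2) (b := b) (by norm_num) one_pos hb
  simpa using this

theorem integral_sq_mul_exp {b : ℝ} (hb : 0 < b) :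
    ∫ u in Ioi (0 : ℝ), u ^ 2 * rexp (-(b * u)) = 2 / b ^ 3 := by
  have := Real.integral_rpow_mul_exp_neg_mul_Ioi (a := 3) (r := b) (by norm_num) hb
  rw [show (3 : ℝ) - 1 = (2 : ℕ) by norm_num, show (3 : ℝ) = (2 : ℕ) + 1 by norm_num,
    Gamma_nat_eq_factorial] at this
  simp only [rpow_natCast] at this
  rw [this, show ((2 : ℕ) : ℝ) + 1 = (3 : ℕ) by norm_num, rpow_natCast]
  simp [Nat.factorial]
  field_simp

theorem exp_neg_div_le {a u : ℝ} (ha : 0 < a) (hu : 0 < u) : rexp (-(a / u)) ≤ 2 / a ^ 2 * u ^ 2 := by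
  refine (exp_neg_le_factorial_div_pow (div_pos ha hu) 2).trans_eq ?_
  simp [Nat.factorial]
  field_simp

theorem measurable_exp_mul_exp (a b : ℝ) :
    Measurable fun u : ℝ => rexp (-(a / u)) * rexp (-(b * u)) := by fun_prop

theorem integrableOn_exp_mul_exp {a b : ℝ} (ha : 0 < a) (hb : 0 < b) :
    IntegrableOn (fun u : ℝ => rexp (-(a / u)) * rexp (-(b * u))) (Ioi 0) := by
  refine ((integrableOn_sq_mul_exp hb).const_mul (2 / a ^ 2)).mono'
    (measurable_exp_mul_exp a b).aestronglyMeasurable ?_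
  filter_upwards [self_mem_ae_restrict measurableSet_Ioi] with u hu
  rw [norm_of_nonneg (by positivity), ← mul_assoc]
  exact mul_le_mul_of_nonneg_right (exp_neg_div_le ha hu) (exp_pos _).le

/-- Trading exp(-a/u) for 2u²/a² gives decay in a and b at once, enough for summation over all four
odd indices. -/
theorem integral_exp_mul_exp_le {a b : ℝ} (ha : 0 < a) (hb : 0 < b) :
    ∫ u in Ioi (0 : ℝ), rexp (-(a / u)) * rexp (-(b * u)) ≤ 4 / (a ^ 2 * b ^ 3) := by
  calc _ ≤ ∫ u in Ioi (0 : ℝ), 2 / a ^ 2 * (u ^ 2 * rexp (-(b * u))) := by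
        refine setIntegral_mono_on (integrableOn_exp_mul_exp ha hb)
          ((integrableOn_sq_mul_exp hb).const_mul _) measurableSet_Ioi fun u hu => ?_
        rw [← mul_assoc]
        exact mul_le_mul_of_nonneg_right (exp_neg_div_le ha hu) (exp_pos _).le
    _ = _ := by
        rw [integral_const_mul, integral_sq_mul_exp hb]
        field_simp
        norm_num

theorem integral_exp_mul_exp_scale {a b c : ℝ} (hc : 0 < c) :
    c * ∫ u in Ioi (0 : ℝ), rexp (-(a / u)) * rexp (-(b * u)) =
      ∫ u in Ioi (0 : ℝ), rexp (-(a * c / u)) * rexp (-(b / c * u)) := by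
  have h := integral_comp_mul_left_Ioi (fun u => rexp (-(a * c / u)) * rexp (-(b / c * u))) 0 hc
  rw [mul_zero, smul_eq_mul, eq_inv_mul_iff_mul_eq₀ hc.ne'] at h
  rw [← h]
  congr 1
  refine setIntegral_congr_fun measurableSet_Ioi fun u hu => ?_
  have : u ≠ 0 := ne_of_gt hu
  congr 3 <;> field_simp

theorem summable_inv_odd_prod : Summable fun p : ℕ × ℕ =>
    (((2 * p.1 + 1 : ℝ) * (2 * p.2 + 1)) ^ 2)⁻¹ := by
  refine (summable_inv_odd_sq.mul_of_nonneg summable_inv_odd_sq (fun _ => by positivity)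
    (fun _ => by positivity)).congr fun p => ?_
  rw [mul_pow, mul_inv]

theorem summable_integral_exp_mul_exp : Summable fun P : (ℕ × ℕ) × (ℕ × ℕ) =>
    ∫ u in Ioi (0 : ℝ), rexp (-(oddWeight P.1 / u)) * rexp (-(oddWeight P.2 * u)) := by
  refine Summable.of_nonneg_of_le (fun P => integral_nonneg fun u => by positivity)
    (fun P => integral_exp_mul_exp_le (oddWeight_pos _) (oddWeight_pos _)) ?_
  refine Summable.of_nonneg_of_le (fun P => ?_) (fun P => ?_)
    ((summable_inv_odd_prod.mul_of_nonneg summable_inv_odd_prod (fun _ => by positivity)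
    (fun _ => by positivity)).mul_left (4 / (π / 4) ^ 5))
  · have h1 := oddWeight_pos P.1
    have h2 := oddWeight_pos P.2
    positivity
  · rw [oddWeight, oddWeight]
    have h1 : (1 : ℝ) ≤ (2 * P.2.1 + 1) * (2 * P.2.2 + 1) :=
      one_le_mul_of_one_le_of_one_le (one_le_odd _) (one_le_odd _)
    calc _ = 4 / (π / 4) ^ 5 * ((((2 * P.1.1 + 1 : ℝ) * (2 * P.1.2 + 1)) ^ 2)⁻¹ *
          (((2 * P.2.1 + 1 : ℝ) * (2 * P.2.2 + 1)) ^ 3)⁻¹) := by field_simp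
      _ ≤ _ := by
        gcongr
        norm_num

variable {f₁ f₂ f₃ f₄ : ℕ → ℝ}

/-- Integration of a product of two Lambert series term by term. -/
theorem hasSum_integral_oddLambert_mul {w : (ℕ × ℕ) × (ℕ × ℕ) → ℝ} {F : ℝ → ℝ}
    (hs : ∀ u : ℝ, 0 < u → HasSum (fun P => w P *
      (rexp (-(oddWeight P.1 / u)) * rexp (-(oddWeight P.2 * u)))) (F u))
    (hw : Summable fun P => |w P| *
      ∫ u in Ioi (0 : ℝ), rexp (-(oddWeight P.1 / u)) * rexp (-(oddWeight P.2 * u))) :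
    IntegrableOn F (Ioi 0) ∧ HasSum (fun P => w P *
      ∫ u in Ioi (0 : ℝ), rexp (-(oddWeight P.1 / u)) * rexp (-(oddWeight P.2 * u)))
      (∫ u in Ioi (0 : ℝ), F u) := by
  have hF : ∀ u ∈ Ioi (0 : ℝ), ∑' P, w P * (rexp (-(oddWeight P.1 / u)) *
      rexp (-(oddWeight P.2 * u))) = F u := fun u hu => (hs u hu).tsum_eq
  have hi : ∀ P, IntegrableOn (fun u => w P * (rexp (-(oddWeight P.1 / u)) *
      rexp (-(oddWeight P.2 * u)))) (Ioi 0) := fun P =>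
    (integrableOn_exp_mul_exp (oddWeight_pos _) (oddWeight_pos _)).const_mul _
  have hsum : Summable fun P => ∫ u in Ioi (0 : ℝ), ‖w P * (rexp (-(oddWeight P.1 / u)) *
      rexp (-(oddWeight P.2 * u)))‖ := by
    refine hw.congr fun P => ?_
    rw [← integral_const_mul]
    refine integral_congr_ae (Filter.Eventually.of_forall fun u => ?_)
    simp only [norm_mul, norm_eq_abs, abs_exp]
  refine ⟨(integrableOn_congr_fun hF measurableSet_Ioi).mp
    (integrable_tsum_of_summable_integral_norm hi hsum), ?_⟩
  have h := hasSum_integral_of_summable_integral_norm hi hsum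
  simp_rw [integral_const_mul] at h
  rwa [setIntegral_congr_fun measurableSet_Ioi hF] at h

/-- The Rogers–Zudilin transformation. -/
theorem integral_oddLambert_mul_oddLambert (h₁ : ∀ i, |f₁ i| ≤ 1) (h₂ : ∀ i, |f₂ i| ≤ 1)
    (h₃ : ∀ i, |f₃ i| ≤ 1) (h₄ : ∀ i, |f₄ i| ≤ 1) :
    IntegrableOn (fun s => oddLambert f₁ (fun j => f₂ j / (2 * j + 1)) s⁻¹ *
        oddLambert (fun k => f₃ k * (2 * k + 1)) f₄ s) (Ioi 0) ∧
    ∫ s in Ioi (0 : ℝ), oddLambert f₁ (fun j => f₂ j / (2 * j + 1)) s⁻¹ *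
        oddLambert (fun k => f₃ k * (2 * k + 1)) f₄ s =
      ∫ u in Ioi (0 : ℝ), oddLambert f₁ f₃ u⁻¹ * oddLambert f₂ f₄ u := by
  have h₁' : ∀ i, |f₁ i| ≤ 2 * i + 1 := fun i => (h₁ i).trans (one_le_odd i)
  have h₂' : ∀ i, |f₂ i| ≤ 2 * i + 1 := fun i => (h₂ i).trans (one_le_odd i)
  have h₃' : ∀ i, |f₃ i * (2 * i + 1)| ≤ 2 * i + 1 := fun i => by
    rw [abs_mul, abs_of_pos (by positivity : (0 : ℝ) < 2 * i + 1)]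
    exact mul_le_of_le_one_left (by positivity) (h₃ i)
  have prodSum : ∀ {f g f' g' : ℕ → ℝ}, (∀ i, |f i| ≤ 2 * i + 1) → (∀ i, |g i| ≤ 1) →
      (∀ i, |f' i| ≤ 2 * i + 1) → (∀ i, |g' i| ≤ 1) → ∀ u : ℝ, 0 < u →
      HasSum (fun P : (ℕ × ℕ) × (ℕ × ℕ) => (f P.1.1 * g P.1.2 * (f' P.2.1 * g' P.2.2)) *
        (rexp (-(oddWeight P.1 / u)) * rexp (-(oddWeight P.2 * u))))
        (oddLambert f g u⁻¹ * oddLambert f' g' u) := by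
    intro f g f' g' hf hg hf' hg' u hu
    refine ((hasSum_oddLambert (inv_pos.mpr hu) hf hg).mul (hasSum_oddLambert hu hf' hg')
      (summable_mul_of_summable_norm (summable_norm_mul_oddExp (inv_pos.mpr hu) hf hg)
        (summable_norm_mul_oddExp hu hf' hg'))).congr_fun fun P => ?_
    simp only [oddExp, oddWeight, div_eq_mul_inv]
    ring
  have bound : ∀ a b c d : ℝ, |a| ≤ 1 → |b| ≤ 1 → |c| ≤ 1 → |d| ≤ 1 → |a * b * (c * d)| ≤ 1 := by
    intro a b c d ha hb hc hd
    simp only [abs_mul]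
    exact mul_le_one₀ (mul_le_one₀ ha (abs_nonneg _) hb) (by positivity)
      (mul_le_one₀ hc (abs_nonneg _) hd)
  have hR := And.right <| hasSum_integral_oddLambert_mul (prodSum h₁' h₃ h₂' h₄)
    (summable_integral_exp_mul_exp.of_nonneg_of_le
      (fun P => mul_nonneg (abs_nonneg _) (integral_nonneg fun u => by positivity))
      fun P => mul_le_of_le_one_left (integral_nonneg fun u => by positivity)
        (bound _ _ _ _ (h₁ _) (h₃ _) (h₂ _) (h₄ _)))
  have hR' := (Equiv.prodProdProdComm ℕ ℕ ℕ ℕ).hasSum_iff.mpr hR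
  have hRs := (Equiv.prodProdProdComm ℕ ℕ ℕ ℕ).summable_iff.mpr
    (summable_integral_exp_mul_exp.of_nonneg_of_le
      (fun P => mul_nonneg (abs_nonneg _) (integral_nonneg fun u => by positivity))
      fun P => mul_le_of_le_one_left (integral_nonneg fun u => by positivity)
        (bound _ _ _ _ (h₁ P.1.1) (h₃ P.1.2) (h₂ P.2.1) (h₄ P.2.2)))
  -- For P = ((i, j), (k, l)) the substitution has ratio c = (2k+1)/(2j+1). It exchanges j and k in
  -- the exponents, and its Jacobian is exactly the quotient of the weights.
  have scale : ∀ P : (ℕ × ℕ) × (ℕ × ℕ), (2 * P.2.1 + 1 : ℝ) / (2 * P.1.2 + 1) *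
      ∫ u in Ioi (0 : ℝ), rexp (-(oddWeight P.1 / u)) * rexp (-(oddWeight P.2 * u)) =
      ∫ u in Ioi (0 : ℝ), rexp (-(oddWeight (P.1.1, P.2.1) / u)) *
        rexp (-(oddWeight (P.1.2, P.2.2) * u)) := by
    intro P
    rw [integral_exp_mul_exp_scale (by positivity)]
    congr! 6
    · simp only [oddWeight]; field_simp
    · simp only [oddWeight]; field_simp
  have hL := hasSum_integral_oddLambert_mul (prodSum h₁' (abs_div_odd_le h₂) h₃' h₄) ?_
  · refine ⟨hL.1, hL.2.unique (hR'.congr_fun fun P => ?_)⟩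
    simp only [Function.comp, Equiv.prodProdProdComm_apply]
    rw [← scale P]
    ring
  · refine hRs.congr fun P => ?_
    simp only [Function.comp, Equiv.prodProdProdComm_apply]
    rw [← scale P, ← mul_assoc, ← abs_of_pos (by positivity :
      (0 : ℝ) < (2 * P.2.1 + 1 : ℝ) / (2 * P.1.2 + 1)), ← abs_mul]
    congr 2
    ring

end RogersZudilin

end

/-! ### The L-value as a lattice sum and as an integral -/

section

open Real Set MeasureTheory

section LatticeSums

theorem HasSum.sum_fiberwise {β γ M : Type*} [AddCommMonoid M] [TopologicalSpace M]
    [ContinuousAdd M] [RegularSpace M] {f : β → M} {a : M} (hf : HasSum f a) (g : β → γ)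
    (s : γ → Finset β) (hs : ∀ c b, b ∈ s c ↔ g b = c) : HasSum (fun c => ∑ b ∈ s c, f b) a := by
  refine (((Equiv.sigmaFiberEquiv g).hasSum_iff).mpr hf).sigma fun c => ?_
  have h := (s c).hasSum f
  exact ((Equiv.subtypeEquivRight (hs c)).symm.hasSum_iff
    (f := fun b : {b // b ∈ s c} => f b)).mpr h

/-- Summation over the lattice of primary Gaussian integers, grouped by the norm. -/
theorem hasSum_primaryOfNorm {M : Type*} [AddCommMonoid M] [TopologicalSpace M]
    [ContinuousAdd M] [RegularSpace M] {f : GaussianInt → M} {a : M}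
    (hf : HasSum (fun p : ℤ × ℤ => f ⟨4 * p.1 + 1, 2 * p.2⟩) a) :
    HasSum (fun n : ℕ => ∑ α ∈ primaryOfNorm n, f α) a := by
  let e : ℤ × ℤ ≃ {α : GaussianInt // α.re % 4 = 1 ∧ α.im % 2 = 0} :=
    { toFun := fun p => ⟨⟨4 * p.1 + 1, 2 * p.2⟩, by simp only; omega, by simp only; omega⟩
      invFun := fun α => (α.1.re / 4, α.1.im / 2)
      left_inv := fun p => by ext <;> simp only <;> omega
      right_inv := fun ⟨α, h1, h2⟩ => by ext <;> simp only <;> omega }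
  have h1 : HasSum (fun α : {α : GaussianInt // α.re % 4 = 1 ∧ α.im % 2 = 0} => f α) a :=
    (e.hasSum_iff (f := fun α : {α : GaussianInt // α.re % 4 = 1 ∧ α.im % 2 = 0} => f α)).mp hf
  refine (h1.sum_fiberwise (fun α => α.1.norm.toNat)
    (fun n => (primaryOfNorm n).subtype fun α => α.re % 4 = 1 ∧ α.im % 2 = 0) ?_).congr_fun ?_
  · rintro n ⟨α, hα⟩
    rw [Finset.mem_subtype, mem_primaryOfNorm]
    have : 0 ≤ α.norm := by rw [gaussianInt_norm_eq]; positivity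
    simp only [hα, true_and]
    omega
  · intro n
    rw [Finset.sum_subtype_eq_sum_filter, Finset.filter_true_of_mem]
    intro α hα
    rw [mem_primaryOfNorm] at hα
    exact ⟨hα.1, hα.2.1⟩

/-- The pairs `(i, j)` with `(2i + 1) (2j + 1) = n`. -/
def oddFactorizations (n : ℕ) : Finset (ℕ × ℕ) :=
  (Finset.range n ×ˢ Finset.range n).filter fun p => (2 * p.1 + 1) * (2 * p.2 + 1) = n

theorem mem_oddFactorizations {n : ℕ} {p : ℕ × ℕ} :
    p ∈ oddFactorizations n ↔ (2 * p.1 + 1) * (2 * p.2 + 1) = n := by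
  rw [oddFactorizations, Finset.mem_filter, and_iff_right_iff_imp]
  rintro rfl
  simp only [Finset.mem_product, Finset.mem_range]
  constructor <;> nlinarith

theorem sum_oddFactorizations (n : ℕ) :
    ∑ p ∈ oddFactorizations n, (-1) ^ p.2 = ((primaryOfNorm n).card : ℤ) := by
  rcases eq_or_ne n 0 with rfl | hn
  · have : primaryOfNorm 0 = ∅ := by
      refine Finset.eq_empty_of_forall_notMem fun α hα => ?_
      rw [mem_primaryOfNorm, gaussianInt_norm_eq] at hα
      have : α.re = 0 := by
        have := hα.2.2
        push_cast at this
        nlinarith [sq_nonneg α.re, sq_nonneg α.im]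
      omega
    rw [this]
    simp [oddFactorizations]
  · rw [card_primaryOfNorm hn, ArithmeticFunction.mul_apply]
    refine Finset.sum_of_injOn (fun p => (2 * p.1 + 1, 2 * p.2 + 1)) (fun p _ q _ h => ?_)
      (fun p hp => ?_) (fun q hq hq' => ?_) fun p hp => ?_
    · simp only [Prod.mk.injEq] at h
      ext <;> omega
    · exact Nat.mem_divisorsAntidiagonal.mpr ⟨mem_oddFactorizations.mp hp, hn⟩
    · rw [Nat.mem_divisorsAntidiagonal] at hq
      rcases Nat.mod_two_eq_zero_or_one q.1 with h1 | h1
      · rw [oddIndicator_apply, chiFour_of_even h1]; ring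
      rcases Nat.mod_two_eq_zero_or_one q.2 with h2 | h2
      · rw [chiFour_of_even h2]; ring
      refine absurd ⟨(q.1 / 2, q.2 / 2), mem_oddFactorizations.mpr ?_, ?_⟩ hq'
      · simp only
        rw [show 2 * (q.1 / 2) + 1 = q.1 by omega, show 2 * (q.2 / 2) + 1 = q.2 by omega, hq.1]
      · ext <;> simp only <;> omega
    · rw [oddIndicator_of_odd (by omega), chiFour_of_odd (by omega), one_mul]
      congr 1
      omega

/-- Both sides are Σ r(n) exp(-πnt/4), r(n) being the number of primary Gaussian integers of norm n:
on the left by the divisor-sum formula, on the right because θ₂/2 runs over 4k + 1 and θ₃ over 2m.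
-/
theorem oddLambert_one_alternating {t : ℝ} (ht : 0 < t) :
    oddLambert (fun _ => 1) (fun j => (-1) ^ j) t = thetaTwo t * thetaThree t / 2 := by
  have h1 := (hasSum_oddLambert (f := fun _ => 1) (g := fun j : ℕ => (-1) ^ j) ht
    (fun i => by simp) fun _ => by simp).sum_fiberwise (fun p => (2 * p.1 + 1) * (2 * p.2 + 1))
      oddFactorizations fun n p => mem_oddFactorizations
  have h2 := (hasSum_thetaTwo_half ht).mul (hasSum_thetaThree ht)
    ((hasSum_thetaTwo_half ht).summable.mul_of_nonneg (hasSum_thetaThree ht).summable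
      (fun _ => (exp_pos _).le) fun _ => (exp_pos _).le)
  have h3 := hasSum_primaryOfNorm (f := fun α : GaussianInt => rexp (-(π / 4 * (α.norm : ℝ) * t)))
    (h2.congr_fun fun p => by
      rw [← exp_add, gaussianInt_norm_eq]
      push_cast
      ring_nf)
  rw [mul_div_right_comm]
  refine h1.unique (h3.congr_fun fun n => ?_)
  have e1 : ∀ p ∈ oddFactorizations n, 1 * (-1) ^ p.2 * oddExp t p =
      (-1) ^ p.2 * rexp (-(π / 4 * n * t)) := by
    intro p hp
    rw [one_mul, oddExp, ← mem_oddFactorizations.mp hp]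
    push_cast
    rfl
  have e2 : ∀ α ∈ primaryOfNorm n, rexp (-(π / 4 * (α.norm : ℝ) * t)) = rexp (-(π / 4 * n * t)) := by
    intro α hα
    rw [(mem_primaryOfNorm.mp hα).2.2]
    push_cast
    rfl
  rw [Finset.sum_congr rfl e1, Finset.sum_congr rfl e2, ← Finset.sum_mul, Finset.sum_const,
    nsmul_eq_mul]
  congr 1
  exact_mod_cast sum_oddFactorizations n

/-- The term of the lattice sum for the value of the `L`-function at `2`. -/
noncomputable def latticeTerm (p : ℤ × ℤ) : ℝ :=
  (4 * p.1 + 1) / ((4 * p.1 + 1) ^ 2 + (2 * p.2) ^ 2) ^ 2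

theorem latticeNorm_pos (p : ℤ × ℤ) : (0 : ℝ) < (4 * p.1 + 1) ^ 2 + (2 * p.2) ^ 2 := by
  have h : (4 * p.1 + 1 : ℝ) ≠ 0 := by
    have : 4 * p.1 + 1 ≠ 0 := by omega
    exact_mod_cast this
  positivity

/-- The term is at most r⁻³ for the sup norm r, and the lattice has rank two. -/
theorem summable_norm_latticeTerm : Summable fun p => ‖latticeTerm p‖ := by
  have h := (EisensteinSeries.summable_one_div_norm_rpow (k := 3) (by norm_num)).comp_injective
    (i := fun p : ℤ × ℤ => ![4 * p.1 + 1, 2 * p.2]) fun p q hpq => by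
      have h0 := congrFun hpq 0
      have h1 := congrFun hpq 1
      simp at h0 h1
      exact Prod.ext h0 h1
  refine h.of_nonneg_of_le (fun _ => norm_nonneg _) fun p => ?_
  simp only [Function.comp]
  set r := ‖![4 * p.1 + 1, 2 * p.2]‖ with hr
  have h0 : |(4 * p.1 + 1 : ℝ)| ≤ r := by
    have := norm_le_pi_norm (![4 * p.1 + 1, 2 * p.2]) 0
    simpa [Int.norm_eq_abs] using this
  have hN : r ^ 2 ≤ (4 * p.1 + 1 : ℝ) ^ 2 + (2 * p.2) ^ 2 := by
    have : r ≤ √((4 * p.1 + 1 : ℝ) ^ 2 + (2 * p.2) ^ 2) := by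
      refine (pi_norm_le_iff_of_nonneg (sqrt_nonneg _)).mpr fun i => ?_
      fin_cases i
      · refine le_sqrt_of_sq_le ?_
        simp [Int.norm_eq_abs]
        positivity
      · refine le_sqrt_of_sq_le ?_
        simpa [Int.norm_eq_abs, mul_pow] using sq_nonneg (4 * p.1 + 1 : ℝ)
    calc r ^ 2 ≤ √((4 * p.1 + 1 : ℝ) ^ 2 + (2 * p.2) ^ 2) ^ 2 := by gcongr
      _ = _ := sq_sqrt (latticeNorm_pos p).le
  have hx : (0 : ℝ) < |(4 * p.1 + 1 : ℝ)| := by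
    have : 4 * p.1 + 1 ≠ 0 := by omega
    exact abs_pos.mpr (by exact_mod_cast this)
  have hr0 : 0 < r := hx.trans_le h0
  rw [latticeTerm, norm_div, norm_eq_abs, norm_of_nonneg (by positivity), rpow_neg hr0.le,
    show (3 : ℝ) = (3 : ℕ) by norm_num, rpow_natCast]
  calc _ ≤ r / (r ^ 2) ^ 2 := by gcongr
    _ = _ := by field_simp

theorem integral_mul_exp {c : ℝ} (hc : 0 < c) :
    ∫ u in Ioi (0 : ℝ), u * rexp (-(c * u)) = 1 / c ^ 2 := by
  have := Real.integral_rpow_mul_exp_neg_mul_Ioi (a := 2) (r := c) (by norm_num) hc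
  rw [show (2 : ℝ) - 1 = 1 by norm_num, Gamma_two, mul_one, show (2 : ℝ) = (2 : ℕ) by norm_num,
    rpow_natCast, div_pow, one_pow] at this
  simpa using this

theorem integrableOn_mul_exp {c : ℝ} (hc : 0 < c) :
    IntegrableOn (fun u : ℝ => u * rexp (-(c * u))) (Ioi 0) := by
  have := integrableOn_rpow_mul_exp_neg_mul_rpow (p := 1) (s := 1) (b := c) (by norm_num) one_pos hc
  simpa using this

/-- Inversion turns the integrand into u θ₂θ₃²θ₄/4 at u. Written as (u/2)(θ₂θ₃θ₄/2)θ₃ it is a double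
series of terms u exp(-cu), each with integral 1/c². -/
theorem integral_oddLambert_inv_mul_self :
    ∫ u in Ioi (0 : ℝ), oddLambert (fun _ => 1) (fun j => (-1) ^ j) u⁻¹ *
      oddLambert (fun _ => 1) (fun j => (-1) ^ j) u = 8 / π ^ 2 * ∑' p, latticeTerm p := by
  have hc : ∀ p : ℤ × ℤ, 0 < π / 4 * ((4 * p.1 + 1 : ℝ) ^ 2 + (2 * p.2) ^ 2) := fun p =>
    mul_pos (by positivity) (latticeNorm_pos p)
  have key : ∀ u ∈ Ioi (0 : ℝ), oddLambert (fun _ => 1) (fun j => (-1) ^ j) u⁻¹ *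
      oddLambert (fun _ => 1) (fun j => (-1) ^ j) u = ∑' p : ℤ × ℤ, (4 * p.1 + 1) / 2 *
        (u * rexp (-(π / 4 * ((4 * p.1 + 1 : ℝ) ^ 2 + (2 * p.2) ^ 2) * u))) := by
    intro u hu
    have hu' : (0 : ℝ) < u := hu
    have h1 := hasSum_thetaTwo_mul_thetaThree_mul_thetaFour hu'
    have h2 := hasSum_thetaThree hu'
    have h3 := (h1.mul h2 (summable_mul_of_summable_norm h1.summable.norm h2.summable.norm)).mul_left
      (u / 2)
    rw [oddLambert_one_alternating hu', oddLambert_one_alternating (inv_pos.mpr hu'),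
      thetaTwo_inv hu', thetaThree_inv hu']
    have h4 : u / 2 * (thetaTwo u * thetaThree u * thetaFour u / 2 * thetaThree u) =
        √u * thetaFour u * (√u * thetaThree u) / 2 * (thetaTwo u * thetaThree u / 2) := by
      have := mul_self_sqrt hu'.le
      linear_combination -(thetaTwo u * thetaThree u * thetaFour u * thetaThree u / 4) * this
    rw [← h4, ← h3.tsum_eq]
    refine tsum_congr fun p => ?_
    have : rexp (-(π / 4 * ((4 * p.1 + 1 : ℝ) ^ 2 + (2 * p.2) ^ 2) * u)) =
        rexp (-(π / 4 * (4 * p.1 + 1) ^ 2 * u)) * rexp (-π * p.2 ^ 2 * u) := by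
      rw [← exp_add]; ring_nf
    rw [this]
    ring
  have hval : ∀ p : ℤ × ℤ, (4 * p.1 + 1 : ℝ) / 2 *
      (1 / (π / 4 * ((4 * p.1 + 1 : ℝ) ^ 2 + (2 * p.2) ^ 2)) ^ 2) = 8 / π ^ 2 * latticeTerm p := by
    intro p
    have := (latticeNorm_pos p).ne'
    rw [latticeTerm]
    field_simp
    ring
  rw [setIntegral_congr_fun measurableSet_Ioi key, ← tsum_mul_left]
  have h := hasSum_integral_of_summable_integral_norm (μ := volume.restrict (Ioi (0 : ℝ)))
    (F := fun (p : ℤ × ℤ) u => (4 * p.1 + 1) / 2 *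
        (u * rexp (-(π / 4 * ((4 * p.1 + 1 : ℝ) ^ 2 + (2 * p.2) ^ 2) * u))))
    (fun p => (integrableOn_mul_exp (hc p)).const_mul _) ?_
  · rw [← h.tsum_eq]
    refine tsum_congr fun p => ?_
    rw [integral_const_mul, integral_mul_exp (hc p), hval]
  · refine (summable_norm_latticeTerm.mul_left (8 / π ^ 2)).congr fun p => ?_
    have e : ∀ u ∈ Ioi (0 : ℝ), ‖(4 * p.1 + 1 : ℝ) / 2 *
        (u * rexp (-(π / 4 * ((4 * p.1 + 1 : ℝ) ^ 2 + (2 * p.2) ^ 2) * u)))‖ =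
        |(4 * p.1 + 1 : ℝ) / 2| *
          (u * rexp (-(π / 4 * ((4 * p.1 + 1 : ℝ) ^ 2 + (2 * p.2) ^ 2) * u))) := by
      intro u hu
      have hu' : (0 : ℝ) < u := hu
      rw [norm_mul, norm_eq_abs, norm_of_nonneg (by positivity)]
    rw [setIntegral_congr_fun measurableSet_Ioi e, integral_const_mul, integral_mul_exp (hc p),
      ← abs_of_pos (one_div_pos.mpr (pow_pos (hc p) 2)), ← abs_mul, hval, abs_mul,
      abs_of_pos (by positivity : 0 < 8 / π ^ 2), norm_eq_abs]

theorem hasSum_LSeries_term :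
    HasSum (LSeries.term (fun n : ℕ => ((curveE64.LFunction n : ℤ) : ℂ)) 2)
      ((∑' p, latticeTerm p : ℝ) : ℂ) := by
  have h := hasSum_primaryOfNorm (f := fun α : GaussianInt => (α.re : ℝ) / (α.norm : ℝ) ^ 2)
    (a := ∑' p, latticeTerm p) (summable_norm_latticeTerm.of_norm.hasSum.congr_fun fun p => by
      rw [gaussianInt_norm_eq, latticeTerm]
      push_cast
      ring)
  refine (Complex.hasSum_ofReal.mpr h).congr_fun fun n => ?_
  rcases eq_or_ne n 0 with rfl | hn
  · rw [LSeries.term_zero, Finset.sum_eq_zero, Complex.ofReal_zero]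
    intro α hα
    rw [(mem_primaryOfNorm.mp hα).2.2]
    simp
  · rw [LSeries.term_of_ne_zero hn, LFunction_curveE64_apply hn, Complex.ofReal_sum, Int.cast_sum,
      Finset.sum_div]
    refine Finset.sum_congr rfl fun α hα => ?_
    rw [(mem_primaryOfNorm.mp hα).2.2]
    push_cast
    rw [Complex.cpow_ofNat]

end LatticeSums

end

/-! ### The theta quotient as variable of integration -/

section

open Real Set MeasureTheory Filter Topology

section ModularParametrization

theorem oddLambert_comm (f g : ℕ → ℝ) (t : ℝ) : oddLambert f g t = oddLambert g f t := by
  rw [oddLambert, oddLambert, ← (Equiv.prodComm ℕ ℕ).tsum_eq]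
  refine tsum_congr fun p => ?_
  simp only [oddExp, Equiv.prodComm_apply, Prod.fst_swap, Prod.snd_swap]
  ring_nf

theorem hasDerivAt_tanh (x : ℝ) : HasDerivAt tanh (1 - tanh x ^ 2) x := by
  have h := (hasDerivAt_sinh x).div (hasDerivAt_cosh x) (cosh_pos x).ne'
  have e : (cosh x * cosh x - sinh x * sinh x) / cosh x ^ 2 = 1 - tanh x ^ 2 := by
    have := (cosh_pos x).ne'
    rw [tanh_eq_sinh_div_cosh]
    field_simp
  rw [e] at h
  exact h.congr_of_eventuallyEq (Eventually.of_forall fun y => tanh_eq_sinh_div_cosh y)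

variable {t : ℝ} (ht : 0 < t)
include ht

theorem hasDerivAt_thetaRatio : HasDerivAt thetaRatio
    (-(π / 2 * oddLambert (fun i => 1 * (2 * i + 1)) (fun _ => 1) t * (1 - thetaRatio t ^ 2))) t := by
  have h := (hasDerivAt_oddLambert (f := fun _ => 1) (g := fun _ => 1) (by simp) (by simp)
    ht).const_mul 2
  have h2 := (hasDerivAt_tanh _).comp t h
  rw [← thetaRatio_eq_tanh ht] at h2
  refine (h2.congr_deriv (by ring)).congr_of_eventuallyEq ?_
  filter_upwards [lt_mem_nhds ht] with s hs
  exact thetaRatio_eq_tanh hs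

/-- The derivative of v = θ₂/θ₃ is computed once through tanh and once through arctan; the
comparison relates the two series of weight two. -/
theorem deriv_thetaRatio_eq : -(π / 2 *
      oddLambert (fun i => 1 * (2 * i + 1)) (fun _ => 1) t * (1 - thetaRatio t ^ 2)) =
    -(π / 2 * oddLambert (fun i => (-1) ^ i * (2 * i + 1)) (fun j => (-1) ^ j) t *
      (1 + thetaRatio t ^ 2)) := by
  have h := (hasDerivAt_oddLambert (f := fun i => (-1) ^ i) (g := fun j => (-1) ^ j) (by simp)
    (by simp) ht).const_mul 2
  have h2 := (hasDerivAt_thetaRatio ht).arctan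
  have h3 := h2.unique (h.congr_of_eventuallyEq (by
    filter_upwards [lt_mem_nhds ht] with s hs
    exact arctan_thetaRatio hs))
  have h4 : 1 + thetaRatio t ^ 2 ≠ 0 := by positivity
  field_simp at h3 ⊢
  linear_combination (1 / 4) * h3

theorem thetaRatio_inv_eq_rpow : thetaRatio t⁻¹ = (1 - thetaRatio t ^ 4) ^ (1 / 4 : ℝ) := by
  rw [show 1 - thetaRatio t ^ 4 = thetaRatio t⁻¹ ^ 4 by linarith [thetaRatio_pow_four_add ht],
    show (1 / 4 : ℝ) = ((4 : ℕ) : ℝ)⁻¹ by norm_num,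
    pow_rpow_inv_natCast (thetaRatio_pos (inv_pos.mpr ht)).le (by norm_num)]

theorem oddLambert_weight_pos : 0 < oddLambert (fun i => 1 * (2 * i + 1)) (fun _ => 1) t := by
  have h := hasSum_oddLambert (f := fun i => 1 * (2 * i + 1)) (g := fun _ => 1) ht
    (fun i => by rw [one_mul, abs_of_pos (by positivity)]) (by simp)
  refine h.summable.tsum_pos (fun p => ?_) (0, 0) ?_
  · have := oddExp_pos t p
    positivity
  · have := oddExp_pos t (0, 0)
    positivity

omit ht

theorem strictAntiOn_thetaRatio : StrictAntiOn thetaRatio (Ioi 0) := by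
  refine strictAntiOn_of_deriv_neg (convex_Ioi 0)
    (fun t ht => (hasDerivAt_thetaRatio ht).continuousAt.continuousWithinAt) fun t ht => ?_
  rw [interior_Ioi] at ht
  have ht : 0 < t := ht
  rw [(hasDerivAt_thetaRatio ht).deriv, neg_lt_zero]
  have h1 := oddLambert_weight_pos ht
  have h2 : thetaRatio t ^ 2 < 1 :=
    pow_lt_one₀ (thetaRatio_pos ht).le (thetaRatio_lt_one ht) two_ne_zero
  have h3 : 0 < 1 - thetaRatio t ^ 2 := sub_pos.mpr h2
  positivity

theorem exists_thetaRatio_lt {y : ℝ} (hy : 0 < y) : ∃ t, 0 < t ∧ thetaRatio t < y := by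
  have h : Tendsto (fun t : ℝ => tanh (2 * oddLambert (fun _ => 1)
      (fun j => 1 / (2 * j + 1)) t)) atTop (𝓝 (tanh (2 * ∑' _ : ℕ × ℕ, 0))) := by
    refine ((hasDerivAt_tanh _).continuousAt.tendsto).comp (Tendsto.const_mul 2 ?_)
    refine tendsto_tsum_of_dominated_convergence (bound := fun p => (2 * p.1 + 1) * oddExp 1 p)
      (summable_weight_mul_oddExp one_pos) (fun p => ?_) ?_
    · rw [← mul_zero (1 * (1 / (2 * p.2 + 1 : ℝ)))]
      refine Tendsto.const_mul _ (tendsto_exp_neg_atTop_nhds_zero.comp ?_)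
      exact tendsto_id.const_mul_atTop (oddWeight_pos p)
    · filter_upwards [eventually_ge_atTop 1] with t ht p
      refine (abs_mul_oddExp_le (f := fun _ => 1) (g := fun j : ℕ => 1 / (2 * j + 1)) (fun i => ?_)
        (abs_div_odd_le (g := fun _ => 1) fun _ => by simp) p).trans
        (mul_le_mul_of_nonneg_left (oddExp_anti ht p) (by positivity))
      simp
  rw [tsum_zero, mul_zero, tanh_zero] at h
  obtain ⟨t, ht1, ht2⟩ := ((h.eventually (gt_mem_nhds hy)).and (eventually_gt_atTop 0)).exists
  exact ⟨t, ht2, by rwa [thetaRatio_eq_tanh ht2]⟩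

/-- The quotient tends to 0 at infinity. Values close to 1 come from inversion, v(1/s)⁴ = 1 - v(s)⁴,
and connectedness fills the interval. -/
theorem image_thetaRatio : thetaRatio '' Ioi 0 = Ioo 0 1 := by
  refine Subset.antisymm ?_ fun y hy => ?_
  · rintro _ ⟨t, ht, rfl⟩
    exact ⟨thetaRatio_pos ht, thetaRatio_lt_one ht⟩
  · have hconn : (thetaRatio '' Ioi 0).OrdConnected := (isPreconnected_Ioi.image _
      fun t ht => (hasDerivAt_thetaRatio ht).continuousAt.continuousWithinAt).ordConnected
    obtain ⟨t, ht, h1⟩ := exists_thetaRatio_lt hy.1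
    have hy4 : y ^ 4 < 1 := pow_lt_one₀ hy.1.le hy.2 (by norm_num)
    obtain ⟨s, hs, h2⟩ := exists_thetaRatio_lt (y := (1 - y ^ 4) ^ (1 / 4 : ℝ))
      (rpow_pos_of_pos (sub_pos.mpr hy4) _)
    have h3 : thetaRatio s ^ 4 < 1 - y ^ 4 := by
      calc thetaRatio s ^ 4 < ((1 - y ^ 4) ^ (1 / 4 : ℝ)) ^ 4 :=
            pow_lt_pow_left₀ h2 (thetaRatio_pos hs).le (by norm_num)
        _ = 1 - y ^ 4 := by
            rw [← rpow_natCast, ← rpow_mul (sub_pos.mpr hy4).le]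
            norm_num
    have h4 : y < thetaRatio s⁻¹ := by
      refine lt_of_pow_lt_pow_left₀ 4 (thetaRatio_pos (inv_pos.mpr hs)).le ?_
      linarith [thetaRatio_pow_four_add hs]
    exact hconn.out ⟨t, ht, rfl⟩ ⟨s⁻¹, inv_pos.mpr hs, rfl⟩ ⟨h1.le, h4.le⟩

theorem integral_artanh_add_arctan :
    ∫ v in Ioo (0 : ℝ) 1, (artanh ((1 - v ^ 4) ^ (1 / 4 : ℝ)) / (1 + v ^ 2) +
      arctan ((1 - v ^ 4) ^ (1 / 4 : ℝ)) / (1 - v ^ 2)) = 16 / π * ∑' p, latticeTerm p := by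
  have hε : ∀ i : ℕ, |((-1) ^ i : ℝ)| ≤ 1 := fun i => by simp
  have h1 : ∀ i : ℕ, |(1 : ℝ)| ≤ 1 := fun i => by simp
  -- The two choices of characters differ on the weight-zero side, artanh against arctan, but
  -- transform to the same integral.
  obtain ⟨i1, e1⟩ := integral_oddLambert_mul_oddLambert h1 h1 hε hε
  obtain ⟨i2, e2⟩ := integral_oddLambert_mul_oddLambert hε hε h1 h1
  simp_rw [oddLambert_comm (fun i => (-1) ^ i) fun _ => 1] at e2
  rw [integral_oddLambert_inv_mul_self] at e1 e2
  rw [← image_thetaRatio, integral_image_eq_integral_abs_deriv_smul measurableSet_Ioi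
    (fun t ht => (hasDerivAt_thetaRatio ht).hasDerivWithinAt) strictAntiOn_thetaRatio.injOn]
  have key : ∀ s ∈ Ioi (0 : ℝ), |(-(π / 2 * oddLambert (fun i => 1 * (2 * i + 1)) (fun _ => 1) s *
      (1 - thetaRatio s ^ 2)))| •
        (artanh ((1 - thetaRatio s ^ 4) ^ (1 / 4 : ℝ)) / (1 + thetaRatio s ^ 2) +
          arctan ((1 - thetaRatio s ^ 4) ^ (1 / 4 : ℝ)) / (1 - thetaRatio s ^ 2)) =
      π * (oddLambert (fun _ => 1) (fun j => 1 / (2 * j + 1)) s⁻¹ *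
          oddLambert (fun k => (-1) ^ k * (2 * k + 1)) (fun j => (-1) ^ j) s +
        oddLambert (fun i => (-1) ^ i) (fun j => (-1) ^ j / (2 * j + 1)) s⁻¹ *
          oddLambert (fun i => 1 * (2 * i + 1)) (fun _ => 1) s) := by
    intro s hs
    have hs : 0 < s := hs
    have hd := deriv_thetaRatio_eq hs
    have hpos := oddLambert_weight_pos hs
    have hv2 : thetaRatio s ^ 2 < 1 :=
      pow_lt_one₀ (thetaRatio_pos hs).le (thetaRatio_lt_one hs) two_ne_zero
    have hv3 : 0 < 1 - thetaRatio s ^ 2 := sub_pos.mpr hv2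
    have hv4 : 0 < 1 + thetaRatio s ^ 2 := by positivity
    rw [abs_neg, abs_of_pos (by positivity), ← thetaRatio_inv_eq_rpow hs,
      arctan_thetaRatio (inv_pos.mpr hs), thetaRatio_eq_tanh (inv_pos.mpr hs), artanh_tanh,
      smul_eq_mul, mul_add]
    have hd' := neg_injective hd
    -- The artanh term needs the derivative in its second form, so that the factor 1 + v² cancels;
    -- the arctan term keeps the form with 1 - v².
    conv_lhs =>
      arg 1
      rw [hd']
    field_simp
  rw [setIntegral_congr_fun measurableSet_Ioi key, integral_const_mul, integral_add i1 i2, e1, e2]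
  field_simp
  ring

end ModularParametrization

end

/-! ### Beta integrals and the hypergeometric series -/

section

open Real Set MeasureTheory

section Pochhammer

/-- The ratio `(a)_n / (2a)_n`. -/
noncomputable def pochhammerRatio (a : ℝ) (n : ℕ) : ℝ :=
  (ascPochhammer ℝ n).eval a / (ascPochhammer ℝ n).eval (2 * a)

theorem pochhammerRatio_succ (a : ℝ) (n : ℕ) :
    pochhammerRatio a (n + 1) = pochhammerRatio a n * ((a + n) / (2 * a + n)) := by
  rw [pochhammerRatio, pochhammerRatio, ascPochhammer_succ_eval, ascPochhammer_succ_eval,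
    mul_div_mul_comm]

theorem ascPochhammer_eval_add_one (a : ℝ) (n : ℕ) :
    (ascPochhammer ℝ n).eval (a + 1) * a = (ascPochhammer ℝ n).eval a * (a + n) := by
  induction n with
  | zero => simp
  | succ n ih =>
    rw [ascPochhammer_succ_eval, ascPochhammer_succ_eval]
    push_cast
    linear_combination (a + 1 + n) * ih

variable {a : ℝ} (ha : 0 < a)
include ha

theorem pochhammerRatio_pos (n : ℕ) : 0 < pochhammerRatio a n :=
  div_pos (ascPochhammer_pos n a ha) (ascPochhammer_pos n _ (by positivity))

/-- Comparison with a telescoping series: consecutive ratios differ by the ratio times a/(2a + n),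
and a/(a + n) ≤ 2a/(2a + n). -/
theorem summable_pochhammerRatio : Summable fun n : ℕ => pochhammerRatio a n * (a / (a + n)) := by
  refine summable_of_sum_range_le (c := 2 * pochhammerRatio a 0) (fun n => ?_) fun n => ?_
  · have := pochhammerRatio_pos ha n
    positivity
  · suffices h : ∑ i ∈ Finset.range n, pochhammerRatio a i * (a / (a + i)) ≤
        2 * (pochhammerRatio a 0 - pochhammerRatio a n) by
      linarith [pochhammerRatio_pos ha n]
    induction n with
    | zero => simp
    | succ n ih =>
      rw [Finset.sum_range_succ]
      have h : pochhammerRatio a n * (a / (a + n)) ≤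
          2 * (pochhammerRatio a n - pochhammerRatio a (n + 1)) := by
        rw [pochhammerRatio_succ a, show 2 * (pochhammerRatio a n - pochhammerRatio a n *
          ((a + n) / (2 * a + n))) = pochhammerRatio a n * (2 * a / (2 * a + n)) by
            field_simp; ring]
        refine mul_le_mul_of_nonneg_left ?_ (pochhammerRatio_pos ha n).le
        rw [div_le_div_iff₀ (by positivity) (by positivity)]
        have : 0 ≤ a * (n : ℝ) := by positivity
        nlinarith
      linarith

/-- The upper parameter 1 cancels n!, and (a)_n/(a + 1)_n collapses to a/(a + n). -/
theorem hypergeometricTerm_eq (n : ℕ) :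
    hypergeometricTerm₃F₂ a a 1 (2 * a) (a + 1) 1 n = pochhammerRatio a n * (a / (a + n)) := by
  have h1 := (ascPochhammer_pos n a ha).ne'
  have h2 := (ascPochhammer_pos n (2 * a) (by positivity)).ne'
  have h3 := (ascPochhammer_pos n (a + 1) (by positivity)).ne'
  have h4 : (n.factorial : ℝ) ≠ 0 := by positivity
  have h5 := ascPochhammer_eval_add_one a n
  have h6 : a + n ≠ 0 := by positivity
  rw [hypergeometricTerm₃F₂, pochhammerRatio, ascPochhammer_eval_one, one_pow]
  field_simp
  linear_combination -h5

theorem Gamma_add_nat (n : ℕ) : Gamma (n + a) = (ascPochhammer ℝ n).eval a * Gamma a := by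
  induction n with
  | zero => simp
  | succ n ih =>
    rw [ascPochhammer_succ_eval, Nat.cast_succ, show (n : ℝ) + 1 + a = (n + a) + 1 by ring,
      Gamma_add_one (by positivity), ih]
    ring

theorem beta_add_nat (n : ℕ) : ProbabilityTheory.beta a (n + a) =
    Gamma a ^ 2 / Gamma (2 * a) * pochhammerRatio a n := by
  have h1 := (ascPochhammer_pos n (2 * a) (by positivity)).ne'
  have h2 := (Gamma_pos_of_pos (by positivity : 0 < 2 * a)).ne'
  rw [ProbabilityTheory.beta, show a + (n + a) = n + 2 * a by ring, Gamma_add_nat ha,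
    Gamma_add_nat (by positivity : 0 < 2 * a), pochhammerRatio]
  field_simp

end Pochhammer

section BetaIntegral

/-- Both claims are read off from the total mass 1 of the beta distribution. -/
theorem integrableOn_and_integral_beta {a b : ℝ} (ha : 0 < a) (hb : 0 < b) :
    IntegrableOn (fun x : ℝ => x ^ (a - 1) * (1 - x) ^ (b - 1)) (Ioo 0 1) ∧
      ∫ x in Ioo (0 : ℝ) 1, x ^ (a - 1) * (1 - x) ^ (b - 1) = ProbabilityTheory.beta a b := by
  have hpos := ProbabilityTheory.beta_pos ha hb
  have h := ProbabilityTheory.lintegral_betaPDF_eq_one ha hb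
  rw [ProbabilityTheory.lintegral_betaPDF] at h
  set g : ℝ → ℝ := fun x => 1 / ProbabilityTheory.beta a b * x ^ (a - 1) * (1 - x) ^ (b - 1) with hg
  have hm : AEStronglyMeasurable g (volume.restrict (Ioo 0 1)) := by
    have : Measurable g := by fun_prop
    exact this.aestronglyMeasurable
  have hnn : 0 ≤ᵐ[volume.restrict (Ioo 0 1)] g := by
    filter_upwards [self_mem_ae_restrict measurableSet_Ioo] with x hx
    have h1 := rpow_pos_of_pos hx.1 (a - 1)
    have h2 := rpow_pos_of_pos (sub_pos.mpr hx.2) (b - 1)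
    simp only [hg, Pi.zero_apply]
    positivity
  have hi : IntegrableOn g (Ioo 0 1) :=
    (lintegral_ofReal_ne_top_iff_integrable hm hnn).mp (by rw [h]; exact ENNReal.one_ne_top)
  have hv : ∫ x in Ioo (0 : ℝ) 1, g x = 1 := by
    rw [integral_eq_lintegral_of_nonneg_ae hnn hm, h, ENNReal.toReal_one]
  have e : (fun x : ℝ => x ^ (a - 1) * (1 - x) ^ (b - 1)) =
      fun x => ProbabilityTheory.beta a b * g x := by
    funext x
    simp only [hg]
    field_simp
  rw [e, integral_const_mul, hv, mul_one]
  exact ⟨hi.const_mul _, rfl⟩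

theorem image_pow_four : (fun v : ℝ => v ^ 4) '' Ioo 0 1 = Ioo 0 1 := by
  ext x
  constructor
  · rintro ⟨v, hv, rfl⟩
    exact ⟨pow_pos hv.1 4, pow_lt_one₀ hv.1.le hv.2 (by norm_num)⟩
  · intro hx
    refine ⟨x ^ (1 / 4 : ℝ), ⟨rpow_pos_of_pos hx.1 _, rpow_lt_one hx.1.le hx.2 (by norm_num)⟩, ?_⟩
    change (x ^ (1 / 4 : ℝ)) ^ 4 = x
    rw [← rpow_natCast, ← rpow_mul hx.1.le]
    norm_num

theorem integrableOn_and_integral_beta_pow_four {a b : ℝ} (ha : 0 < a) (hb : 0 < b) :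
    IntegrableOn (fun v : ℝ => v ^ (4 * a - 1) * (1 - v ^ 4) ^ (b - 1)) (Ioo 0 1) ∧
      ∫ v in Ioo (0 : ℝ) 1, v ^ (4 * a - 1) * (1 - v ^ 4) ^ (b - 1) =
        ProbabilityTheory.beta a b / 4 := by
  obtain ⟨h1, h2⟩ := integrableOn_and_integral_beta ha hb
  have hd : ∀ v ∈ Ioo (0 : ℝ) 1, HasDerivWithinAt (fun v : ℝ => v ^ 4) (4 * v ^ 3) (Ioo 0 1) v :=
    fun v _ => by simpa using (hasDerivAt_pow 4 v).hasDerivWithinAt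
  have hinj : InjOn (fun v : ℝ => v ^ 4) (Ioo 0 1) := fun x hx y hy h =>
    (pow_left_inj₀ hx.1.le hy.1.le (by norm_num)).mp h
  have e : ∀ v ∈ Ioo (0 : ℝ) 1, |4 * v ^ 3| • ((v ^ 4) ^ (a - 1) * (1 - v ^ 4) ^ (b - 1)) =
      4 * (v ^ (4 * a - 1) * (1 - v ^ 4) ^ (b - 1)) := by
    intro v hv
    rw [abs_of_pos (by have := hv.1; positivity), smul_eq_mul]
    have : v ^ (4 * a - 1) = v ^ 3 * (v ^ 4) ^ (a - 1) := by
      rw [← rpow_natCast, ← rpow_natCast, ← rpow_mul hv.1.le, ← rpow_add hv.1]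
      congr 1
      push_cast
      ring
    rw [this]
    ring
  rw [← image_pow_four, integrableOn_image_iff_integrableOn_abs_deriv_smul measurableSet_Ioo hd hinj,
    integrableOn_congr_fun e measurableSet_Ioo] at h1
  rw [← image_pow_four, integral_image_eq_integral_abs_deriv_smul measurableSet_Ioo hd hinj,
    setIntegral_congr_fun measurableSet_Ioo e, integral_const_mul] at h2
  refine ⟨?_, by linarith⟩
  have := h1.const_mul (1 / 4)
  simpa [← mul_assoc, IntegrableOn] using this

end BetaIntegral

section Series

/-- The `n`-th term of the expansion of the integrand in powers of `(1 - v⁴)^(1/4)`. -/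
noncomputable def integrandTerm (n : ℕ) (v : ℝ) : ℝ :=
  ((1 - v ^ 4) ^ (1 / 4 : ℝ)) ^ (2 * n + 1) / (2 * n + 1) *
    (1 / (1 + v ^ 2) + (-1) ^ n / (1 - v ^ 2))

theorem hasSum_artanh {x : ℝ} (hx0 : 0 ≤ x) (hx : x < 1) :
    HasSum (fun n : ℕ => x ^ (2 * n + 1) / (2 * n + 1)) (artanh x) := by
  have h := (hasSum_log_sub_log_of_abs_lt_one (abs_lt.mpr ⟨by linarith, hx⟩)).mul_left (1 / 2)
  rw [← log_div (by linarith) (by linarith), ← artanh_eq_half_log ⟨by linarith, hx.le⟩] at h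
  exact h.congr_fun fun n => by ring

theorem hasSum_integrandTerm {v : ℝ} (hv : v ∈ Ioo (0 : ℝ) 1) :
    HasSum (fun n => integrandTerm n v) (artanh ((1 - v ^ 4) ^ (1 / 4 : ℝ)) / (1 + v ^ 2) +
      arctan ((1 - v ^ 4) ^ (1 / 4 : ℝ)) / (1 - v ^ 2)) := by
  have h4 : v ^ 4 < 1 := pow_lt_one₀ hv.1.le hv.2 (by norm_num)
  have h4' : 0 < v ^ 4 := pow_pos hv.1 4
  have hw0 : 0 ≤ (1 - v ^ 4) ^ (1 / 4 : ℝ) := rpow_nonneg (by linarith) _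
  have hw1 : (1 - v ^ 4) ^ (1 / 4 : ℝ) < 1 :=
    rpow_lt_one (by linarith) (by linarith) (by norm_num)
  refine (((hasSum_artanh hw0 hw1).div_const (1 + v ^ 2)).add
    ((Real.hasSum_arctan (by rwa [norm_of_nonneg hw0])).div_const (1 - v ^ 2))).congr_fun fun n => ?_
  rw [integrandTerm]
  push_cast
  ring

theorem rpow_quarter_pow {x : ℝ} (hx : 0 < x) (n : ℕ) (b : ℝ) (hb : (n : ℝ) = 4 * b) :
    (x ^ (1 / 4 : ℝ)) ^ n = x * x ^ (b - 1) := by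
  rw [← rpow_natCast, ← rpow_mul hx.le, hb]
  nth_rewrite 2 [← rpow_one x]
  rw [← rpow_add hx]
  congr 1
  ring

/-- Here 1/(1 + v²) + 1/(1 - v²) = 2/(1 - v⁴). The exponent of v is 0, written as 4·(1/4) - 1 to
match a beta integral in v⁴. -/
theorem integrandTerm_even {v : ℝ} (hv : v ∈ Ioo (0 : ℝ) 1) (k : ℕ) :
    integrandTerm (2 * k) v =
      2 / (4 * k + 1) * (v ^ (4 * (1 / 4) - 1 : ℝ) * (1 - v ^ 4) ^ ((k + 1 / 4 : ℝ) - 1)) := by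
  have h2 : v ^ 2 < 1 := pow_lt_one₀ hv.1.le hv.2 (by norm_num)
  have h4 : 0 < 1 - v ^ 4 := sub_pos.mpr (pow_lt_one₀ hv.1.le hv.2 (by norm_num))
  have h2' : 1 - v ^ 2 ≠ 0 := (sub_pos.mpr h2).ne'
  rw [integrandTerm, rpow_quarter_pow h4 _ (k + 1 / 4) (by push_cast; ring),
    show (4 * (1 / 4) - 1 : ℝ) = 0 by norm_num, rpow_zero, (even_two_mul k).neg_one_pow]
  push_cast
  field_simp
  ring

/-- Here the difference is -2v²/(1 - v⁴), so v has exponent 2 = 4·(3/4) - 1. -/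
theorem integrandTerm_odd {v : ℝ} (hv : v ∈ Ioo (0 : ℝ) 1) (k : ℕ) :
    integrandTerm (2 * k + 1) v =
      -2 / (4 * k + 3) * (v ^ (4 * (3 / 4) - 1 : ℝ) * (1 - v ^ 4) ^ ((k + 3 / 4 : ℝ) - 1)) := by
  have h2 : v ^ 2 < 1 := pow_lt_one₀ hv.1.le hv.2 (by norm_num)
  have h4 : 0 < 1 - v ^ 4 := sub_pos.mpr (pow_lt_one₀ hv.1.le hv.2 (by norm_num))
  have h2' : 1 - v ^ 2 ≠ 0 := (sub_pos.mpr h2).ne'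
  rw [integrandTerm, rpow_quarter_pow h4 _ (k + 3 / 4) (by push_cast; ring),
    show (4 * (3 / 4) - 1 : ℝ) = (2 : ℕ) by norm_num, rpow_natCast, Odd.neg_one_pow ⟨k, rfl⟩]
  push_cast
  field_simp
  ring

theorem integrableOn_const_mul_beta {a b : ℝ} (ha : 0 < a) (hb : 0 < b) (c : ℝ) {f : ℝ → ℝ}
    (hf : ∀ v ∈ Ioo (0 : ℝ) 1, f v = c * (v ^ (4 * a - 1) * (1 - v ^ 4) ^ (b - 1))) :
    IntegrableOn f (Ioo 0 1) ∧
      ∫ v in Ioo (0 : ℝ) 1, f v = c * (ProbabilityTheory.beta a b / 4) ∧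
      ∫ v in Ioo (0 : ℝ) 1, ‖f v‖ = |c| * (ProbabilityTheory.beta a b / 4) := by
  obtain ⟨h1, h2⟩ := integrableOn_and_integral_beta_pow_four ha hb
  have hf' : ∀ v ∈ Ioo (0 : ℝ) 1, ‖f v‖ = |c| * (v ^ (4 * a - 1) * (1 - v ^ 4) ^ (b - 1)) := by
    intro v hv
    have h4 : 0 < 1 - v ^ 4 := sub_pos.mpr (pow_lt_one₀ hv.1.le hv.2 (by norm_num))
    rw [hf v hv, norm_mul, norm_eq_abs, norm_of_nonneg
      (mul_pos (rpow_pos_of_pos hv.1 _) (rpow_pos_of_pos h4 _)).le]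
  refine ⟨(integrableOn_congr_fun hf measurableSet_Ioo).mpr (h1.const_mul c), ?_, ?_⟩
  · rw [setIntegral_congr_fun measurableSet_Ioo hf, integral_const_mul, h2]
  · rw [setIntegral_congr_fun measurableSet_Ioo hf', integral_const_mul, h2]

theorem integral_integrandTerm_even (k : ℕ) : IntegrableOn (integrandTerm (2 * k)) (Ioo 0 1) ∧
    ∫ v in Ioo (0 : ℝ) 1, integrandTerm (2 * k) v = Gamma (1 / 4) ^ 2 / Gamma (2 * (1 / 4)) / 2 *
      (pochhammerRatio (1 / 4) k * (1 / 4 / (1 / 4 + k))) ∧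
    ∫ v in Ioo (0 : ℝ) 1, ‖integrandTerm (2 * k) v‖ =
      Gamma (1 / 4) ^ 2 / Gamma (2 * (1 / 4)) / 2 *
        (pochhammerRatio (1 / 4) k * (1 / 4 / (1 / 4 + k))) := by
  obtain ⟨h1, h2, h3⟩ := integrableOn_const_mul_beta (a := 1 / 4) (b := k + 1 / 4) (by norm_num)
    (by positivity) (2 / (4 * k + 1)) fun v hv => integrandTerm_even hv k
  have e : 2 / (4 * k + 1) * (Gamma (1 / 4) ^ 2 / Gamma (2 * (1 / 4)) *
      pochhammerRatio (1 / 4) k / 4) = Gamma (1 / 4) ^ 2 / Gamma (2 * (1 / 4)) / 2 *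
        (pochhammerRatio (1 / 4) k * (1 / 4 / (1 / 4 + k))) := by
    rw [show (1 / 4 / (1 / 4 + k) : ℝ) = 1 / (4 * k + 1) by field_simp; ring]
    ring
  rw [abs_of_pos (by positivity)] at h3
  rw [h2, h3, beta_add_nat (by norm_num), e]
  exact ⟨h1, rfl, rfl⟩

theorem integral_integrandTerm_odd (k : ℕ) : IntegrableOn (integrandTerm (2 * k + 1)) (Ioo 0 1) ∧
    ∫ v in Ioo (0 : ℝ) 1, integrandTerm (2 * k + 1) v =
      -(Gamma (3 / 4) ^ 2 / Gamma (2 * (3 / 4)) / 6) *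
        (pochhammerRatio (3 / 4) k * (3 / 4 / (3 / 4 + k))) ∧
    ∫ v in Ioo (0 : ℝ) 1, ‖integrandTerm (2 * k + 1) v‖ =
      Gamma (3 / 4) ^ 2 / Gamma (2 * (3 / 4)) / 6 *
        (pochhammerRatio (3 / 4) k * (3 / 4 / (3 / 4 + k))) := by
  obtain ⟨h1, h2, h3⟩ := integrableOn_const_mul_beta (a := 3 / 4) (b := k + 3 / 4) (by norm_num)
    (by positivity) (-2 / (4 * k + 3)) fun v hv => integrandTerm_odd hv k
  have e : 2 / (4 * k + 3) * (Gamma (3 / 4) ^ 2 / Gamma (2 * (3 / 4)) *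
      pochhammerRatio (3 / 4) k / 4) = Gamma (3 / 4) ^ 2 / Gamma (2 * (3 / 4)) / 6 *
        (pochhammerRatio (3 / 4) k * (3 / 4 / (3 / 4 + k))) := by
    rw [show (3 / 4 / (3 / 4 + k) : ℝ) = 3 / (4 * k + 3) by field_simp; ring]
    ring
  rw [neg_div, abs_neg, abs_of_pos (by positivity)] at h3
  rw [h2, h3, beta_add_nat (by norm_num), neg_div, neg_mul, neg_mul, e]
  exact ⟨h1, rfl, rfl⟩

/-- All terms of one parity have constant sign, so the integrals of their absolute values are, up to
sign, the hypergeometric terms; their summability justifies the interchange. -/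
theorem integral_artanh_add_arctan_eq :
    ∫ v in Ioo (0 : ℝ) 1, (artanh ((1 - v ^ 4) ^ (1 / 4 : ℝ)) / (1 + v ^ 2) +
      arctan ((1 - v ^ 4) ^ (1 / 4 : ℝ)) / (1 - v ^ 2)) =
    Gamma (1 / 4) ^ 2 / Gamma (2 * (1 / 4)) / 2 *
        ∑' k : ℕ, pochhammerRatio (1 / 4) k * (1 / 4 / (1 / 4 + k)) -
      Gamma (3 / 4) ^ 2 / Gamma (2 * (3 / 4)) / 6 *
        ∑' k : ℕ, pochhammerRatio (3 / 4) k * (3 / 4 / (3 / 4 + k)) := by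
  have s1 := summable_pochhammerRatio (a := 1 / 4) (by norm_num)
  have s3 := summable_pochhammerRatio (a := 3 / 4) (by norm_num)
  have hi : ∀ n, IntegrableOn (integrandTerm n) (Ioo 0 1) := by
    intro n
    rcases Nat.even_or_odd' n with ⟨k, rfl | rfl⟩
    · exact (integral_integrandTerm_even k).1
    · exact (integral_integrandTerm_odd k).1
  have hs : Summable fun n => ∫ v in Ioo (0 : ℝ) 1, ‖integrandTerm n v‖ :=
    (HasSum.even_add_odd
      ((s1.hasSum.mul_left _).congr_fun fun k => (integral_integrandTerm_even k).2.2)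
      ((s3.hasSum.mul_left _).congr_fun fun k => (integral_integrandTerm_odd k).2.2)).summable
  have h := hasSum_integral_of_summable_integral_norm hi hs
  rw [setIntegral_congr_fun measurableSet_Ioo fun v hv => (hasSum_integrandTerm hv).tsum_eq] at h
  rw [sub_eq_add_neg, ← neg_mul]
  exact h.unique (HasSum.even_add_odd
    ((s1.hasSum.mul_left _).congr_fun fun k => (integral_integrandTerm_even k).2.1)
    ((s3.hasSum.mul_left _).congr_fun fun k => (integral_integrandTerm_odd k).2.1))

end Series

end


/-! ### The evaluation of L(E, 2) -/

theorem theorem2p7 :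
    LSeriesSummable (fun n : ℕ => ((curveE64.LFunction n : ℤ) : ℂ)) 2 ∧
    Summable (hypergeometricTerm₃F₂ (1 / 4) (1 / 4) 1 (1 / 2) (5 / 4) 1) ∧
    Summable (hypergeometricTerm₃F₂ (3 / 4) (3 / 4) 1 (3 / 2) (7 / 4) 1) ∧
    curveE64.LSeries 2 =
      ((√Real.pi * Real.Gamma (1 / 4) ^ 2 / 32 *
            hypergeometric₃F₂ (1 / 4) (1 / 4) 1 (1 / 2) (5 / 4) 1 -
          √Real.pi * Real.Gamma (3 / 4) ^ 2 / 48 *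
            hypergeometric₃F₂ (3 / 4) (3 / 4) 1 (3 / 2) (7 / 4) 1 : ℝ) : ℂ) := by
  have s1 := summable_pochhammerRatio (a := 1 / 4) (by norm_num)
  have s3 := summable_pochhammerRatio (a := 3 / 4) (by norm_num)
  have e1 : hypergeometricTerm₃F₂ (1 / 4) (1 / 4) 1 (1 / 2) (5 / 4) 1 =
      fun n : ℕ => pochhammerRatio (1 / 4) n * (1 / 4 / (1 / 4 + n)) := by
    funext n
    rw [← hypergeometricTerm_eq (by norm_num)]
    norm_num
  have e3 : hypergeometricTerm₃F₂ (3 / 4) (3 / 4) 1 (3 / 2) (7 / 4) 1 =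
      fun n : ℕ => pochhammerRatio (3 / 4) n * (3 / 4 / (3 / 4 + n)) := by
    funext n
    rw [← hypergeometricTerm_eq (by norm_num)]
    norm_num
  refine ⟨hasSum_LSeries_term.summable, e1 ▸ s1, e3 ▸ s3, ?_⟩
  refine hasSum_LSeries_term.tsum_eq.trans ?_
  rw [hypergeometric₃F₂, hypergeometric₃F₂, e1, e3]
  congr 1
  have h := integral_artanh_add_arctan_eq
  have g1 : Real.Gamma (2 * (1 / 4)) = √Real.pi := by
    rw [← Real.Gamma_one_half_eq]; norm_num
  have g3 : Real.Gamma (2 * (3 / 4)) = √Real.pi / 2 := by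
    rw [show (2 * (3 / 4) : ℝ) = 1 / 2 + 1 by norm_num, Real.Gamma_add_one (by norm_num),
      Real.Gamma_one_half_eq]
    ring
  rw [integral_artanh_add_arctan, g1, g3] at h
  have hpi : √Real.pi ≠ 0 := (Real.sqrt_pos.mpr Real.pi_pos).ne'
  have hsq : √Real.pi * √Real.pi = Real.pi := Real.mul_self_sqrt Real.pi_pos.le
  -- Writing π as the square of √π turns the comparison of the two evaluations into a rational
  -- identity in r = √π.
  rw [show 16 / Real.pi = 16 / (√Real.pi * √Real.pi) by rw [hsq]] at h
  generalize √Real.pi = r at h hpi ⊢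
  generalize (∑' k : ℕ, pochhammerRatio (1 / 4) k * (1 / 4 / (1 / 4 + k))) = x at h ⊢
  generalize (∑' k : ℕ, pochhammerRatio (3 / 4) k * (3 / 4 / (3 / 4 + k))) = y at h ⊢
  field_simp at h
  linear_combination h / 192
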